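/- Let $\mathsf{k}$ be a perfect field of odd characteristic $p$, and let $\mathcal{F}$ be a purely transcendental extension of $\mathsf{k}$ of finite transcendence degree $n$. A seed for $\mathcal{F}$ consists of a quiver on $n$ vertices without loops or directed 2-cycles, a set of frozen vertices containing every vertex that touches no arrow, and a cluster $\mathbf{x}=(x_1,\dots,x_n)$ of algebraically independent generators of the field $\mathcal{F}$ over $\mathsf{k}$. A seed is mutated at a non-frozen vertex $v$ by the usual quiver mutation and by replacing $x_v$ with $x_v^{-1}\bigl(\prod_{i\to v}x_i+\prod_{v\to i}x_i\bigr)$. Let $\mathcal{U}=\bigcap_{\mathbf{x}}L_{\mathbf{x}}\subseteq\mathcal{F}$, with $L_{\mathbf{x}}=\mathsf{k}[x_1^{\pm1},\dots,x_n^{\pm1}]$, be the upper cluster algebra of a seed, where $\mathbf{x}$ runs over the clusters of all seeds obtained from it by mutations. Let $\mathcal{U}^{1/p}$ be the ring of $p$-th roots of $\mathcal{U}$, a $\mathcal{U}$-algebra by Frobenius. The cluster splitting $\phi:\mathcal{U}^{1/p}\to\mathcal{U}$ is the $\mathcal{U}$-linear map that is, for every cluster $\mathbf{x}$, the restriction of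 the standard splitting $L_{\mathbf{x}}^{1/p}\to L_{\mathbf{x}}$, which sends $(\lambda\mathbf{x}^a)^{1/p}$ to $\lambda^{1/p}\mathbf{x}^{a/p}$ if $a\in p\mathbb{Z}^n$ and to $0$ otherwise. Put $\omega_{\mathcal{U}/\mathsf{k}}=(\Lambda^n_{\mathcal{U}}\Omega_{\mathcal{U}/\mathsf{k}})^{**}$, with its natural embedding in $\Lambda^n_{\mathcal{F}}\Omega_{\mathcal{F}/\mathsf{k}}$, and $(\omega_{\mathcal{U}/\mathsf{k}})^{1-p}=\bigl((\Lambda^n_{\mathcal{U}}\Omega_{\mathcal{U}/\mathsf{k}})^{*}\bigr)^{\otimes(p-1)}$. The log volume forms are the forms $\pm\frac{dx_1\wedge\cdots\wedge dx_n}{x_1\cdots x_n}\in\Lambda^n_{\mathcal{F}}\Omega_{\mathcal{F}/\mathsf{k}}$ for the clusters $\mathbf{x}$ (in any order). There is exactly one Cartier operator $\tau$ on $\Lambda^n_{\mathcal{F}}\Omega_{\mathcal{F}/\mathsf{k}}$: an additive map with $\tau(a^p\eta)=a\,\tau(\eta)$ that vanishes on exact forms and sends $(a_1\cdots a_n)^{p-1}da_1\wedge\cdots\wedge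 da_n$ to $da_1\wedge\cdots\wedge da_n$. There is exactly one additive bijection (the duality isomorphism) $$\Phi:(\omega_{\mathcal{U}/\mathsf{k}})^{1-p}\xrightarrow{\ \sim\ }\operatorname{Hom}_{\mathcal{U}}(\mathcal{U}^{1/p},\mathcal{U})$$ that satisfies $\Phi(u\sigma)(y)=\Phi(\sigma)(u^{1/p}y)$ and $\Phi(\sigma)(u^{1/p})\,\eta=\tau\bigl(u\,\sigma(\eta^{\otimes(p-1)})\,\eta\bigr)$ for all $u\in\mathcal{U}$, $y\in\mathcal{U}^{1/p}$, $\sigma\in(\omega_{\mathcal{U}/\mathsf{k}})^{1-p}$, and $\eta\in\Lambda^n_{\mathcal{U}}\Omega_{\mathcal{U}/\mathsf{k}}$ (the second equation is in $\Lambda^n_{\mathcal{F}}\Omega_{\mathcal{F}/\mathsf{k}}$). Every log volume form is the image of exactly one $\mu\in\omega_{\mathcal{U}/\mathsf{k}}$. For this $\mu$ there is exactly one $\mu^{-1}\in(\Lambda^n_{\mathcal{U}}\Omega_{\mathcal{U}/\mathsf{k}})^{*}$ with $\mu(\mu^{-1})=1$, and with $\mu^{1-p}:=(\mu^{-1})^{\otimes(p-1)}$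 the map $\Phi(\mu^{1-p})$ is the cluster splitting $\phi$. -/

import Mathlib

open scoped KaehlerDifferential TensorProduct

/-! ## Quivers, seeds and mutation -/

/-- A quiver on the vertices `0, …, n - 1`, given by the number of arrows `i → j`, without loops and
without directed 2-cycles, together with a set of frozen vertices.  A vertex that touches no arrow
is frozen.  The vertices that are not frozen are the mutable ones. -/
@[ext]
structure IceQuiver (n : ℕ) where
  arrows : Fin n → Fin n → ℕ
  loopless : ∀ i, arrows i i = 0
  no_two_cycle : ∀ i j, arrows i j = 0 ∨ arrows j i = 0
  frozen : Set (Fin n)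
  isolated_frozen : ∀ i, (∀ j, arrows i j = 0 ∧ arrows j i = 0) → i ∈ frozen

namespace IceQuiver

variable {n : ℕ}

/-- Step 1: for each pair of arrows `i → v → j` add an arrow `i → j`. -/
def addComposites (a : Fin n → Fin n → ℕ) (v : Fin n) : Fin n → Fin n → ℕ :=
  fun i j => a i j + a i v * a v j

/-- Step 2: reverse every arrow incident to `v`. -/
def reverseAt (a : Fin n → Fin n → ℕ) (v : Fin n) : Fin n → Fin n → ℕ :=
  fun i j => if i = v ∨ j = v then a j i else a i j

/-- Step 3: cancel directed 2-cycles in pairs (the subtraction is truncated). -/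
def cancelTwoCycles (a : Fin n → Fin n → ℕ) : Fin n → Fin n → ℕ :=
  fun i j => a i j - a j i

/-- The numbers of arrows of the mutation at `v`. -/
def mutateArrows (a : Fin n → Fin n → ℕ) (v : Fin n) : Fin n → Fin n → ℕ :=
  cancelTwoCycles (reverseAt (addComposites a v) v)

/-- Mutation of a quiver at the vertex `v`; frozen vertices stay frozen. -/
def mutate (Q : IceQuiver n) (v : Fin n) : IceQuiver n where
  arrows := mutateArrows Q.arrows v
  loopless i := by simp [mutateArrows, cancelTwoCycles]
  no_two_cycle i j := by
    simp only [mutateArrows, cancelTwoCycles]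
    omega
  frozen := Q.frozen
  isolated_frozen i hi := by
    apply Q.isolated_frozen
    have hv : Q.arrows i v = 0 ∧ Q.arrows v i = 0 := by
      have h := hi v
      have h2 := Q.no_two_cycle i v
      simp only [mutateArrows, cancelTwoCycles, reverseAt, addComposites, Q.loopless] at h
      simp at h
      omega
    intro j
    have h := hi j
    have h2 := Q.no_two_cycle i j
    by_cases hj : j = v
    · subst hj; exact hv
    by_cases hi' : i = v
    · subst hi'
      simp only [mutateArrows, cancelTwoCycles, reverseAt, addComposites, Q.loopless] at h
      simp at h
      omega
    · simp [mutateArrows, cancelTwoCycles, reverseAt, addComposites, hv, hj, hi'] at h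
      omega

end IceQuiver

section Mutation

variable {k F : Type*} [Field k] [Field F] [Algebra k F] {n : ℕ}

/-- The sum of the two monomials in the exchange relation at `v`: the products of the `x i` over all
arrows `i → v` and over all arrows `v → i`. -/
def exchangeNumerator (Q : IceQuiver n) (x : Fin n → F) (v : Fin n) : F :=
  ∏ i, x i ^ Q.arrows i v + ∏ i, x i ^ Q.arrows v i

/-- The cluster obtained by replacing `x v` with the new cluster variable at `v`. -/
def mutateCluster (Q : IceQuiver n) (x : Fin n → F) (v : Fin n) : Fin n → F :=
  Function.update x v (exchangeNumerator Q x v * (x v)⁻¹)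

theorem exchangeNumerator_ne_zero (Q : IceQuiver n) {x : Fin n → F}
    (hx : AlgebraicIndependent k x) {v : Fin n} (hv : v ∉ Q.frozen) :
    exchangeNumerator Q x v ≠ 0 := by
  classical
  let e₁ : Fin n →₀ ℕ := Finsupp.equivFunOnFinite.symm fun i => Q.arrows i v
  let e₂ : Fin n →₀ ℕ := Finsupp.equivFunOnFinite.symm fun i => Q.arrows v i
  have hne : e₁ ≠ e₂ := by
    intro h
    apply hv
    apply Q.isolated_frozen
    intro j
    have h1 : Q.arrows j v = Q.arrows v j := DFunLike.congr_fun h j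
    have := Q.no_two_cycle j v
    omega
  have key : MvPolynomial.aeval x
      (MvPolynomial.monomial e₁ (1 : k) + MvPolynomial.monomial e₂ (1 : k)) =
      exchangeNumerator Q x v := by
    simp [MvPolynomial.aeval_monomial, exchangeNumerator, e₁, e₂, Finsupp.prod_fintype]
  rw [← key]
  intro h0
  have h1 := (injective_iff_map_eq_zero _).1 hx _ h0
  have h2 := congrArg (MvPolynomial.coeff e₁) h1
  simp [MvPolynomial.coeff_add, MvPolynomial.coeff_monomial, hne.symm] at h2

theorem adjoin_mutateCluster (Q : IceQuiver n) {x : Fin n → F}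
    (hx : AlgebraicIndependent k x) (hg : IntermediateField.adjoin k (Set.range x) = ⊤)
    {v : Fin n} (hv : v ∉ Q.frozen) :
    IntermediateField.adjoin k (Set.range (mutateCluster Q x v)) = ⊤ := by
  rw [eq_top_iff, ← hg, IntermediateField.adjoin_le_iff]
  set K := IntermediateField.adjoin k (Set.range (mutateCluster Q x v)) with hK
  have hmem : ∀ i, mutateCluster Q x v i ∈ K := fun i =>
    IntermediateField.subset_adjoin _ _ ⟨i, rfl⟩
  have hne : ∀ i, i ≠ v → x i ∈ K := fun i hi => by
    simpa [mutateCluster, Function.update_of_ne hi] using hmem i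
  have hP : exchangeNumerator Q x v ∈ K := by
    have h : ∀ i (e : ℕ), (i = v → e = 0) → x i ^ e ∈ K := fun i e he => by
      by_cases hi : i = v
      · rw [he hi, pow_zero]; exact one_mem _
      · exact pow_mem (hne i hi) _
    refine add_mem (prod_mem fun i _ => h i _ ?_) (prod_mem fun i _ => h i _ ?_) <;>
    · rintro rfl; exact Q.loopless _
  rintro _ ⟨i, rfl⟩
  by_cases hi : i = v
  · subst hi
    have h1 := hmem i
    have h0 := exchangeNumerator_ne_zero Q hx hv
    have h2 := mul_mem hP (inv_mem h1)
    have : exchangeNumerator Q x i * (mutateCluster Q x i i)⁻¹ = x i := by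
      simp only [mutateCluster, Function.update_self]
      field_simp
    rwa [this] at h2
  · exact hne i hi

theorem algebraicIndependent_mutateCluster (Q : IceQuiver n) {x : Fin n → F}
    (hx : AlgebraicIndependent k x) (hg : IntermediateField.adjoin k (Set.range x) = ⊤)
    {v : Fin n} (hv : v ∉ Q.frozen) : AlgebraicIndependent k (mutateCluster Q x v) := by
  have alg : ∀ y : Fin n → F, IntermediateField.adjoin k (Set.range y) = ⊤ →
      Algebra.IsAlgebraic (Algebra.adjoin k (Set.range y)) F := fun y hy => by
    refine ⟨fun z => ?_⟩
    have hz : z ∈ IntermediateField.adjoin k (Set.range y) := by rw [hy]; trivial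
    obtain ⟨r, hr, d, hd, rfl⟩ := IntermediateField.mem_adjoin_iff_div.1 hz
    rw [div_eq_mul_inv]
    exact (isAlgebraic_algebraMap (⟨r, hr⟩ : Algebra.adjoin k (Set.range y))).mul
      (isAlgebraic_algebraMap (⟨d, hd⟩ : Algebra.adjoin k (Set.range y))).inv
  have ht : IsTranscendenceBasis k x :=
    hx.isTranscendenceBasis_iff_isAlgebraic.2 (alg x hg)
  have := alg _ (adjoin_mutateCluster Q hx hg hv)
  exact (Algebra.IsAlgebraic.isTranscendenceBasis_of_lift_le_trdeg_of_finite k (mutateCluster Q x v)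
    ht.lift_cardinalMk_eq_trdeg.le).1

end Mutation

/-- A seed for the field `F` over `k`: an ice quiver and a cluster, that is, algebraically independent
generators of `F` over `k` indexed by the vertices. -/
@[ext]
structure ClusterSeed (k F : Type*) [Field k] [Field F] [Algebra k F] (n : ℕ) where
  quiver : IceQuiver n
  cluster : Fin n → F
  algebraicIndependent : AlgebraicIndependent k cluster
  adjoin_eq_top : IntermediateField.adjoin k (Set.range cluster) = ⊤

namespace ClusterSeed

variable {k F : Type*} [Field k] [Field F] [Algebra k F] {n : ℕ}

/-- Mutation of a seed at a mutable vertex. -/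
def mutate (s : ClusterSeed k F n) (v : Fin n) (hv : v ∉ s.quiver.frozen) : ClusterSeed k F n where
  quiver := s.quiver.mutate v
  cluster := mutateCluster s.quiver s.cluster v
  algebraicIndependent :=
    algebraicIndependent_mutateCluster s.quiver s.algebraicIndependent s.adjoin_eq_top hv
  adjoin_eq_top := adjoin_mutateCluster s.quiver s.algebraicIndependent s.adjoin_eq_top hv

/-- `t` is obtained from `s` by a finite sequence of mutations. -/
def MutationEquivalent (s t : ClusterSeed k F n) : Prop :=
  Relation.ReflTransGen (fun a b => ∃ v hv, b = mutate a v hv) s t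

end ClusterSeed

/-! ## Laurent rings and the upper cluster algebra -/

section Upper

variable {k F : Type*} [Field k] [Field F] [Algebra k F] {n : ℕ}

variable (k) in
/-- The Laurent ring `k[x₁^{±1}, …, xₙ^{±1}]` inside `F`. -/
def laurentRing (x : Fin n → F) : Subalgebra k F :=
  Algebra.adjoin k (Set.range x ∪ Set.range fun i => (x i)⁻¹)

variable (k) in
/-- The Laurent monomial with exponent vector `a`, as an element of the Laurent ring. -/
def laurentMonomial (x : Fin n → F) (a : Fin n → ℤ) : laurentRing k x :=
  ⟨∏ i, x i ^ a i, by
    refine prod_mem fun i _ => ?_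
    have h1 : x i ∈ laurentRing k x := Algebra.subset_adjoin (Or.inl ⟨i, rfl⟩)
    have h2 : (x i)⁻¹ ∈ laurentRing k x := Algebra.subset_adjoin (Or.inr ⟨i, rfl⟩)
    obtain ⟨m, h | h⟩ := (a i).eq_nat_or_neg
    · rw [h, zpow_natCast]; exact pow_mem h1 m
    · rw [h, zpow_neg, zpow_natCast, ← inv_pow]; exact pow_mem h2 m⟩

/-- The upper cluster algebra: the intersection in `F` of the Laurent rings of all clusters. -/
def upperClusterAlgebra (s : ClusterSeed k F n) : Subalgebra k F :=
  ⨅ t : {t : ClusterSeed k F n // s.MutationEquivalent t}, laurentRing k t.1.cluster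

end Upper

/-! ## `p`-th roots and splittings -/

/-- The ring `R^{1/p}`: a copy of `R`, regarded as an `R`-algebra through the Frobenius map. -/
def PthRoot (_p : ℕ) (R : Type*) : Type _ := R

namespace PthRoot

variable (p : ℕ) {R : Type*} [CommRing R]

instance : CommRing (PthRoot p R) := inferInstanceAs (CommRing R)

/-- The canonical ring isomorphism `R ≃ R^{1/p}`, `r ↦ r^{1/p}`. -/
def root : R ≃+* PthRoot p R := RingEquiv.refl R

/-- The inclusion `R → R^{1/p}`, `r ↦ (r ^ p)^{1/p}`. -/
noncomputable instance [ExpChar R p] : Algebra R (PthRoot p R) :=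
  ((root p : R ≃+* PthRoot p R).toRingHom.comp (frobenius R p)).toAlgebra

theorem smul_root [ExpChar R p] (r x : R) : r • root p x = root p (r ^ p * x) := rfl

end PthRoot

instance Subalgebra.instExpCharOfField {k F : Type*} [Field k] [Field F] [Algebra k F] (p : ℕ)
    [ExpChar k p] (R : Subalgebra k F) : ExpChar R p :=
  expChar_of_injective_algebraMap (algebraMap k R).injective p

section Splitting

variable {k F : Type*} [Field k] [Field F] [Algebra k F] {n : ℕ} (p : ℕ) [ExpChar k p]

/-- `ψ` is the standard splitting of the Laurent ring in `x`, for a perfect ground field: it sends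
`(c x^a)^{1/p}` to `c^{1/p} x^{a/p}` if `p` divides all entries of `a`, and to `0` otherwise.  Every
scalar is written here as the `p`-th power `c ^ p` of its `p`-th root. -/
def IsStandardSplitting (x : Fin n → F)
    (ψ : PthRoot p (laurentRing k x) →ₗ[laurentRing k x] laurentRing k x) : Prop :=
  (∀ (c : k) (b : Fin n → ℤ),
    ψ (PthRoot.root p (c ^ p • laurentMonomial k x fun i => p * b i)) =
      c • laurentMonomial k x b) ∧
  ∀ (c : k) (a : Fin n → ℤ), (¬ ∀ i, (p : ℤ) ∣ a i) →
    ψ (PthRoot.root p (c ^ p • laurentMonomial k x a)) = 0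

/-- `φ` is the cluster splitting of the upper cluster algebra: in every cluster it is the restriction
of the standard splitting of the Laurent ring. -/
def IsClusterSplitting (s : ClusterSeed k F n)
    (φ : PthRoot p (upperClusterAlgebra s) →ₗ[upperClusterAlgebra s] upperClusterAlgebra s) :
    Prop :=
  ∀ t : ClusterSeed k F n, s.MutationEquivalent t →
    ∃ ψ : PthRoot p (laurentRing k t.cluster) →ₗ[laurentRing k t.cluster] laurentRing k t.cluster,
      IsStandardSplitting p t.cluster ψ ∧
      ∀ (u : upperClusterAlgebra s) (l : laurentRing k t.cluster), (u : F) = l →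
        (φ (PthRoot.root p u) : F) = ψ (PthRoot.root p l)

end Splitting

/-! ## Canonical modules -/

section Canonical

variable (k : Type*) {F : Type*} [Field k] [Field F] [Algebra k F] (n : ℕ)

/-- `Λⁿ_R Ω_{R/k}`. -/
abbrev TopForms (R : Type*) [CommRing R] [Algebra k R] : Type _ := ⋀[R]^n Ω[R⁄k]

/-- The dual `(Λⁿ_R Ω_{R/k})^*`, which is `ω_{R/k}^*` where `ω_{R/k}` is the canonical module. -/
abbrev DualTopForms (R : Type*) [CommRing R] [Algebra k R] : Type _ :=
  Module.Dual R (TopForms k n R)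

/-- The canonical module `ω_{R/k} = (Λⁿ_R Ω_{R/k})^{**}`. -/
abbrev CanonicalModule (R : Type*) [CommRing R] [Algebra k R] : Type _ :=
  Module.Dual R (DualTopForms k n R)

/-- The module `(ω_{R/k})^{1-p}`: the `(p-1)`-st tensor power of `ω_{R/k}^*`. -/
abbrev CanonicalPower (p : ℕ) (R : Type*) [CommRing R] [Algebra k R] : Type _ :=
  ⨂[R]^(p - 1) (DualTopForms k n R)

variable {k n} in
/-- `da₁ ∧ … ∧ daₙ`. -/
noncomputable def wedgeD {R : Type*} [CommRing R] [Algebra k R] (a : Fin n → R) : TopForms k n R :=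
  exteriorPower.ιMulti R n fun i => KaehlerDifferential.D k R (a i)

/-- The natural map `Λⁿ_R Ω_{R/k} → Λⁿ_F Ω_{F/k}` for a subalgebra `R` of `F`; it sends
`a • db₁ ∧ … ∧ dbₙ` to the form with the same name. -/
noncomputable def toGeneric (R : Subalgebra k F) : TopForms k n R →ₗ[R] TopForms k n F :=
  exteriorPower.alternatingMapLinearEquiv
    { ((exteriorPower.ιMulti F n (M := Ω[F⁄k])).toMultilinearMap.restrictScalars R).compLinearMap
        fun _ => KaehlerDifferential.map k k R F with
      map_eq_zero_of_eq' := fun v i j h hij =>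
        (exteriorPower.ιMulti F n (M := Ω[F⁄k])).map_eq_zero_of_eq
          (fun i => KaehlerDifferential.map k k R F (v i)) (by simp only [h]) hij }

variable {k n} in
theorem toGeneric_wedgeD (R : Subalgebra k F) (a : Fin n → R) :
    toGeneric k n R (wedgeD a) = wedgeD fun i => (a i : F) := by
  rw [toGeneric, wedgeD, exteriorPower.alternatingMapLinearEquiv_apply_ιMulti]
  change exteriorPower.ιMulti F n (fun i => KaehlerDifferential.map k k R F _) = _
  simp only [KaehlerDifferential.map_D]
  rfl

variable {k n} in
/-- The natural embedding `ω_{R/k} ⊆ Λⁿ_F Ω_{F/k}`, for `F` the fraction field of `R`, sends `θ` to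
`η`.  Here `θ` is a function of `ν : Λⁿ_R Ω_{R/k} → R`, and its value at `ν` is the value at `η` of the
`F`-linear extension `νF` of `ν`. -/
def IsGenericForm {R : Subalgebra k F} (θ : CanonicalModule k n R) (η : TopForms k n F) : Prop :=
  ∀ ν : DualTopForms k n R, ∃ νF : TopForms k n F →ₗ[F] F,
    (∀ m, νF (toGeneric k n R m) = (ν m : F)) ∧ νF η = (θ ν : F)

variable {k n} in
/-- The element of `(ω_{R/k})^{1-p}` evaluated at `m ^ (p-1)`, for `m` in `Λⁿ_R Ω_{R/k}`:
`ν₁ ⊗ … ⊗ ν_{p-1} ↦ ν₁(m) ⋯ ν_{p-1}(m)`. -/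
noncomputable def evalPower (p : ℕ) {R : Type*} [CommRing R] [Algebra k R] (m : TopForms k n R) :
    CanonicalPower k n p R →ₗ[R] R :=
  PiTensorProduct.lift ((MultilinearMap.mkPiAlgebra R (Fin (p - 1)) R).compLinearMap
    fun _ => Module.Dual.eval R (TopForms k n R) m)

/-- The log volume form `dx₁ ∧ … ∧ dxₙ / (x₁ ⋯ xₙ)`. -/
noncomputable def logVolumeForm (x : Fin n → F) : TopForms k n F :=
  (∏ i, x i)⁻¹ • wedgeD x

variable {k n} in
/-- `η` is one of the two log volume forms of the cluster algebra: up to sign it is the log volume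
form of some cluster, with its variables in some order. -/
def IsLogVolumeForm (s : ClusterSeed k F n) (η : TopForms k n F) : Prop :=
  ∃ (t : ClusterSeed k F n) (π : Equiv.Perm (Fin n)), s.MutationEquivalent t ∧
    (η = logVolumeForm k n (t.cluster ∘ π) ∨ η = -logVolumeForm k n (t.cluster ∘ π))

/-! ## Frobenius duality -/

variable {k n} in
/-- `τ` is the Cartier operator on forms of top degree `n` of `F/k`: it is additive and `p⁻¹`-linear,
it kills exact forms (sums of forms `da₁ ∧ … ∧ daₙ`, when `n` is positive) and it sends
`(a₁ ⋯ aₙ)^{p-1} da₁ ∧ … ∧ daₙ` to `da₁ ∧ … ∧ daₙ`.  It is the trace map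
of duality theory for Frobenius. -/
structure IsCartierOperator (p : ℕ) (τ : TopForms k n F →+ TopForms k n F) : Prop where
  map_pow_smul : ∀ (a : F) (η : TopForms k n F), τ (a ^ p • η) = a • τ η
  map_exact : 0 < n → ∀ a : Fin n → F, τ (wedgeD a) = 0
  map_pow_wedgeD : ∀ a : Fin n → F, τ ((∏ i, a i) ^ (p - 1) • wedgeD a) = wedgeD a

variable {k n} in
/-- The duality isomorphism `(ω_{R/k})^{1-p} ≃ Hom_R(R^{1/p}, R)` attached to the trace map `τ`.
A section `σ` of `ω^{1-p} = Hom(ω^p, ω)` is sent to the map `f` with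
`f(u^{1/p}) η = τ(u σ(η^p))`, where `σ(η^p) = σ(η^{p-1}) η`; it is enough to let `η` run over
`Λⁿ_R Ω_{R/k}`. Multiplication by `u` on `σ` corresponds to multiplication by `u^{1/p}` on
the source of `f`. -/
structure IsDualityIso (p : ℕ) [ExpChar k p] {R : Subalgebra k F}
    (τ : TopForms k n F →+ TopForms k n F)
    (Φ : CanonicalPower k n p R ≃+ (PthRoot p R →ₗ[R] R)) : Prop where
  trace : ∀ (σ : CanonicalPower k n p R) (u : R) (m : TopForms k n R),
    (Φ σ (PthRoot.root p u) : F) • toGeneric k n R m =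
      τ ((u * evalPower p m σ : F) • toGeneric k n R m)
  map_smul : ∀ (σ : CanonicalPower k n p R) (u : R) (y : PthRoot p R),
    Φ (u • σ) y = Φ σ (PthRoot.root p u * y)

variable {k n} in
/-- `σ = μ^{1-p}` in `(ω_{R/k})^{1-p}`: there is exactly one `ν` in `ω_{R/k}^*` with `μ(ν) = 1`
(so that `μ` freely generates `ω_{R/k}` and `ν = μ^{-1}` freely generates the dual), and `σ` is its
`(p-1)`-st tensor power. -/
def IsInversePower (p : ℕ) {R : Type*} [CommRing R] [Algebra k R] (μ : CanonicalModule k n R)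
    (σ : CanonicalPower k n p R) : Prop :=
  ∃ ν : DualTopForms k n R, μ ν = 1 ∧ (∀ ν', μ ν' = 1 → ν' = ν) ∧
    σ = PiTensorProduct.tprod R fun _ => ν

end Canonical

/-! The log volume form trivializes all the modules involved. Let `vol` be the coordinate of top
forms of `F` with respect to the log volume form of a cluster `x`. In this coordinate the Cartier
operator becomes an additive map `κ : F → F` that sends `x^(pb)` to `x^b` and kills the other
monomials, so `κ` is the standard splitting in `x` (`LogFrame.isCartierOperator`,
`IsCartierOperator.vol_apply`). A mutation replaces `x_v` by a numerator free of `x_v` divided by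
`x_v`, hence only changes the sign of the log volume form (`ClusterSeed.logVolumeForm_mutate`). The
Cartier operator does not depend on coordinates and `κ` commutes with signs, so one `κ` serves all
clusters. It preserves every Laurent ring, hence `U`, and restricts to the cluster splitting.

For duality, the dual of the top forms of `U` must be free on `vol`, and `Hom(U^{1/p}, U)` must be
free on `κ` (`FrobeniusFrame`). After passing to `F`, an element of either module is the generator
twisted by some `c` in `F`. To see that `c` lies in the Laurent ring of each cluster, evaluate on
elements built from the variables of that cluster. This requires the cluster variables to lie in
`U`, which is the Laurent phenomenon. The duality isomorphism then sends `c • vol^{⊗(p-1)}` to `κ(c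
·)`, because the `p`-th power in `κ(c u vol(m)^{p-1} vol(m))` comes out as `vol(m)`. Finally `μ⁻¹ =
± vol`, and the sign disappears in the even power `p - 1`, which leaves `κ` itself.

The Laurent phenomenon (`ExchangeSeed.IsFree.path_mem_laurentAdjoin`) is proved by induction on the
number of mutations, as by Fomin and Zelevinsky. For a path that begins with `i, j`, the induction
hypothesis is applied to the seeds reached by `i` and by `i, j, i`. The two sets of possible
denominators are coprime in the sense of `RegularMod`, a notion that needs no unique factorization.
If `i` and `j` are not joined, coprimality can fail; then a vertex joined only to `j` is added, and
its variable is set to `1` at the end. -/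

/-! ### Differentials of `F` and logarithmic coordinates. -/

section Frame

variable {k F : Type*} [Field k] [Field F] [Algebra k F] {n : ℕ}

/-- Algebraically independent generators of `F` give a basis of `Ω[F⁄k]`. -/
theorem exists_basis_kaehlerDifferential {x : Fin n → F} (hx : AlgebraicIndependent k x)
    (hg : IntermediateField.adjoin k (Set.range x) = ⊤) :
    ∃ b : Module.Basis (Fin n) F Ω[F⁄k], ∀ i, b i = KaehlerDifferential.D k F (x i) := by
  let : Algebra (MvPolynomial (Fin n) k) F := (MvPolynomial.aeval x).toAlgebra
  have hmap : ∀ f, algebraMap (MvPolynomial (Fin n) k) F f = MvPolynomial.aeval x f := fun _ => rfl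
  have : IsScalarTower k (MvPolynomial (Fin n) k) F :=
    IsScalarTower.of_algebraMap_eq fun r => by simp [hmap]
  have hinj : Function.Injective (algebraMap (MvPolynomial (Fin n) k) F) := hx
  have : FaithfulSMul (MvPolynomial (Fin n) k) F :=
    (faithfulSMul_iff_algebraMap_injective _ _).2 hinj
  have : IsFractionRing (MvPolynomial (Fin n) k) F := by
    refine IsFractionRing.of_field _ _ fun z => ?_
    have hz : z ∈ IntermediateField.adjoin k (Set.range x) := by rw [hg]; trivial
    obtain ⟨r, s, h⟩ := (IntermediateField.mem_adjoin_range_iff k x z).1 hz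
    exact ⟨r, s, h⟩
  refine ⟨(KaehlerDifferential.mvPolynomialBasis k (Fin n)).ofIsLocalizedModule F
    (nonZeroDivisors (MvPolynomial (Fin n) k))
    (KaehlerDifferential.map k k (MvPolynomial (Fin n) k) F), fun i => ?_⟩
  rw [Module.Basis.ofIsLocalizedModule_apply, KaehlerDifferential.mvPolynomialBasis_apply,
    KaehlerDifferential.map_D, hmap, MvPolynomial.aeval_X]

variable (k) in
/-- Coordinates on top forms with respect to the log volume form of `x`, and the logarithmic
derivations `xᵢ ∂ᵢ`. -/
structure LogFrame (x : Fin n → F) where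
  vol : TopForms k n F ≃ₗ[F] F
  θ : Fin n → Derivation k F F
  θ_apply : ∀ i j, θ i (x j) = if i = j then x j else 0
  vol_wedgeD : ∀ a : Fin n → F, vol (wedgeD a) = (Matrix.of fun i j => θ i (a j)).det

/-- The determinant of a basis identifies the top exterior power with the ring. -/
noncomputable def Module.Basis.topExteriorPowerEquiv {R M : Type*} [CommRing R] [AddCommGroup M]
    [Module R M] (b : Module.Basis (Fin n) R M) : (⋀[R]^n M) ≃ₗ[R] R :=
  LinearEquiv.ofLinearMap (exteriorPower.alternatingMapLinearEquiv b.det)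
    (LinearMap.toSpanSingleton R _ (exteriorPower.ιMulti R n b))
    (by ext; simp [exteriorPower.alternatingMapLinearEquiv_apply_ιMulti, b.det_self])
    (by
      apply exteriorPower.linearMap_ext
      apply b.ext_alternating
      intro v hv
      obtain ⟨e, he⟩ : ∃ e : Equiv.Perm (Fin n), ∀ i, v i = e i :=
        ⟨Equiv.ofBijective v (Finite.injective_iff_bijective.1 hv), fun _ => rfl⟩
      have h1 : (fun i => b (v i)) = b ∘ e := by ext i; simp [he]
      simp [exteriorPower.alternatingMapLinearEquiv_apply_ιMulti, h1, AlternatingMap.map_perm,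
        b.det_self])

/-- The basis `dx_i / x_i` of `Ω[F⁄k]` supplies both parts: its determinant is `vol`, and its
coordinates composed with `d` are the derivations `x_i ∂_i`. -/
theorem exists_logFrame {x : Fin n → F} (hx : AlgebraicIndependent k x)
    (hg : IntermediateField.adjoin k (Set.range x) = ⊤) : Nonempty (LogFrame k x) := by
  obtain ⟨b, hb⟩ := exists_basis_kaehlerDifferential hx hg
  have h0 : ∀ i, x i ≠ 0 := hx.ne_zero
  let c := b.isUnitSMul fun i => (isUnit_iff_ne_zero.2 (inv_ne_zero (h0 i)))
  have hc : ∀ i, c i = (x i)⁻¹ • KaehlerDifferential.D k F (x i) := fun i => by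
    simp [c, Module.Basis.isUnitSMul_apply, hb]
  refine ⟨⟨c.topExteriorPowerEquiv, fun i => (c.coord i).compDer (KaehlerDifferential.D k F),
    fun i j => ?_, fun a => ?_⟩⟩
  · have : KaehlerDifferential.D k F (x j) = x j • c j := by
      rw [hc, smul_smul, mul_inv_cancel₀ (h0 j), one_smul]
    simp [this, Finsupp.single_apply, eq_comm]
  · simp only [Module.Basis.topExteriorPowerEquiv, wedgeD, LinearEquiv.coe_ofLinearMap,
      exteriorPower.alternatingMapLinearEquiv_apply_ιMulti, Module.Basis.det_apply]
    congr 1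

end Frame

/-! ### Laurent monomials and the Frobenius trace. -/

section Monomials

variable {F ι : Type*} [Field F] [Fintype ι]

/-- The Laurent monomial `x ^ b`. -/
def zmonomial (x : ι → F) (b : ι → ℤ) : F := ∏ i, x i ^ b i

theorem zmonomial_zero (x : ι → F) : zmonomial x 0 = 1 := by simp [zmonomial]

theorem zmonomial_ne_zero {x : ι → F} (h : ∀ i, x i ≠ 0) (b : ι → ℤ) :
    zmonomial x b ≠ 0 :=
  Finset.prod_ne_zero_iff.2 fun i _ => zpow_ne_zero _ (h i)

theorem zmonomial_add {x : ι → F} (h : ∀ i, x i ≠ 0) (b c : ι → ℤ) :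
    zmonomial x (b + c) = zmonomial x b * zmonomial x c := by
  simp [zmonomial, zpow_add₀ (h _), Finset.prod_mul_distrib]

theorem zmonomial_sum {x : ι → F} (h : ∀ i, x i ≠ 0) {σ : Type*} (s : Finset σ)
    (b : σ → ι → ℤ) : zmonomial x (∑ i ∈ s, b i) = ∏ i ∈ s, zmonomial x (b i) := by
  classical
  induction s using Finset.induction_on with
  | empty => simp [zmonomial_zero]
  | insert i s hi ih => rw [Finset.sum_insert hi, Finset.prod_insert hi, zmonomial_add h, ih]

theorem zmonomial_nsmul (x : ι → F) (m : ℕ) (b : ι → ℤ) :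
    zmonomial x (m • b) = zmonomial x b ^ m := by
  simp only [zmonomial, ← Finset.prod_pow]
  refine Finset.prod_congr rfl fun i _ => ?_
  rw [Pi.smul_apply, nsmul_eq_mul, mul_comm, zpow_mul, zpow_natCast]

theorem zmonomial_neg (x : ι → F) (b : ι → ℤ) :
    zmonomial x (-b) = (zmonomial x b)⁻¹ := by
  simp [zmonomial, Finset.prod_inv_distrib]

theorem zmonomial_single [DecidableEq ι] (x : ι → F) (i : ι) :
    zmonomial x (Pi.single i 1) = x i := by
  rw [zmonomial, Finset.prod_eq_single i] <;> simp +contextual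

theorem zmonomial_one (x : ι → F) : zmonomial x 1 = ∏ i, x i := by simp [zmonomial]

variable {n : ℕ}

variable {k : Type*} [Field k] [Algebra k F]

theorem Derivation.apply_zmonomial (D : Derivation k F F) {x : Fin n → F} (h : ∀ i, x i ≠ 0)
    (b : Fin n → ℤ) :
    D (zmonomial x b) = (∑ i, (b i : F) * ((x i)⁻¹ * D (x i))) * zmonomial x b := by
  classical
  have key : ∀ s : Finset (Fin n), D (∏ i ∈ s, x i ^ b i) =
      (∑ i ∈ s, (b i : F) * ((x i)⁻¹ * D (x i))) * ∏ i ∈ s, x i ^ b i := fun s => by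
    induction s using Finset.induction_on with
    | empty => simp
    | insert i s hi ih =>
      rw [Finset.prod_insert hi, Finset.sum_insert hi, D.leibniz, ih, D.leibniz_zpow,
        zpow_sub_one₀ (h i)]
      simp only [smul_eq_mul, zsmul_eq_mul]
      ring
  exact key _

theorem LogFrame.θ_zmonomial {x : Fin n → F} (fr : LogFrame k x) (h : ∀ i, x i ≠ 0) (j : Fin n)
    (b : Fin n → ℤ) : fr.θ j (zmonomial x b) = (b j : F) * zmonomial x b := by
  rw [Derivation.apply_zmonomial _ h, Finset.sum_eq_single j]
  · rw [fr.θ_apply, if_pos rfl, inv_mul_cancel₀ (h j), mul_one]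
  · intro i _ hi
    rw [fr.θ_apply, if_neg hi.symm]; simp
  · simp

variable (p : ℕ)

/-- `κ` is additive and `p⁻¹`-linear, and extracts the `p`-th roots of the monomials in `x`. -/
structure IsFrobeniusTrace (x : Fin n → F) (κ : F →+ F) : Prop where
  map_pow_mul : ∀ a f, κ (a ^ p * f) = a * κ f
  map_nsmul : ∀ b, κ (zmonomial x (p • b)) = zmonomial x b
  map_of_not_dvd : ∀ b : Fin n → ℤ, (¬ ∀ i, (p : ℤ) ∣ b i) → κ (zmonomial x b) = 0

variable [Fact p.Prime]

theorem exists_pow_prime_eq [CharP k p] [PerfectField k] (c : k) : ∃ d : k, d ^ p = c := by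
  have : ExpChar k p := inferInstance
  have : PerfectRing k p := PerfectField.toPerfectRing p
  obtain ⟨d, hd⟩ := (PerfectRing.bijective_frobenius (R := k) (p := p)).2 c
  exact ⟨d, hd⟩

/-- Over a perfect field, `F` is spanned over `F ^ p` by the Laurent monomials in generators. -/
theorem addSubgroup_eq_top_of_zmonomial_mem [CharP k p] [PerfectField k] {x : Fin n → F}
    (h : ∀ i, x i ≠ 0)
    (hg : IntermediateField.adjoin k (Set.range x) = ⊤) {S : AddSubgroup F}
    (hS : ∀ a f, f ∈ S → a ^ p * f ∈ S) (hmon : ∀ b, zmonomial x b ∈ S) : S = ⊤ := by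
  have hp : p ≠ 0 := (Fact.out : p.Prime).ne_zero
  let M : Submonoid F :=
    { carrier := {f | ∃ a b, f = a ^ p * zmonomial x b}
      mul_mem' := by
        rintro _ _ ⟨a, b, rfl⟩ ⟨a', b', rfl⟩
        exact ⟨a * a', b + b', by rw [zmonomial_add h]; ring⟩
      one_mem' := ⟨1, 0, by simp [zmonomial_zero]⟩ }
  let R := Subring.closure (M : Set F)
  have hpow : ∀ a : F, a ^ p ∈ R := fun a =>
    Subring.subset_closure ⟨a, 0, by rw [zmonomial_zero, mul_one]⟩
  -- The subring generated by the products `a ^ p * x^b` contains `k`, as `k` is perfect, and is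
  -- closed under inverses, as `z⁻¹ = (z⁻¹)^p z^(p-1)`. So it is a field that contains the
  -- generators.
  let K : IntermediateField k F :=
    { R with
      algebraMap_mem' := fun c => by
        obtain ⟨d, rfl⟩ := exists_pow_prime_eq p c
        rw [map_pow]; exact hpow _
      inv_mem' := fun z hz => by
        by_cases h0 : z = 0
        · simp [h0]
        have h1 : z⁻¹ = z⁻¹ ^ p * z ^ (p - 1) := by
          rw [inv_pow, eq_inv_mul_iff_mul_eq₀ (pow_ne_zero _ h0), ← div_eq_mul_inv,
            div_eq_iff h0, ← pow_succ, Nat.sub_add_cancel (Nat.one_le_iff_ne_zero.2 hp)]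
        rw [h1]
        exact R.mul_mem (hpow _) (R.pow_mem hz _) }
  have hK : K = ⊤ := by
    rw [eq_top_iff, ← hg, IntermediateField.adjoin_le_iff]
    rintro _ ⟨i, rfl⟩
    exact Subring.subset_closure ⟨1, Pi.single i 1, by rw [zmonomial_single]; simp⟩
  rw [eq_top_iff]
  intro f _
  have hf : f ∈ R := by
    have : f ∈ K := by rw [hK]; trivial
    exact this
  -- The products `a ^ p * x^b` form a monoid, so the subring is just their additive span.
  rw [Subring.mem_closure_iff, Submonoid.closure_eq] at hf
  refine (AddSubgroup.closure_le _).2 ?_ hf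
  rintro _ ⟨a, b, rfl⟩
  exact hS _ _ (hmon b)

/-- The projection of `F` to its `p`-th powers. -/
theorem LogFrame.exists_projection [CharP F p] {x : Fin n → F} (fr : LogFrame k x)
    (h : ∀ i, x i ≠ 0) (l : List (Fin n)) : ∃ E : F →+ F, (∀ a f, E (a ^ p * f) = a ^ p * E f) ∧
      (∀ b : Fin n → ℤ, (∀ i ∈ l, (p : ℤ) ∣ b i) → E (zmonomial x b) = zmonomial x b) ∧
      ∀ b : Fin n → ℤ, (¬ ∀ i ∈ l, (p : ℤ) ∣ b i) → E (zmonomial x b) = 0 := by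
  have hp : p ≠ 0 := (Fact.out : p.Prime).ne_zero
  induction l with
  | nil => exact ⟨AddMonoidHom.id F, by simp, by simp, by simp⟩
  | cons j l ih =>
    obtain ⟨E, h1, h2, h3⟩ := ih
    -- A monomial `x^b` is an eigenvector of `θ j` with eigenvalue `b j`. By Fermat, `1 - (θ
    -- j)^(p-1)` keeps it if `p ∣ b j` and kills it otherwise; the projection is the product of
    -- these operators over `j`.
    let T : Module.End k F := (fr.θ j : F →ₗ[k] F)
    have hT : ∀ (m : ℕ) (a f : F), (T ^ m) (a ^ p * f) = a ^ p * (T ^ m) f := fun m a f => by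
      induction m with
      | zero => simp
      | succ m ih =>
        rw [pow_succ', Module.End.mul_apply, ih]
        change fr.θ j _ = _ * fr.θ j _
        rw [Derivation.leibniz, Derivation.leibniz_pow]
        simp
    have hTm : ∀ (m : ℕ) (b : Fin n → ℤ),
        (T ^ m) (zmonomial x b) = (b j : F) ^ m * zmonomial x b := fun m b => by
      induction m with
      | zero => simp
      | succ m ih =>
        rw [pow_succ', Module.End.mul_apply, ih]
        change fr.θ j _ = _
        rw [Derivation.leibniz, fr.θ_zmonomial h, ← Int.cast_pow, Derivation.map_intCast]
        simp only [smul_eq_mul, mul_zero, add_zero]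
        push_cast
        ring
    let E' : F →+ F := E.comp
      (AddMonoidHom.id F - ((T ^ (p - 1) : Module.End k F) : F →ₗ[k] F).toAddMonoidHom)
    have hE' : ∀ f, E' f = E (f - (T ^ (p - 1)) f) := fun _ => rfl
    have hlast : ∀ b : Fin n → ℤ, ((p : ℤ) ∣ b j → (b j : F) ^ (p - 1) = 0) ∧
        (¬ (p : ℤ) ∣ b j → (b j : F) ^ (p - 1) = 1) := fun b => by
      have h0 := CharP.intCast_eq_zero_iff F p (b j)
      constructor
      · intro hd
        rw [h0.2 hd, zero_pow]
        have := (Fact.out : p.Prime).two_le; omega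
      · intro hd
        have h4 : (b j : F) ≠ 0 := fun h => hd (h0.1 h)
        have h5 : (b j : F) ^ p = b j := by
          rw [← frobenius_def, map_intCast]
        rw [← mul_left_inj' h4, ← pow_succ, Nat.sub_add_cancel (Nat.one_le_iff_ne_zero.2 hp), h5,
          one_mul]
    refine ⟨E', fun a f => ?_, fun b hb => ?_, fun b hb => ?_⟩
    · rw [hE', hE', hT, ← mul_sub, h1]
    · rw [hE', hTm, (hlast b).1 (hb j (by simp)), zero_mul, sub_zero,
        h2 b fun i hi => hb i (by simp [hi])]
    · rw [hE', hTm]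
      by_cases hj : (p : ℤ) ∣ b j
      · rw [(hlast b).1 hj, zero_mul, sub_zero]
        refine h3 b fun hl => hb fun i hi => ?_
        rcases List.mem_cons.1 hi with rfl | hi
        · exact hj
        · exact hl i hi
      · rw [(hlast b).2 hj, one_mul, sub_self, map_zero]

/-- The projection onto the monomials with exponents in `pℤ` takes values in `F^p`, and `κ` is its
`p`-th root, unique because Frobenius is injective. -/
theorem exists_isFrobeniusTrace [CharP k p] [CharP F p] [PerfectField k] {x : Fin n → F}
    (fr : LogFrame k x) (h : ∀ i, x i ≠ 0) (hg : IntermediateField.adjoin k (Set.range x) = ⊤) :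
    ∃ κ : F →+ F, IsFrobeniusTrace p x κ := by
  obtain ⟨E, h1, h2, h3⟩ := fr.exists_projection p h (List.finRange n)
  have hE : AddSubgroup.comap E (frobenius F p).range.toAddSubgroup = ⊤ := by
    refine addSubgroup_eq_top_of_zmonomial_mem (k := k) p h hg ?_ ?_
    · rintro a f ⟨g, hg⟩
      refine ⟨a * g, ?_⟩
      rw [h1, map_mul, hg]; rfl
    · intro b
      by_cases hb : ∀ i ∈ List.finRange n, (p : ℤ) ∣ b i
      · choose c hc using fun i => hb i (List.mem_finRange i)
        have : b = p • c := by ext i; simp [hc]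
        refine ⟨zmonomial x c, ?_⟩
        rw [h2 b hb, this, zmonomial_nsmul]; rfl
      · exact ⟨0, by rw [h3 b hb, map_zero]⟩
  have hE' : ∀ f, ∃ g, g ^ p = E f := fun f => by
    have : f ∈ AddSubgroup.comap E (frobenius F p).range.toAddSubgroup := by rw [hE]; trivial
    exact this
  choose r hr using hE'
  have inj : ∀ {a b : F}, a ^ p = b ^ p → a = b := fun hab => frobenius_inj F p hab
  have hadd : ∀ a b : F, (a + b) ^ p = a ^ p + b ^ p := fun a b =>
    (frobenius F p).map_add a b
  refine ⟨⟨⟨r, inj ?_⟩, fun a b => inj ?_⟩, ⟨fun a f => inj ?_, fun b => inj ?_,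
    fun b hb => inj ?_⟩⟩
  · rw [hr, map_zero, zero_pow (Fact.out : p.Prime).ne_zero]
  · change r _ ^ p = (r _ + r _) ^ p
    rw [hadd, hr, hr, hr, map_add]
  · change r _ ^ p = (a * r _) ^ p
    rw [mul_pow, hr, hr, h1]
  · change r _ ^ p = _
    rw [hr, h2 _ (fun i _ => by simp), zmonomial_nsmul]
  · change r _ ^ p = _
    rw [hr, h3 _ (fun h => hb fun i => h i (List.mem_finRange i)),
      zero_pow (Fact.out : p.Prime).ne_zero]

end Monomials

/-! ### The Cartier operator in logarithmic coordinates. -/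

section Cartier

variable {k F : Type*} [Field k] [Field F] [Algebra k F] {n : ℕ} (p : ℕ)

theorem Derivation.map_pow_char_mul [CharP F p] {M : Type*} [AddCommGroup M] [Module k M]
    [Module F M] (D : Derivation k F M) (a f : F) : D (a ^ p * f) = a ^ p • D f := by
  rw [Derivation.leibniz, Derivation.leibniz_pow, ← Nat.cast_smul_eq_nsmul F, CharP.cast_eq_zero,
    zero_smul, smul_zero, add_zero]

variable [Fact p.Prime] [CharP F p]

/-- The defect of additivity of `u ↦ u ^ (p - 1) du` is exact. -/
theorem exists_derivation_eq_pow_smul {M : Type*} [AddCommGroup M] [Module k M] [Module F M]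
    (D : Derivation k F M) (u v : F) :
    ∃ h, (u + v) ^ (p - 1) • D (u + v) = u ^ (p - 1) • D u + v ^ (p - 1) • D v + D h := by
  have hp : (p - 1) + 1 = p := Nat.sub_add_cancel (Fact.out : p.Prime).one_le
  -- Write `(X + 1)^p = X^p + 1 + p H` over `ℤ`; differentiating and dividing by `p` gives `H' = (X
  -- + 1)^(p-1) - X^(p-1)`. By homogeneity the general case follows from `w = u / v`, with `h = v^p
  -- H(w)`.
  obtain ⟨r, hr⟩ := exists_add_pow_prime_eq (Fact.out : p.Prime) (Polynomial.X : Polynomial ℤ) 1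
  set H : Polynomial ℤ := Polynomial.X * r with hH
  have hH' : (Polynomial.X + 1 : Polynomial ℤ) ^ p =
      Polynomial.X ^ p + 1 + (p : Polynomial ℤ) * H := by
    rw [hr, hH]; ring
  have hd : Polynomial.derivative H =
      (Polynomial.X + 1 : Polynomial ℤ) ^ (p - 1) - Polynomial.X ^ (p - 1) := by
    have h1 := congrArg Polynomial.derivative hH'
    simp only [Polynomial.derivative_pow, Polynomial.derivative_add, Polynomial.derivative_X,
      Polynomial.derivative_one, Polynomial.derivative_mul, Polynomial.derivative_natCast,
      map_natCast, zero_mul, zero_add, add_zero, mul_one] at h1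
    have h2 : (p : Polynomial ℤ) ≠ 0 := Nat.cast_ne_zero.2 (Fact.out : p.Prime).ne_zero
    apply mul_left_cancel₀ h2
    linear_combination -h1
  by_cases hv : v = 0
  · refine ⟨0, ?_⟩
    subst hv
    simp
  set w := u * v⁻¹ with hw
  have hu : u = w * v := by rw [hw, inv_mul_cancel_right₀ hv]
  let D' : Derivation ℤ F M := D.restrictScalars ℤ
  have hDh : D (Polynomial.aeval w H) = ((w + 1) ^ (p - 1) - w ^ (p - 1)) • D w := by
    have h1 : D' (Polynomial.aeval w H) = _ := D'.map_aeval H w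
    rw [hd] at h1
    change D' _ = _ • D' _
    simpa using h1
  refine ⟨v ^ p * Polynomial.aeval w H, ?_⟩
  rw [Derivation.map_pow_char_mul, hDh, hu, show w * v + v = (w + 1) * v by ring,
    Derivation.leibniz, Derivation.leibniz, map_add, Derivation.map_one_eq_zero]
  have hchar : (w + 1) ^ (p - 1) * (w + 1) = w ^ (p - 1) * w + 1 := by
    rw [← pow_succ, ← pow_succ, hp]
    simpa [frobenius_def] using (frobenius F p).map_add w 1
  have hvp : v ^ p = v ^ (p - 1) * v := by rw [← pow_succ, hp]
  simp only [smul_add, smul_smul, add_zero, mul_pow, hvp]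
  have e1 : (w + 1) ^ (p - 1) * v ^ (p - 1) * (w + 1) =
      w ^ (p - 1) * v ^ (p - 1) * w + v ^ (p - 1) := by
    linear_combination v ^ (p - 1) * hchar
  have e2 : v ^ (p - 1) * v * ((w + 1) ^ (p - 1) - w ^ (p - 1)) =
      (w + 1) ^ (p - 1) * v ^ (p - 1) * v - w ^ (p - 1) * v ^ (p - 1) * v := by ring
  rw [e1, e2, add_smul, sub_smul]
  abel

variable {p}

/-- The monomials span `F` over `F^p`, so a property that is additive and `F^p`-homogeneous in each
slot can be checked on monomials, one slot after another. In `key` the set `s` holds the slots that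
may be arbitrary. -/
theorem forall_of_zmonomial [CharP k p] [PerfectField k] {x : Fin n → F} (h : ∀ i, x i ≠ 0)
    (hg : IntermediateField.adjoin k (Set.range x) = ⊤) {P : (Fin n → F) → Prop}
    (hadd : ∀ a i u v, P (Function.update a i u) → P (Function.update a i v) →
      P (Function.update a i (u + v)))
    (hpow : ∀ a i c u, P (Function.update a i u) → P (Function.update a i (c ^ p * u)))
    (hmon : ∀ b : Fin n → Fin n → ℤ, P fun i => zmonomial x (b i)) (a : Fin n → F) : P a := by
  classical
  have hp : p ≠ 0 := (Fact.out : p.Prime).ne_zero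
  have key : ∀ s : Finset (Fin n), ∀ a : Fin n → F,
      (∀ i ∉ s, ∃ b, a i = zmonomial x b) → P a := fun s => by
    induction s using Finset.induction_on with
    | empty =>
      intro a ha
      choose b hb using fun i => ha i (by simp)
      rw [show a = fun i => zmonomial x (b i) from funext hb]
      exact hmon b
    | insert i s hi ih =>
      intro a ha
      have hm : ∀ b, P (Function.update a i (zmonomial x b)) := fun b => by
        refine ih _ fun j hj => ?_
        by_cases hji : j = i
        · subst hji; exact ⟨b, by simp⟩
        · rw [Function.update_of_ne hji]; exact ha j (by simp [hji, hj])
      have h0 : P (Function.update a i 0) := by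
        have := hpow a i 0 _ (hm 0)
        rwa [zero_pow hp, zero_mul] at this
      let S : AddSubgroup F :=
        { carrier := {u | P (Function.update a i u)}
          add_mem' := fun {u v} => hadd a i u v
          zero_mem' := h0
          neg_mem' := fun {u} hu => by
            have h1 := hpow a i (-1) u hu
            rcases (Fact.out : p.Prime).eq_two_or_odd' with h2 | h2
            · have : CharP F 2 := by rw [← h2]; infer_instance
              change P (Function.update a i (-u))
              rwa [CharTwo.neg_eq]
            · rwa [h2.neg_one_pow, neg_one_mul] at h1 }
      have hS : S = ⊤ := addSubgroup_eq_top_of_zmonomial_mem (k := k) p h hg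
        (fun c u hu => hpow a i c u hu) hm
      have : a i ∈ S := by rw [hS]; trivial
      have h1 : P (Function.update a i (a i)) := this
      rwa [Function.update_eq_self] at h1
  exact key Finset.univ a (by simp)

variable {x : Fin n → F}

/-- The logarithmic derivative of a monomial is its exponent vector, so the Jacobian is the
determinant of the exponent matrix. -/
theorem LogFrame.vol_wedgeD_zmonomial (fr : LogFrame k x) (h : ∀ i, x i ≠ 0)
    (b : Fin n → Fin n → ℤ) :
    fr.vol (wedgeD fun i => zmonomial x (b i)) =
      zmonomial x (∑ i, b i) * ((Matrix.of b).det : F) := by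
  rw [fr.vol_wedgeD, zmonomial_sum h, ← Matrix.det_transpose (Matrix.of b), Int.cast_det]
  rw [← Matrix.det_mul_row]
  congr 1
  ext i j
  simp [fr.θ_zmonomial h, mul_comm]

theorem LogFrame.vol_wedgeD_self (fr : LogFrame k x) (h : ∀ i, x i ≠ 0) :
    fr.vol (wedgeD x) = zmonomial x 1 := by
  classical
  have h1 := fr.vol_wedgeD_zmonomial h fun i => Pi.single i 1
  simp only [zmonomial_single] at h1
  have e1 : (∑ i, Pi.single i 1 : Fin n → ℤ) = 1 := by
    ext j; simp [Finset.sum_apply, Pi.single_apply]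
  have e2 : (Matrix.of fun i => Pi.single i 1 : Matrix (Fin n) (Fin n) ℤ) = 1 := by
    ext i j; simp [Matrix.one_apply, Pi.single_apply, eq_comm]
  rw [h1, e1, e2, Matrix.det_one, Int.cast_one, mul_one]

/-- `S = ∅` gives the vanishing on exact forms and `S = univ` the normalization of the Cartier
operator. The intermediate sets are needed because `a ↦ a^(p-1) da` is additive only up to an exact
term, in which that slot has left `S`; hence the induction on `S`. -/
theorem LogFrame.frobeniusTrace_wedgeD [CharP k p] [PerfectField k] (fr : LogFrame k x)
    (h : ∀ i, x i ≠ 0) (hg : IntermediateField.adjoin k (Set.range x) = ⊤) {κ : F →+ F}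
    (hκ : IsFrobeniusTrace p x κ) (S : Finset (Fin n)) (a : Fin n → F) :
    κ ((∏ i ∈ S, a i ^ (p - 1)) * fr.vol (wedgeD a)) =
      if S = Finset.univ then fr.vol (wedgeD a) else 0 := by
  classical
  have hp1 : (p - 1) + 1 = p := Nat.sub_add_cancel (Fact.out : p.Prime).one_le
  induction S using Finset.strongInduction generalizing a with
  | H S ih =>
  let D := KaehlerDifferential.D k F
  let A : Ω[F⁄k] [⋀^Fin n]→ₗ[F] F := (fr.vol : _ →ₗ[F] F).compAlternatingMap
    (exteriorPower.ιMulti F n)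
  -- The factors `a i ^ (p - 1)` are moved into their slots, so that one slot can be varied at a
  -- time.
  let g : Finset (Fin n) → Fin n → F → Ω[F⁄k] := fun S i u =>
    (if i ∈ S then u ^ (p - 1) else 1) • D u
  have hA : ∀ (S : Finset (Fin n)) (a : Fin n → F), (∏ i ∈ S, a i ^ (p - 1)) * fr.vol (wedgeD a) =
      A fun i => g S i (a i) := fun S a => by
    rw [← AlternatingMap.coe_multilinearMap, MultilinearMap.map_smul_univ, Finset.prod_ite_mem,
      Finset.univ_inter]
    rfl
  have hupd : ∀ (S : Finset (Fin n)) (a : Fin n → F) i u,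
      (fun j => g S j (Function.update a i u j)) =
        Function.update (fun j => g S j (a j)) i (g S i u) := fun S a i u =>
    funext fun j => Function.apply_update (fun j => g S j) a i u j
  have hW : ∀ a : Fin n → F, fr.vol (wedgeD a) = A fun i => g ∅ i (a i) := fun a => by
    rw [← hA]; simp
  have hgpow : ∀ S i c u, g S i (c ^ p * u) = (if i ∈ S then (c ^ p) ^ p else c ^ p) • g S i u := by
    intro S i c u
    simp only [g, D, Derivation.map_pow_char_mul]
    split_ifs
    · rw [smul_smul, smul_smul]
      congr 1
      rw [mul_pow, mul_right_comm, ← pow_succ, hp1]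
    · simp
  rw [hA, hW]
  refine forall_of_zmonomial (k := k) h hg
    (P := fun a => κ (A fun i => g S i (a i)) =
      if S = Finset.univ then A fun i => g ∅ i (a i) else 0) ?_ ?_ ?_ a
  · intro a i u v hu hv
    simp only [hupd] at hu hv ⊢
    have e0 : g ∅ i (u + v) = g ∅ i u + g ∅ i v := by simp [g]
    have e1 : κ (A (Function.update (fun j => g S j (a j)) i (g S i (u + v)))) =
        κ (A (Function.update (fun j => g S j (a j)) i (g S i u))) +
        κ (A (Function.update (fun j => g S j (a j)) i (g S i v))) := by
      by_cases hi : i ∈ S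
      · obtain ⟨w, hw⟩ := exists_derivation_eq_pow_smul p D u v
        have e2 : g S i (u + v) = g S i u + g S i v + D w := by simpa [g, hi] using hw
        rw [e2, AlternatingMap.map_update_add, AlternatingMap.map_update_add, map_add, map_add]
        -- The defect of additivity is `dw` without a factor in slot `i`; the case of the smaller
        -- set `S.erase i` kills it.
        have e3 := ih (S.erase i) (Finset.erase_ssubset hi) (Function.update a i w)
        have hne : S.erase i ≠ Finset.univ := fun h => by
          have := Finset.mem_univ i
          rw [← h] at this
          simp at this
        rw [if_neg hne, hA, hupd] at e3
        have e4 : Function.update (fun j => g (S.erase i) j (a j)) i (g (S.erase i) i w) =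
            Function.update (fun j => g S j (a j)) i (D w) := by
          ext j
          by_cases hj : j = i
          · subst hj; simp [g]
          · simp [g, hj]
        rw [e4] at e3
        rw [e3, add_zero]
      · have e2 : g S i (u + v) = g S i u + g S i v := by simp [g, hi]
        rw [e2, AlternatingMap.map_update_add, map_add]
    rw [e1, hu, hv, e0, AlternatingMap.map_update_add]
    split_ifs <;> simp
  · intro a i c u hu
    simp only [hupd] at hu ⊢
    rw [hgpow, hgpow, A.map_update_smul _ _ _ (g S i u), A.map_update_smul _ _ _ (g ∅ i u),
      smul_eq_mul, smul_eq_mul]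
    by_cases hS : S = Finset.univ
    · subst hS
      simp only [Finset.mem_univ, if_true, Finset.notMem_empty, if_false] at hu ⊢
      rw [hκ.map_pow_mul, hu]
    · rw [if_neg hS] at hu ⊢
      split_ifs <;> rw [hκ.map_pow_mul, hu, mul_zero]
  · intro b
    rw [← hA, ← hW, fr.vol_wedgeD_zmonomial h, ← mul_assoc]
    set m : ℤ := (Matrix.of b).det
    have hm : ∀ f, κ (f * (m : F)) = m * κ f := fun f => by
      rw [← hκ.map_pow_mul, mul_comm, ← frobenius_def, map_intCast]
    simp only [← zmonomial_nsmul, ← zmonomial_sum h, ← zmonomial_add h]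
    rw [hm]
    split_ifs with hS
    · subst hS
      rw [← Finset.smul_sum, ← succ_nsmul, hp1, hκ.map_nsmul, mul_comm]
    -- As `p - 1 = -1` in `F`, divisibility of the exponents says that the rows of `b` outside `S`
    -- sum to zero in `F`. Since `S` is not everything, this is a nontrivial relation and the
    -- determinant vanishes.
    · by_cases hd : ∀ j, (p : ℤ) ∣ (∑ i ∈ S, (p - 1) • b i + ∑ i, b i) j
      · have hm0 : (m : F) = 0 := by
          rw [Int.cast_det]
          apply Matrix.exists_vecMul_eq_zero_iff.1
          refine ⟨fun i => if i ∈ S then 0 else 1, ?_, ?_⟩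
          · intro h0
            apply hS
            rw [Finset.eq_univ_iff_forall]
            intro i
            by_contra hi
            have := congrFun h0 i
            simp [hi] at this
          · ext j
            have h1 := (CharP.intCast_eq_zero_iff F p _).2 (hd j)
            simp only [Pi.add_apply, Finset.sum_apply, Pi.smul_apply, Int.cast_add,
              Int.cast_sum] at h1
            simp only [nsmul_eq_mul, Int.cast_mul] at h1
            rw [← Finset.mul_sum] at h1
            have h2 : (((p - 1 : ℕ) : ℤ) : F) = -1 := by
              have : (((p - 1) + 1 : ℕ) : F) = 0 := by rw [hp1, CharP.cast_eq_zero]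
              push_cast at this ⊢
              exact eq_neg_of_add_eq_zero_left this
            rw [h2, ← Finset.sum_filter_add_sum_filter_not Finset.univ (· ∈ S),
              Finset.filter_univ_mem] at h1
            simp only [Matrix.vecMul, dotProduct, Pi.zero_apply, ite_mul, zero_mul, one_mul,
              Matrix.map_apply, Matrix.of_apply]
            rw [Finset.sum_ite, Finset.sum_const_zero, zero_add]
            linear_combination h1
        rw [hm0, zero_mul]
      · rw [hκ.map_of_not_dvd _ hd, mul_zero]

theorem LogFrame.isCartierOperator [CharP k p] [PerfectField k] (fr : LogFrame k x)
    (h : ∀ i, x i ≠ 0) (hg : IntermediateField.adjoin k (Set.range x) = ⊤) {κ : F →+ F}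
    (hκ : IsFrobeniusTrace p x κ) :
    IsCartierOperator (k := k) p
      ((fr.vol.symm : F →+ TopForms k n F).comp (κ.comp (fr.vol : TopForms k n F →+ F))) where
  map_pow_smul a η := by
    simp only [AddMonoidHom.comp_apply, AddMonoidHom.coe_coe, map_smul, smul_eq_mul,
      hκ.map_pow_mul]
    rw [← smul_eq_mul a, map_smul]
  map_exact hn a := by
    have h1 := fr.frobeniusTrace_wedgeD h hg hκ ∅ a
    have h2 : (∅ : Finset (Fin n)) ≠ Finset.univ := fun h => by
      have := Finset.mem_univ (⟨0, hn⟩ : Fin n)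
      rw [← h] at this
      simp at this
    rw [if_neg h2, Finset.prod_empty, one_mul] at h1
    simp [h1]
  map_pow_wedgeD a := by
    have h1 := fr.frobeniusTrace_wedgeD h hg hκ Finset.univ a
    rw [if_pos rfl, Finset.prod_pow] at h1
    simp [h1]

/-- A Cartier operator is the Frobenius trace in the coordinate of a log volume form. -/
theorem IsCartierOperator.vol_apply [CharP k p] [PerfectField k]
    {τ : TopForms k n F →+ TopForms k n F} (hτ : IsCartierOperator p τ) (fr : LogFrame k x)
    (h : ∀ i, x i ≠ 0) (hg : IntermediateField.adjoin k (Set.range x) = ⊤) {κ : F →+ F}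
    (hκ : IsFrobeniusTrace p x κ) (η : TopForms k n F) : fr.vol (τ η) = κ (fr.vol η) := by
  classical
  have hp1 : (p - 1) + 1 = p := Nat.sub_add_cancel (Fact.out : p.Prime).one_le
  have hmul : ∀ a η, fr.vol (τ (a ^ p • η)) = a * fr.vol (τ η) := fun a η => by
    rw [hτ.map_pow_smul, map_smul, smul_eq_mul]
  let S : AddSubgroup F := AddMonoidHom.eqLocus κ
    ((fr.vol : TopForms k n F →+ F).comp (τ.comp (fr.vol.symm : F →+ TopForms k n F)))
  have hS' : ∀ f, f ∈ S ↔ κ f = fr.vol (τ (fr.vol.symm f)) := fun f => Iff.rfl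
  have hS : S = ⊤ := by
    refine addSubgroup_eq_top_of_zmonomial_mem (k := k) p h hg (fun a f hf => ?_) fun b => ?_
    · rw [hS'] at hf ⊢
      rw [hκ.map_pow_mul, hf, ← smul_eq_mul (a ^ p), map_smul, hmul]
    rw [hS']
    by_cases hb : ∀ i, (p : ℤ) ∣ b i
    · choose c hc using hb
      have hbc : b = p • c := by ext i; simp [hc]
      have h1 := hτ.map_pow_wedgeD x
      have h2 := fr.vol_wedgeD_self h
      -- The form `x^(pc) dx / (x_1 ⋯ x_n)` is a `p`-th power times `(x_1 ⋯ x_n)^(p-1) dx`, whose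
      -- image is prescribed.
      have h3 : fr.vol.symm (zmonomial x (p • c)) =
          (zmonomial x (c - 1)) ^ p • ((∏ i, x i) ^ (p - 1) • wedgeD x) := by
        apply fr.vol.injective
        rw [LinearEquiv.apply_symm_apply, map_smul, map_smul, h2, smul_eq_mul, smul_eq_mul,
          ← zmonomial_one, ← pow_succ, hp1, ← mul_pow, ← zmonomial_add h, sub_add_cancel,
          zmonomial_nsmul]
      rw [hbc, hκ.map_nsmul, h3, hmul, h1, h2, ← zmonomial_add h, sub_add_cancel]
    · rw [hκ.map_of_not_dvd b hb]
      obtain ⟨i, hi⟩ := not_forall.1 hb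
      have hbi : ((b i : ℤ) : F) ≠ 0 := fun h0 => hi ((CharP.intCast_eq_zero_iff F p _).1 h0)
      -- Integers are their own `p`-th powers in `F`, so `τ` is linear over them.
      have hbp : ((b i : ℤ) : F)⁻¹ = ((b i : F)⁻¹) ^ p := by
        rw [inv_pow, ← frobenius_def, map_intCast]
      -- If `p ∤ b i`, then `x^b` times the log volume form is exact up to the factor `b i`: put
      -- `x^b / ∏_{l ≠ i} x_l` in slot `i` and `x_l` in the other slots. The rows of this exponent
      -- matrix sum to `b` and its determinant is `b i`.
      let B : Fin n → Fin n → ℤ := fun j =>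
        if j = i then b - ∑ l ∈ Finset.univ.erase i, Pi.single l 1 else Pi.single j 1
      have hB1 : ∑ j, B j = b := by
        rw [← Finset.add_sum_erase _ _ (Finset.mem_univ i)]
        have : ∑ j ∈ Finset.univ.erase i, B j =
            ∑ l ∈ Finset.univ.erase i, (Pi.single l 1 : Fin n → ℤ) :=
          Finset.sum_congr rfl fun j hj => if_neg (Finset.ne_of_mem_erase hj)
        rw [this]
        simp [B]
      have hB2 : (Matrix.of B).det = b i := by
        have : Matrix.of B = (1 : Matrix (Fin n) (Fin n) ℤ).updateRow i (B i) := by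
          ext j l
          by_cases hj : j = i
          · subst hj; simp
          · simp [hj, B, Matrix.one_apply, Pi.single_apply, @eq_comm _ l j]
        rw [this, ← Matrix.det_transpose, ← Matrix.updateCol_transpose, Matrix.transpose_one]
        have h4 := Matrix.cramer_one (n := Fin n) (α := ℤ)
        have h5 := congrFun (LinearMap.congr_fun h4 (B i)) i
        rw [Matrix.cramer_apply] at h5
        rw [h5]
        simp [B, Finset.sum_apply, Pi.single_apply]
      have h1 := hτ.map_exact (Fin.pos i) fun j => zmonomial x (B j)
      have h3 : fr.vol.symm (zmonomial x b) =
          ((b i : F)⁻¹) ^ p • wedgeD fun j => zmonomial x (B j) := by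
        apply fr.vol.injective
        rw [LinearEquiv.apply_symm_apply, map_smul, fr.vol_wedgeD_zmonomial h, hB1, hB2, ← hbp,
          smul_eq_mul, mul_comm, mul_assoc, mul_inv_cancel₀ hbi, mul_one]
      rw [h3, hmul, h1, map_zero, mul_zero]
  have : fr.vol η ∈ S := by rw [hS]; trivial
  rw [hS', LinearEquiv.symm_apply_apply] at this
  exact this.symm

end Cartier

/-! ### Laurent rings on arbitrary index types, and regularity modulo an element. -/

section LaurentAdjoin

variable (k : Type*) {F ι : Type*} [Field k] [Field F] [Algebra k F]

/-- The algebra of Laurent polynomials in the elements `x i` of a field. -/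
def laurentAdjoin (x : ι → F) : Subalgebra k F :=
  Algebra.adjoin k (Set.range x ∪ Set.range fun i => (x i)⁻¹)

variable {k} {x : ι → F}

theorem mem_laurentAdjoin (i : ι) : x i ∈ laurentAdjoin k x :=
  Algebra.subset_adjoin (Or.inl ⟨i, rfl⟩)

theorem inv_mem_laurentAdjoin (i : ι) : (x i)⁻¹ ∈ laurentAdjoin k x :=
  Algebra.subset_adjoin (Or.inr ⟨i, rfl⟩)

theorem zpow_mem_laurentAdjoin (i : ι) (m : ℤ) : x i ^ m ∈ laurentAdjoin k x := by
  obtain ⟨m, rfl | rfl⟩ := m.eq_nat_or_neg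
  · rw [zpow_natCast]; exact pow_mem (mem_laurentAdjoin i) m
  · rw [zpow_neg, zpow_natCast, ← inv_pow]; exact pow_mem (inv_mem_laurentAdjoin i) m

theorem zmonomial_mem_laurentAdjoin [Fintype ι] (b : ι → ℤ) :
    zmonomial x b ∈ laurentAdjoin k x :=
  prod_mem fun i _ => zpow_mem_laurentAdjoin i _

theorem laurentAdjoin_le {A : Subalgebra k F} (h : ∀ i, x i ∈ A ∧ (x i)⁻¹ ∈ A) :
    laurentAdjoin k x ≤ A := by
  refine Algebra.adjoin_le ?_
  rintro _ (⟨i, rfl⟩ | ⟨i, rfl⟩)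
  exacts [(h i).1, (h i).2]

theorem laurentAdjoin_comp_le {κ : Type*} (e : κ → ι) :
    laurentAdjoin k (x ∘ e) ≤ laurentAdjoin k x :=
  laurentAdjoin_le fun i => ⟨mem_laurentAdjoin (e i), inv_mem_laurentAdjoin (e i)⟩

/-- If the `w l` lie in `A` and `D` clears the denominators of their inverses, then a power of `D`
clears the denominators of a Laurent polynomial in the `w l`. -/
theorem exists_mul_pow_mem {A : Subalgebra k F} {D : F} (hD : D ∈ A) {w : ι → F}
    (hw : ∀ l, w l ∈ A) (hw' : ∀ l, (w l)⁻¹ * D ∈ A) {y : F} (hy : y ∈ laurentAdjoin k w) :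
    ∃ a : ℕ, y * D ^ a ∈ A := by
  induction hy using Algebra.adjoin_induction with
  | mem y hy =>
    rcases hy with ⟨l, rfl⟩ | ⟨l, rfl⟩
    · exact ⟨0, by simpa using hw l⟩
    · exact ⟨1, by simpa using hw' l⟩
  | algebraMap c => exact ⟨0, by simp⟩
  | add y z _ _ hy hz =>
    obtain ⟨a, ha⟩ := hy
    obtain ⟨b, hb⟩ := hz
    refine ⟨a + b, ?_⟩
    have : (y + z) * D ^ (a + b) = y * D ^ a * D ^ b + z * D ^ b * D ^ a := by ring
    rw [this]
    exact add_mem (mul_mem ha (pow_mem hD _)) (mul_mem hb (pow_mem hD _))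
  | mul y z _ _ hy hz =>
    obtain ⟨a, ha⟩ := hy
    obtain ⟨b, hb⟩ := hz
    refine ⟨a + b, ?_⟩
    have : y * z * D ^ (a + b) = y * D ^ a * (z * D ^ b) := by ring
    rw [this]
    exact mul_mem ha hb

/-- `B` is a nonzerodivisor modulo `A` in the subalgebra `R` of a field. -/
def RegularMod (R : Subalgebra k F) (A B : F) : Prop :=
  ∀ g ∈ R, B * g * A⁻¹ ∈ R → g * A⁻¹ ∈ R

namespace RegularMod

variable {R : Subalgebra k F} {A B C : F}

theorem mul (hB : RegularMod R A B) (hC : RegularMod R A C) (hCR : C ∈ R) :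
    RegularMod R A (B * C) := fun g hg h =>
  hC g hg (hB _ (mul_mem hCR hg) (by rwa [← mul_assoc]))

/-- Modulo `A` the element is the unit `B`. -/
theorem of_unit_add (h0 : B ≠ 0) (hB : B⁻¹ ∈ R) (hA0 : A ≠ 0) (hC : C ∈ R) :
    RegularMod R A (B + A * C) := fun g hg h => by
  have e : g * A⁻¹ = B⁻¹ * ((B + A * C) * g * A⁻¹ - C * g) := by field_simp; ring
  rw [e]
  exact mul_mem hB (sub_mem h (mul_mem hC hg))

theorem of_unit (h0 : B ≠ 0) (hB : B⁻¹ ∈ R) : RegularMod R A B := fun g _ h => by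
  have e : g * A⁻¹ = B⁻¹ * (B * g * A⁻¹) := by
    rw [mul_assoc B, inv_mul_cancel_left₀ h0]
  rw [e]
  exact mul_mem hB h

theorem mul_unit_left (h : RegularMod R A B) (h0 : C ≠ 0) (hC : C ∈ R) (hC' : C⁻¹ ∈ R) :
    RegularMod R (A * C) B := fun g hg hBg => by
  rw [mul_inv, ← mul_assoc] at hBg ⊢
  refine mul_mem (h g hg ?_) hC'
  have := mul_mem hBg hC
  rwa [inv_mul_cancel_right₀ h0] at this

theorem pow (h : RegularMod R A B) (hB : B ∈ R) (b : ℕ) : RegularMod R A (B ^ b) := by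
  induction b with
  | zero => exact of_unit (by simp) (by simp)
  | succ b ih => rw [pow_succ]; exact ih.mul h hB

/-- This replaces the argument with coprime denominators in a factorial ring: regularity of the
powers of `B` modulo `A` removes the factors `A` from the denominator one by one. -/
theorem mem (h : RegularMod R A B) (hA : A ≠ 0) (hB : B ∈ R) {y : F} {a b : ℕ}
    (ha : y * A ^ a ∈ R) (hb : y * B ^ b ∈ R) (hAR : A ∈ R) : y ∈ R := by
  induction a with
  | zero => simpa using ha
  | succ a ih =>
    apply ih
    have e : ∀ z : F, z * A ^ (a + 1) * A⁻¹ = z * A ^ a := fun z => by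
      rw [pow_succ, ← mul_assoc, mul_inv_cancel_right₀ hA]
    have := h.pow hB b (y * A ^ (a + 1)) ha (by
      rw [← mul_assoc, e, show B ^ b * y * A ^ a = y * B ^ b * A ^ a by ring]
      exact mul_mem hb (pow_mem hAR a))
    rwa [e] at this

end RegularMod

end LaurentAdjoin

/-! ### Laurent polynomials as polynomials in one chosen variable. -/

section Grading

variable {k F ι : Type*} [Field k] [Field F] [Algebra k F] {x : ι → F}

variable (k x) in
/-- Laurent polynomials in the variables other than `x i`. -/
abbrev laurentOff (i : ι) : Subalgebra k F := laurentAdjoin k fun l : {l // l ≠ i} => x l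

theorem laurentOff_le (i : ι) : laurentOff k x i ≤ laurentAdjoin k x :=
  laurentAdjoin_comp_le (x := x) (Subtype.val : {l // l ≠ i} → ι)

theorem zmonomial_mem_laurentOff [Fintype ι] {i : ι} {b : ι → ℤ} (hb : b i = 0) :
    zmonomial x b ∈ laurentOff k x i := by
  refine prod_mem fun l _ => ?_
  by_cases hl : l = i
  · subst hl; rw [hb, zpow_zero]; exact one_mem _
  · exact zpow_mem_laurentAdjoin (x := fun l : {l // l ≠ i} => x l) ⟨l, hl⟩ _

theorem transcendental_laurentOff (hx : AlgebraicIndependent k x) (i : ι) :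
    Transcendental (laurentOff k x i) (x i) := by
  have h1 := hx.transcendental_adjoin (s := {i}ᶜ) (i := i) (by simp)
  rw [← IntermediateField.transcendental_adjoin_iff] at h1
  have hle : laurentOff k x i ≤ (IntermediateField.adjoin k (x '' {i}ᶜ)).toSubalgebra :=
    laurentAdjoin_le fun l => by
      have : x l ∈ IntermediateField.adjoin k (x '' {i}ᶜ) :=
        IntermediateField.subset_adjoin _ _ ⟨l, l.2, rfl⟩
      exact ⟨this, IntermediateField.inv_mem _ this⟩
  exact Transcendental.of_tower_top_of_subalgebra_le hle h1

/-- Together with the transcendence of `x i` over `laurentOff`, this allows Laurent polynomials to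
be compared coefficient by coefficient in `x i`. -/
theorem exists_pow_mul_eq_aeval (h : ∀ l, x l ≠ 0) (i : ι) {g : F} (hg : g ∈ laurentAdjoin k x) :
    ∃ (N : ℕ) (q : Polynomial (laurentOff k x i)), x i ^ N * g = Polynomial.aeval (x i) q := by
  induction hg using Algebra.adjoin_induction with
  | mem y hy =>
    rcases hy with ⟨l, rfl⟩ | ⟨l, rfl⟩
    · by_cases hl : l = i
      · subst hl; exact ⟨0, Polynomial.X, by simp⟩
      · exact ⟨0, Polynomial.C ⟨x l, mem_laurentAdjoin (x := fun l : {l // l ≠ i} => x l) ⟨l, hl⟩⟩,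
          by simp [Algebra.algebraMap_eq_smul_one, Subalgebra.smul_def]⟩
    · by_cases hl : l = i
      · subst hl; exact ⟨1, 1, by simp [h l]⟩
      · exact ⟨0, Polynomial.C ⟨(x l)⁻¹,
          inv_mem_laurentAdjoin (x := fun l : {l // l ≠ i} => x l) ⟨l, hl⟩⟩,
          by simp [Algebra.algebraMap_eq_smul_one, Subalgebra.smul_def]⟩
  | algebraMap c =>
    exact ⟨0, Polynomial.C (algebraMap k _ c), by
      simp [Algebra.algebraMap_eq_smul_one]⟩
  | add y z _ _ hy hz =>
    obtain ⟨a, q, ha⟩ := hy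
    obtain ⟨b, r, hb⟩ := hz
    refine ⟨a + b, q * Polynomial.X ^ b + r * Polynomial.X ^ a, ?_⟩
    simp only [map_add, map_mul, map_pow, Polynomial.aeval_X, ← ha, ← hb]
    ring
  | mul y z _ _ hy hz =>
    obtain ⟨a, q, ha⟩ := hy
    obtain ⟨b, r, hb⟩ := hz
    refine ⟨a + b, q * r, ?_⟩
    simp only [map_mul, ← ha, ← hb]
    ring

/-- A binomial `b₀ + b₁ x i`, with `b₀` invertible, is a nonzerodivisor modulo elements that do not
involve `x i`. -/
theorem regularMod_of_linear (hx : AlgebraicIndependent k x) {i : ι} {A b₀ b₁ : F}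
    (hA : A ∈ laurentOff k x i) (hA0 : A ≠ 0) (hb₀ : b₀ ∈ laurentOff k x i)
    (hb₀' : b₀⁻¹ ∈ laurentOff k x i) (h0 : b₀ ≠ 0) (hb₁ : b₁ ∈ laurentOff k x i) :
    RegularMod (laurentAdjoin k x) A (b₀ + b₁ * x i) := by
  intro g hg hh
  have hne : ∀ l, x l ≠ 0 := hx.ne_zero
  obtain ⟨N, q, hq⟩ := exists_pow_mul_eq_aeval hne i hg
  obtain ⟨M, r, hr⟩ := exists_pow_mul_eq_aeval hne i hh
  have hsm : ∀ c : laurentOff k x i, algebraMap (laurentOff k x i) F c = c := fun _ => rfl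
  have key : Polynomial.C ⟨A, hA⟩ * (Polynomial.X ^ N * r) =
      (Polynomial.C ⟨b₀, hb₀⟩ + Polynomial.C ⟨b₁, hb₁⟩ * Polynomial.X) *
        (Polynomial.X ^ M * q) := by
    apply transcendental_iff_injective.1 (transcendental_laurentOff hx i)
    simp only [map_add, map_mul, map_pow, Polynomial.aeval_X, Polynomial.aeval_C, ← hq, ← hr, hsm]
    field_simp
  set q' := Polynomial.X ^ M * q with hq'
  -- With `r' = X^N r`, comparison of coefficients gives `A r'_m = b₀ q'_m + b₁ q'_{m-1}`. Since
  -- `b₀` is a unit, divisibility by `A` propagates upwards from the lowest coefficient.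
  have hcoef : ∀ m, (q'.coeff m : F) * A⁻¹ ∈ laurentOff k x i := fun m => by
    induction m with
    | zero =>
      have h1 := congrArg (fun f => ((f.coeff 0 : laurentOff k x i) : F)) key
      simp only [Polynomial.coeff_C_mul, add_mul, Polynomial.coeff_add, mul_assoc,
        Polynomial.coeff_X_mul_zero, mul_zero, add_zero, MulMemClass.coe_mul] at h1
      have h2 : (q'.coeff 0 : F) * A⁻¹ =
          b₀⁻¹ * ((Polynomial.X ^ N * r).coeff 0 : laurentOff k x i) := by
        field_simp
        linear_combination -h1
      rw [h2]
      exact mul_mem hb₀' (Subtype.property _)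
    | succ m ih =>
      have h1 := congrArg (fun f => ((f.coeff (m + 1) : laurentOff k x i) : F)) key
      simp only [Polynomial.coeff_C_mul, add_mul, Polynomial.coeff_add, mul_assoc,
        Polynomial.coeff_X_mul, AddMemClass.coe_add, MulMemClass.coe_mul] at h1
      have h2 : (q'.coeff (m + 1) : F) * A⁻¹ = b₀⁻¹ *
          (((Polynomial.X ^ N * r).coeff (m + 1) : laurentOff k x i) -
            b₁ * ((q'.coeff m : F) * A⁻¹)) := by
        field_simp
        linear_combination -h1
      rw [h2]
      exact mul_mem hb₀' (sub_mem (Subtype.property _) (mul_mem hb₁ ih))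
  have h3 : g * A⁻¹ = (x i)⁻¹ ^ (M + N) *
      ∑ m ∈ Finset.range (q'.natDegree + 1), ((q'.coeff m : F) * A⁻¹) * x i ^ m := by
    have h4 : x i ^ (M + N) * g = Polynomial.aeval (x i) q' := by
      rw [hq', map_mul, ← hq]; simp; ring
    rw [Polynomial.aeval_eq_sum_range] at h4
    have h5 : ∑ m ∈ Finset.range (q'.natDegree + 1), ((q'.coeff m : F) * A⁻¹) * x i ^ m =
        (x i ^ (M + N) * g) * A⁻¹ := by
      rw [h4, Finset.sum_mul]
      refine Finset.sum_congr rfl fun m _ => ?_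
      rw [Subalgebra.smul_def, smul_eq_mul]
      ring
    rw [h5, inv_pow, mul_assoc (x i ^ (M + N)), inv_mul_cancel_left₀ (pow_ne_zero _ (hne i))]
  rw [h3]
  exact mul_mem (pow_mem (inv_mem_laurentAdjoin i) _) (sum_mem fun m _ =>
    mul_mem (laurentOff_le i (hcoef m)) (pow_mem (mem_laurentAdjoin i) m))

end Grading

/-! ### Seeds given by skew-symmetric matrices, with mutation at every vertex. -/

section ExchangeSeed

theorem zmonomial_update {F ι : Type*} [Field F] [Fintype ι] [DecidableEq ι] (x : ι → F) (i : ι)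
    (y : F) (e : ι → ℤ) :
    zmonomial (Function.update x i y) e = y ^ e i * zmonomial x (Function.update e i 0) := by
  rw [zmonomial, zmonomial, ← Finset.mul_prod_erase _ _ (Finset.mem_univ i),
    ← Finset.mul_prod_erase Finset.univ (fun j => x j ^ Function.update e i 0 j)
      (Finset.mem_univ i)]
  simp only [Function.update_self, zpow_zero, one_mul]
  congr 1
  refine Finset.prod_congr rfl fun j hj => ?_
  rw [Function.update_of_ne (Finset.ne_of_mem_erase hj),
    Function.update_of_ne (Finset.ne_of_mem_erase hj)]

theorem zmonomial_eq_zpow_mul {F ι : Type*} [Field F] [Fintype ι] [DecidableEq ι] (x : ι → F)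
    (i : ι) (e : ι → ℤ) : zmonomial x e = x i ^ e i * zmonomial x (Function.update e i 0) := by
  rw [← zmonomial_update, Function.update_eq_self]

/-- An integer exchange matrix together with a tuple of elements of a field. -/
@[ext]
structure ExchangeSeed (F ι : Type*) where
  B : ι → ι → ℤ
  x : ι → F

namespace ExchangeSeed

variable {k F ι : Type*} [Field k] [Field F] [Algebra k F]

/-- The seed with the opposite exchange matrix. -/
def neg (s : ExchangeSeed F ι) : ExchangeSeed F ι := ⟨fun i j => -s.B i j, s.x⟩

variable (k) in
/-- The exchange matrix is skew-symmetric and the cluster is algebraically independent. -/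
structure IsFree (s : ExchangeSeed F ι) : Prop where
  skew : ∀ i j, s.B i j = -s.B j i
  indep : AlgebraicIndependent k s.x

variable {s : ExchangeSeed F ι}

namespace IsFree

variable (hs : s.IsFree k)
include hs

theorem neg : s.neg.IsFree k := ⟨fun i j => by simp [ExchangeSeed.neg, hs.skew i j], hs.indep⟩

theorem diag (i : ι) : s.B i i = 0 := by
  have := hs.skew i i
  omega

theorem ne_zero (i : ι) : s.x i ≠ 0 := hs.indep.ne_zero i

end IsFree

variable [Fintype ι]

/-- The numerator of the exchange relation at `v`. -/
def numerator (s : ExchangeSeed F ι) (v : ι) : F :=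
  zmonomial s.x (fun l => max (s.B l v) 0) + zmonomial s.x fun l => max (-s.B l v) 0

theorem neg_numerator (v : ι) : s.neg.numerator v = s.numerator v := by
  simp [numerator, neg, add_comm]

namespace IsFree

variable (hs : s.IsFree k)
include hs

theorem numerator_mem (v : ι) : s.numerator v ∈ laurentOff k s.x v :=
  add_mem (zmonomial_mem_laurentOff (by simp [hs.diag]))
    (zmonomial_mem_laurentOff (by simp [hs.diag]))

/-- The two monomials differ unless column `v` of `B` is zero, and in that case the numerator is
`2`. This case has to be covered, because exchange seeds do not record frozen vertices. -/
theorem numerator_ne_zero (h2 : (2 : k) ≠ 0) (v : ι) : s.numerator v ≠ 0 := by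
  classical
  let e₁ : ι →₀ ℕ := Finsupp.equivFunOnFinite.symm fun l => (s.B l v).toNat
  let e₂ : ι →₀ ℕ := Finsupp.equivFunOnFinite.symm fun l => (-s.B l v).toNat
  have key : MvPolynomial.aeval s.x
      (MvPolynomial.monomial e₁ (1 : k) + MvPolynomial.monomial e₂ (1 : k)) = s.numerator v := by
    have hz : ∀ (a : F) (m : ℤ), a ^ max m 0 = a ^ m.toNat := fun a m => by
      rw [← Int.toNat_eq_max, zpow_natCast]
    simp [MvPolynomial.aeval_monomial, numerator, zmonomial, e₁, e₂, Finsupp.prod_fintype, hz]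
  rw [← key]
  intro h0
  have h1 := (injective_iff_map_eq_zero _).1 hs.indep _ h0
  have h3 := congrArg (MvPolynomial.coeff e₁) h1
  simp only [MvPolynomial.coeff_add, MvPolynomial.coeff_monomial, if_true,
    MvPolynomial.coeff_zero] at h3
  split_ifs at h3
  · exact h2 (by rw [← h3]; norm_num)
  · simp at h3

end IsFree

variable [DecidableEq ι]

/-- Mutation of exchange seeds. -/
def mutate (s : ExchangeSeed F ι) (v : ι) : ExchangeSeed F ι where
  B i j := if i = v ∨ j = v then -s.B i j else
    s.B i j + max (s.B i v) 0 * max (s.B v j) 0 - max (-s.B i v) 0 * max (-s.B v j) 0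
  x := Function.update s.x v (s.numerator v * (s.x v)⁻¹)

/-- Iterated mutation. -/
def path (s : ExchangeSeed F ι) (w : List ι) : ExchangeSeed F ι := w.foldl mutate s

theorem zmonomial_mutate (s : ExchangeSeed F ι) {i : ι} {e : ι → ℤ} (he : e i = 0) :
    zmonomial (s.mutate i).x e = zmonomial s.x e := by
  rw [show (s.mutate i).x = Function.update s.x i (s.numerator i * (s.x i)⁻¹) from rfl,
    zmonomial_update, zmonomial_eq_zpow_mul s.x i e, he, zpow_zero, zpow_zero]

theorem mutate_x_self (s : ExchangeSeed F ι) (i : ι) :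
    (s.mutate i).x i = s.numerator i * (s.x i)⁻¹ :=
  Function.update_self ..

theorem mutate_x_of_ne (s : ExchangeSeed F ι) {i l : ι} (h : l ≠ i) :
    (s.mutate i).x l = s.x l :=
  Function.update_of_ne h ..

theorem neg_mutate (s : ExchangeSeed F ι) (v : ι) : (s.mutate v).neg = s.neg.mutate v := by
  ext i j
  · simp only [neg, mutate]
    split_ifs
    · rfl
    · simp only [neg_neg]; ring
  · simp only [mutate, neg_numerator]
    rfl

namespace IsFree

variable (hs : s.IsFree k)
include hs

/-- The old variable at `v` is recovered rationally from the new one and the unchanged variables, so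
algebraicity of the new one would imply that of the old one. -/
theorem mutate (h2 : (2 : k) ≠ 0) (v : ι) : (s.mutate v).IsFree k where
  skew i j := by
    have h1 := hs.skew i j
    have h3 := hs.skew i v
    have h4 := hs.skew v j
    simp only [ExchangeSeed.mutate, or_comm (a := j = v)]
    split_ifs
    · rw [h1]
    · rw [h3, h4, h1]; simp only [neg_neg]; ring
  indep := by
    have hi := hs.indep
    rw [AlgebraicIndependent.iff_transcendental_adjoin_image v] at hi ⊢
    have h1 : ∀ l, l ≠ v → (s.mutate v).x l = s.x l := fun l hl =>
      Function.update_of_ne hl _ _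
    have h3 : (s.mutate v).x '' {v}ᶜ = s.x '' {v}ᶜ :=
      Set.image_congr fun l hl => h1 l hl
    have h4 : (fun j : {j // j ≠ v} => (s.mutate v).x j) = fun j : {j // j ≠ v} => s.x j :=
      funext fun j => h1 j j.2
    rw [h3, h4]
    refine ⟨hi.1, ?_⟩
    have ht := hi.2
    rw [← IntermediateField.transcendental_adjoin_iff] at ht ⊢
    intro halg
    apply ht
    set K := IntermediateField.adjoin k (s.x '' {v}ᶜ)
    have hle : laurentOff k s.x v ≤ K.toSubalgebra :=
      laurentAdjoin_le fun l => by
        have : s.x l ∈ K := IntermediateField.subset_adjoin _ _ ⟨l, l.2, rfl⟩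
        exact ⟨this, K.inv_mem this⟩
    have hP : s.numerator v ∈ K := hle (hs.numerator_mem v)
    have h5 : s.x v = s.numerator v * ((s.mutate v).x v)⁻¹ := by
      have := hs.numerator_ne_zero h2 v
      simp only [ExchangeSeed.mutate, Function.update_self, mul_inv, inv_inv]
      rw [mul_inv_cancel_left₀ this]
    rw [h5]
    exact (isAlgebraic_algebraMap (⟨_, hP⟩ : K)).mul halg.inv

/-- Mutation negates column `i`, which swaps the two monomials, and neither of them involves `x i`.
This makes mutation an involution. -/
theorem numerator_mutate_self (i : ι) :
    (s.mutate i).numerator i = s.numerator i := by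
  have h0 : ∀ l, (s.mutate i).B l i = -s.B l i := fun l => by simp [ExchangeSeed.mutate]
  rw [numerator, numerator, zmonomial_mutate _ (by simp [h0, hs.diag]),
    zmonomial_mutate _ (by simp [h0, hs.diag])]
  simp only [h0, neg_neg]
  rw [add_comm]

theorem mutate_mutate (h2 : (2 : k) ≠ 0) (v : ι) : (s.mutate v).mutate v = s := by
  ext i j
  · by_cases hi : i = v
    · subst hi; simp [ExchangeSeed.mutate]
    by_cases hj : j = v
    · subst hj; simp [ExchangeSeed.mutate]
    simp [ExchangeSeed.mutate, hi, hj]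
  · by_cases hi : i = v
    · subst hi
      rw [mutate_x_self, hs.numerator_mutate_self, mutate_x_self, mul_inv, inv_inv,
        mul_inv_cancel_left₀ (hs.numerator_ne_zero h2 i)]
    · simp [ExchangeSeed.mutate, hi]

end IsFree

end ExchangeSeed

end ExchangeSeed

/-! ### The mutations `i, j, i` when `i` and `j` are joined. -/

section RankTwo

/-- In a subring, `(a + c) ^ m - a ^ m` is divisible by `c`. -/
theorem exists_add_pow_eq {k F : Type*} [Field k] [Field F] [Algebra k F] {R : Subalgebra k F}
    {a c : F} (ha : a ∈ R) (hc : c ∈ R) (m : ℕ) : ∃ S ∈ R, (a + c) ^ m = a ^ m + c * S := by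
  induction m with
  | zero => exact ⟨0, R.zero_mem, by simp⟩
  | succ m ih =>
    obtain ⟨S, hS, h⟩ := ih
    refine ⟨a ^ m + (a + c) * S, add_mem (pow_mem ha m) (mul_mem (add_mem ha hc) hS), ?_⟩
    rw [pow_succ, h]; ring

namespace ExchangeSeed

variable {k F ι : Type*} [Field k] [Field F] [Algebra k F] [Fintype ι] [DecidableEq ι]
  {s : ExchangeSeed F ι}

/-- The three-step mutation `i, j, i` when there are arrows between `i` and `j`. -/
theorem IsFree.rank_two_pos (hs : s.IsFree k) (h2 : (2 : k) ≠ 0) {i j : ι} {b : ℕ} (hb : 0 < b)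
    (hij : s.B i j = b) :
    let R := laurentAdjoin k s.x
    let s₁ := s.mutate i
    let s₂ := s₁.mutate j
    let s₃ := s₂.mutate i
    (s₂.x j ∈ R ∧ RegularMod R (s₁.x i) (s₂.x j)) ∧
      s₃.x i ∈ R ∧ RegularMod R (s₁.x i) (s₃.x i) := by
  intro R s₁ s₂ s₃
  have hs₁ : s₁.IsFree k := hs.mutate h2 i
  have hs₂ : s₂.IsFree k := hs₁.mutate h2 j
  have hne : i ≠ j := by rintro rfl; rw [hs.diag] at hij; omega
  have h0 := hs.ne_zero
  have hxi := h0 i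
  have hxj := h0 j
  have hji : s.B j i = -b := by rw [hs.skew, hij]
  have hz : ∀ e, zmonomial s.x e ≠ 0 := zmonomial_ne_zero h0
  have hzR : ∀ e, zmonomial s.x e ∈ R := zmonomial_mem_laurentAdjoin
  have hzR' : ∀ e, (zmonomial s.x e)⁻¹ ∈ R := fun e => by
    rw [← zmonomial_neg]; exact zmonomial_mem_laurentAdjoin _
  set P := s.numerator i with hP
  have hP0 : P ≠ 0 := hs.numerator_ne_zero h2 i
  have hPR : P ∈ R := laurentOff_le i (hs.numerator_mem i)
  set y := s₁.x i with hy
  have hyP : y = P * (s.x i)⁻¹ := by simp [hy, s₁, ExchangeSeed.mutate, hP]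
  have hx₁ : s₁.x = Function.update s.x i y := by rw [hyP]; rfl
  have hy0 : y ≠ 0 := hs₁.ne_zero i
  have hyR : y ∈ R := by rw [hyP]; exact mul_mem hPR (inv_mem_laurentAdjoin i)
  -- the first mutated matrix
  set α : ι → ℤ := fun l => max (s.B l i) 0 with hα
  set β : ι → ℤ := fun l => max (-s.B l i) 0 with hβ
  have hB1 : ∀ l, l ≠ i → s₁.B l j = s.B l j + b * α l := fun l hl => by
    simp only [s₁, ExchangeSeed.mutate, hl, hne.symm, or_self, if_false, hij, hα]
    rw [max_eq_left (by omega : (b : ℤ) ≥ 0), max_eq_right (by omega : -(b : ℤ) ≤ 0)]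
    ring
  have hB1i : s₁.B i j = -b := by simp [s₁, ExchangeSeed.mutate, hij]
  have hB1ji : s₁.B j i = b := by simp [s₁, ExchangeSeed.mutate, hji]
  have hB1li : ∀ l, s₁.B l i = -s.B l i := fun l => by simp [s₁, ExchangeSeed.mutate]
  set γ : ι → ℤ := fun l => max (s₁.B l j) 0 with hγ
  set δ : ι → ℤ := fun l => max (-s₁.B l j) 0 with hδ
  have hγi : γ i = 0 := by simp only [hγ, hB1i]; omega
  have hδi : δ i = b := by simp only [hδ, hB1i]; omega
  have hγj : γ j = 0 := by simp [hγ, hs₁.diag]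
  set X := s₂.x j with hX
  set M₁ := zmonomial s.x γ with hM₁
  set M₂ := zmonomial s.x (Function.update δ i 0) with hM₂
  have hXeq : X = (M₁ + y ^ b * M₂) * (s.x j)⁻¹ := by
    have e1 : X = s₁.numerator j * (s₁.x j)⁻¹ := by simp [hX, s₂, ExchangeSeed.mutate]
    have e2 : s₁.x j = s.x j := by rw [hx₁, Function.update_of_ne hne.symm]
    rw [e1, e2, numerator, ← hγ, ← hδ, hx₁, zmonomial_update, zmonomial_update, hγi, hδi, zpow_zero,
      one_mul, zpow_natCast, hM₁, zmonomial_eq_zpow_mul s.x i γ, hγi, zpow_zero, one_mul]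
  have hXR : X ∈ R := by
    rw [hXeq]
    exact mul_mem (add_mem (hzR _) (mul_mem (pow_mem hyR _) (hzR _))) (inv_mem_laurentAdjoin j)
  -- the second mutated matrix
  have hB2 : ∀ l, l ≠ j → s₂.B l i = -s.B l i + b * γ l := fun l hl => by
    simp only [s₂, ExchangeSeed.mutate, hl, hne, or_self, if_false, hB1ji, hB1li, hγ]
    rw [max_eq_left (by omega : (b : ℤ) ≥ 0), max_eq_right (by omega : -(b : ℤ) ≤ 0)]
    ring
  have hB2j : s₂.B j i = -b := by simp [s₂, ExchangeSeed.mutate, hB1ji]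
  set ε : ι → ℤ := fun l => max (s₂.B l i) 0 with hε
  set ζ : ι → ℤ := fun l => max (-s₂.B l i) 0 with hζ
  have hεj : ε j = 0 := by simp only [hε, hB2j]; omega
  have hζj : ζ j = b := by simp only [hζ, hB2j]; omega
  have hεi : ε i = 0 := by simp [hε, hs₂.diag]
  have hζi : ζ i = 0 := by simp [hζ, hs₂.diag]
  set Z := s₃.x i with hZ
  set N₁ := zmonomial s.x (Function.update ζ j 0) with hN₁
  have hx₂ : s₂.x = Function.update (Function.update s.x i y) j X := by
    rw [← hx₁]
    have e1 : X = s₁.numerator j * (s₁.x j)⁻¹ := by simp [hX, s₂, ExchangeSeed.mutate]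
    rw [e1]; rfl
  have hx₂i : s₂.x i = y := by rw [hx₂, Function.update_of_ne hne, Function.update_self]
  have hup : ∀ e : ι → ℤ, e i = 0 → Function.update e i 0 = e := fun e he => by
    rw [← he, Function.update_eq_self]
  have hup' : ∀ e : ι → ℤ, e j = 0 → Function.update e j 0 = e := fun e he => by
    rw [← he, Function.update_eq_self]
  have hm : ∀ e : ι → ℤ, e i = 0 →
      zmonomial s₂.x e = X ^ e j * zmonomial s.x (Function.update e j 0) := fun e he => by
    have h' : Function.update e j 0 i = 0 := by rw [Function.update_of_ne hne, he]
    rw [hx₂, zmonomial_update, zmonomial_update, hup _ h', h', zpow_zero, one_mul]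
  have hZeq : Z = (zmonomial s.x ε + X ^ b * N₁) * y⁻¹ := by
    have e1 : Z = s₂.numerator i * (s₂.x i)⁻¹ := by simp [hZ, s₃, ExchangeSeed.mutate]
    rw [e1, hx₂i, numerator, ← hε, ← hζ, hm ε hεi, hm ζ hζi, hεj, hζj, zpow_zero, one_mul,
      zpow_natCast, hup' ε hεj]
  -- comparison of the exchange polynomials at `i`
  have hβj : β j = b := by simp only [hβ, hji]; omega
  have hαj : α j = 0 := by simp only [hα, hji]; omega
  have hαi : α i = 0 := by simp [hα, hs.diag]
  have hexp : ε + α = Function.update ζ j 0 + b • γ + Function.update β j 0 := by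
    ext l
    by_cases hl : l = j
    · subst hl; simp [hεj, hαj, hγj]
    · simp only [Pi.add_apply, Pi.smul_apply, Function.update_of_ne hl, hε, hζ, hα, hβ, hB2 l hl]
      rw [nsmul_eq_mul]
      have a1 : ∀ t : ℤ, max t 0 = t + max (-t) 0 := fun t => by omega
      rw [a1 (-s.B l i + b * γ l), a1 (s.B l i)]
      ring
  have hN₂ : zmonomial s.x ε * zmonomial s.x α =
      N₁ * M₁ ^ b * zmonomial s.x (Function.update β j 0) := by
    rw [← zmonomial_add h0, hexp, zmonomial_add h0, zmonomial_add h0, zmonomial_nsmul]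
  have hPeq : P = zmonomial s.x α + s.x j ^ b * zmonomial s.x (Function.update β j 0) := by
    rw [hP, numerator, ← hα, ← hβ, zmonomial_eq_zpow_mul s.x j β, hβj, zpow_natCast]
  -- Modulo `y` the variable `X` is `M₁ / x_j`. Inserted into the numerator of `Z`, this gives a
  -- monomial times the original exchange polynomial `P = x_i y`; `U` is that monomial. Hence the
  -- division by `y` in `Z` succeeds.
  set U := N₁ * M₁ ^ b * (s.x j)⁻¹ ^ b * (zmonomial s.x α)⁻¹ with hU
  have hU1 : zmonomial s.x ε + (M₁ * (s.x j)⁻¹) ^ b * N₁ = U * (s.x i) * y := by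
    have e1 : zmonomial s.x ε = N₁ * M₁ ^ b * zmonomial s.x (Function.update β j 0) *
        (zmonomial s.x α)⁻¹ := by rw [← hN₂, mul_inv_cancel_right₀ (hz α)]
    rw [hyP, e1, hU, mul_pow, hPeq, inv_pow]
    have := hz α
    have := pow_ne_zero b hxj
    field_simp
    ring
  have hUeq : U =
      zmonomial s.x (Function.update ζ j 0 + b • γ + (-(b • Pi.single j 1)) + (-α)) := by
    rw [zmonomial_add h0, zmonomial_add h0, zmonomial_add h0, zmonomial_nsmul, zmonomial_neg,
      zmonomial_neg, zmonomial_nsmul, zmonomial_single, hU, inv_pow]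
  have hU0 : U ≠ 0 := by rw [hUeq]; exact hz _
  have hxjR : (s.x j)⁻¹ ∈ R := inv_mem_laurentAdjoin j
  obtain ⟨c, rfl⟩ : ∃ c, b = c + 1 := ⟨b - 1, by omega⟩
  refine ⟨⟨hXR, ?_⟩, ?_⟩
  · have e1 : X = M₁ * (s.x j)⁻¹ + y * (y ^ c * M₂ * (s.x j)⁻¹) := by rw [hXeq]; ring
    rw [e1]
    refine RegularMod.of_unit_add (mul_ne_zero (hz _) (inv_ne_zero hxj)) ?_ hy0
      (mul_mem (mul_mem (pow_mem hyR _) (hzR _)) hxjR)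
    rw [mul_inv, inv_inv]
    exact mul_mem (hzR' _) (mem_laurentAdjoin j)
  have hUi : (U * s.x i)⁻¹ ∈ R := by
    rw [mul_inv, hUeq]; exact mul_mem (hzR' _) (inv_mem_laurentAdjoin i)
  have hUiR : U * s.x i ∈ R := by
    rw [hUeq]; exact mul_mem (hzR _) (mem_laurentAdjoin i)
  -- The error `X^b - (M₁ / x_j)^b` is divisible by `y^b`. After division by `y` a factor `y^(b-1)`
  -- is left, so for `b ≥ 2` the variable `Z` is the unit `U x_i` modulo `y`. For `b = 1` no factor
  -- is left, and `Z` is handled as a binomial linear in `x_i`.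
  rcases Nat.eq_zero_or_pos c with rfl | hc
  · -- a single arrow
    have e1 : Z = N₁ * (s.x j)⁻¹ * M₂ + U * s.x i := by
      rw [hZeq, ← div_eq_mul_inv, div_eq_iff hy0, hXeq]
      simp only [zero_add, pow_one] at hU1 ⊢
      linear_combination hU1
    have e2 : N₁ * (s.x j)⁻¹ * M₂ =
        zmonomial s.x (Function.update ζ j 0 + -Pi.single j 1 + Function.update δ i 0) := by
      rw [zmonomial_add h0, zmonomial_add h0, zmonomial_neg, zmonomial_single]
    have hoff : ∀ e : ι → ℤ, e i = 0 → zmonomial s.x e ∈ laurentOff k s.x i := fun e =>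
      zmonomial_mem_laurentOff
    have ei : (Function.update ζ j 0 + -Pi.single j 1 + Function.update δ i 0 : ι → ℤ) i = 0 := by
      simp [hne, hζi]
    refine ⟨by rw [e1, e2]; exact add_mem (hzR _) hUiR, ?_⟩
    -- Up to the unit `x_i`, the element `y` is `P`, and neither `P` nor the two coefficients of `Z`
    -- involve `x_i`.
    rw [e1, e2, hyP]
    refine RegularMod.mul_unit_left ?_ (inv_ne_zero hxi) (inv_mem_laurentAdjoin i)
      (by rw [inv_inv]; exact mem_laurentAdjoin i)
    refine regularMod_of_linear hs.indep (hs.numerator_mem i) hP0 (hoff _ ei) ?_ (hz _) ?_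
    · rw [← zmonomial_neg]; exact hoff _ (by rw [Pi.neg_apply, ei, neg_zero])
    · rw [hUeq]
      exact hoff _ (by simp [hne, hζi, hγi, hαi])
  · -- several arrows
    obtain ⟨d, rfl⟩ : ∃ d, c = d + 1 := ⟨c - 1, by omega⟩
    obtain ⟨S, hS, hSeq⟩ := exists_add_pow_eq (R := R) (a := M₁) (c := y ^ (d + 1 + 1) * M₂)
      (hzR _) (mul_mem (pow_mem hyR _) (hzR _)) (d + 1 + 1)
    have e1 : Z = U * s.x i + y * (y ^ d * M₂ * S * (s.x j)⁻¹ ^ (d + 1 + 1) * N₁) := by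
      rw [hZeq, ← div_eq_mul_inv, div_eq_iff hy0, hXeq, mul_pow, hSeq]
      rw [mul_pow] at hU1
      linear_combination hU1
    have hR' : y ^ d * M₂ * S * (s.x j)⁻¹ ^ (d + 1 + 1) * N₁ ∈ R :=
      mul_mem (mul_mem (mul_mem (mul_mem (pow_mem hyR _) (hzR _)) hS) (pow_mem hxjR _)) (hzR _)
    rw [e1]
    exact ⟨add_mem hUiR (mul_mem hyR hR'), RegularMod.of_unit_add (mul_ne_zero hU0 hxi) hUi hy0 hR'⟩

end ExchangeSeed

end RankTwo

/-! ### Evaluating rational functions at `1`. -/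

section Specialization

open Polynomial in
/-- The value of the rational function `f` at `1` is `a`. -/
def SpecializesTo {F : Type*} [Field F] (f : RatFunc F) (a : F) : Prop :=
  ∃ p q : F[X], q.eval 1 ≠ 0 ∧ f * algebraMap F[X] (RatFunc F) q = algebraMap F[X] (RatFunc F) p ∧
    p.eval 1 = a * q.eval 1

namespace SpecializesTo

variable {F : Type*} [Field F] {f g : RatFunc F} {a b : F}

theorem C (a : F) : SpecializesTo (RatFunc.C a) a :=
  ⟨Polynomial.C a, 1, by simp, by simp, by simp⟩

theorem X : SpecializesTo (RatFunc.X : RatFunc F) 1 :=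
  ⟨Polynomial.X, 1, by simp, by simp, by simp⟩

theorem add (hf : SpecializesTo f a) (hg : SpecializesTo g b) : SpecializesTo (f + g) (a + b) := by
  obtain ⟨p, q, hq, h, hp⟩ := hf
  obtain ⟨p', q', hq', h', hp'⟩ := hg
  refine ⟨p * q' + p' * q, q * q', by simp [hq, hq'], ?_, ?_⟩
  · simp only [map_add, map_mul, ← h, ← h']; ring
  · simp only [Polynomial.eval_add, Polynomial.eval_mul, hp, hp']; ring

theorem mul (hf : SpecializesTo f a) (hg : SpecializesTo g b) : SpecializesTo (f * g) (a * b) := by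
  obtain ⟨p, q, hq, h, hp⟩ := hf
  obtain ⟨p', q', hq', h', hp'⟩ := hg
  refine ⟨p * p', q * q', by simp [hq, hq'], ?_, ?_⟩
  · simp only [map_mul, ← h, ← h']; ring
  · simp only [Polynomial.eval_mul, hp, hp']; ring

theorem ne_zero (hf : SpecializesTo f a) (ha : a ≠ 0) : f ≠ 0 := by
  rintro rfl
  obtain ⟨p, q, hq, h, hp⟩ := hf
  rw [zero_mul, eq_comm, map_eq_zero_iff _ (IsFractionRing.injective _ _)] at h
  rw [h, Polynomial.eval_zero, eq_comm] at hp
  exact mul_ne_zero ha hq hp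

theorem inv (hf : SpecializesTo f a) (ha : a ≠ 0) : SpecializesTo f⁻¹ a⁻¹ := by
  have hf0 := hf.ne_zero ha
  obtain ⟨p, q, hq, h, hp⟩ := hf
  refine ⟨q, p, by rw [hp]; exact mul_ne_zero ha hq, ?_, ?_⟩
  · rw [← h, inv_mul_cancel_left₀ hf0]
  · rw [hp, inv_mul_cancel_left₀ ha]

theorem unique (hf : SpecializesTo f a) (hg : SpecializesTo f b) : a = b := by
  obtain ⟨p, q, hq, h, hp⟩ := hf
  obtain ⟨p', q', hq', h', hp'⟩ := hg
  have h1 : p * q' = p' * q := by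
    apply IsFractionRing.injective (Polynomial F) (RatFunc F)
    rw [map_mul, map_mul, ← h, ← h']; ring
  have h2 := congrArg (Polynomial.eval 1) h1
  rw [Polynomial.eval_mul, Polynomial.eval_mul, hp, hp'] at h2
  have := mul_ne_zero hq hq'
  apply mul_right_cancel₀ this
  linear_combination h2

theorem one : SpecializesTo (1 : RatFunc F) 1 := by simpa using C (1 : F)

theorem pow (hf : SpecializesTo f a) (m : ℕ) : SpecializesTo (f ^ m) (a ^ m) := by
  induction m with
  | zero => simpa using one
  | succ m ih => rw [pow_succ, pow_succ]; exact ih.mul hf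

theorem zpow (hf : SpecializesTo f a) (ha : a ≠ 0) (m : ℤ) : SpecializesTo (f ^ m) (a ^ m) := by
  obtain ⟨m, rfl | rfl⟩ := m.eq_nat_or_neg
  · simpa using hf.pow m
  · simpa using (hf.pow m).inv (pow_ne_zero _ ha)

theorem prod {ι : Type*} {s : Finset ι} {f : ι → RatFunc F} {a : ι → F}
    (h : ∀ i ∈ s, SpecializesTo (f i) (a i)) : SpecializesTo (∏ i ∈ s, f i) (∏ i ∈ s, a i) := by
  classical
  induction s using Finset.induction_on with
  | empty => simpa using one
  | insert i s hi ih =>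
    rw [Finset.prod_insert hi, Finset.prod_insert hi]
    exact (h i (by simp)).mul (ih fun j hj => h j (by simp [hj]))

end SpecializesTo

end Specialization

/-! ### Adding a vertex to a seed. -/

namespace ExchangeSeed

variable {k F ι : Type*} [Field k] [Field F] [Algebra k F] [DecidableEq ι]

/-- The seed with an additional vertex `none`, connected only to `j`, whose variable is a new
indeterminate. -/
noncomputable def extend (s : ExchangeSeed F ι) (j : ι) : ExchangeSeed (RatFunc F) (Option ι) where
  B := fun a b => match a, b with
    | some l, some m => s.B l m
    | some l, none => if l = j then -1 else 0
    | none, some l => if l = j then 1 else 0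
    | none, none => 0
  x a := a.elim RatFunc.X fun l => RatFunc.C (s.x l)

/-- `t` is an extension of `s` by one vertex, and its variables specialize to those of `s` when the
variable of the additional vertex is set to `1`. -/
structure IsExtension (t : ExchangeSeed (RatFunc F) (Option ι)) (s : ExchangeSeed F ι) : Prop where
  B_some : ∀ i j, t.B (some i) (some j) = s.B i j
  x_some : ∀ l, SpecializesTo (t.x (some l)) (s.x l)
  x_none : SpecializesTo (t.x none) 1

theorem isExtension_extend (s : ExchangeSeed F ι) (j : ι) : IsExtension (s.extend j) s :=
  ⟨fun _ _ => rfl, fun _ => SpecializesTo.C _, SpecializesTo.X⟩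

variable {s : ExchangeSeed F ι}

theorem IsFree.extend (hs : s.IsFree k) (j : ι) : (s.extend j).IsFree k where
  skew a b := by
    rcases a with _ | a <;> rcases b with _ | b <;> simp only [ExchangeSeed.extend]
    · rfl
    · split_ifs <;> rfl
    · split_ifs <;> rfl
    · exact hs.skew a b
  indep := by
    have hX : AlgebraicIndependent F fun _ : Unit => (RatFunc.X : RatFunc F) := by
      rw [algebraicIndependent_unique_type_iff]
      exact RatFunc.transcendental_X
    have h1 := hs.indep.sumElim_comp hX
    let e : Option ι → Unit ⊕ ι := fun a => a.elim (Sum.inl ()) Sum.inr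
    have he : Function.Injective e := by
      rintro (_ | a) (_ | b) hab <;> simp_all [e]
    have hx : (s.extend j).x =
        Sum.elim (fun _ => RatFunc.X) (algebraMap F (RatFunc F) ∘ s.x) ∘ e := by
      ext a
      rcases a with _ | a
      · rfl
      · simp [ExchangeSeed.extend, e, RatFunc.algebraMap_eq_C]
    rw [hx]
    exact h1.comp e he

/-- Specializing the additional variable preserves the property of being a Laurent polynomial. -/
theorem mem_laurentAdjoin_of_extend (hs : s.IsFree k) (j : ι) {f : RatFunc F} {a : F}
    (hf : f ∈ laurentAdjoin k (s.extend j).x) (h : SpecializesTo f a) :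
    a ∈ laurentAdjoin k s.x := by
  have key : ∃ b ∈ laurentAdjoin k s.x, SpecializesTo f b := by
    clear h
    induction hf using Algebra.adjoin_induction with
    | mem f hf =>
      rcases hf with ⟨l, rfl⟩ | ⟨l, rfl⟩ <;> rcases l with _ | l
      · exact ⟨1, one_mem _, SpecializesTo.X⟩
      · exact ⟨_, mem_laurentAdjoin l, SpecializesTo.C _⟩
      · exact ⟨1⁻¹, by rw [inv_one]; exact one_mem _, SpecializesTo.X.inv (one_ne_zero (α := F))⟩
      · exact ⟨_, inv_mem_laurentAdjoin l, (SpecializesTo.C _).inv (hs.ne_zero l)⟩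
    | algebraMap c =>
      refine ⟨algebraMap k F c, Subalgebra.algebraMap_mem _ c, ?_⟩
      rw [IsScalarTower.algebraMap_apply k F (RatFunc F), RatFunc.algebraMap_eq_C]
      exact SpecializesTo.C _
    | add f g _ _ hf hg =>
      obtain ⟨a, ha, hf⟩ := hf
      obtain ⟨b, hb, hg⟩ := hg
      exact ⟨_, add_mem ha hb, hf.add hg⟩
    | mul f g _ _ hf hg =>
      obtain ⟨a, ha, hf⟩ := hf
      obtain ⟨b, hb, hg⟩ := hg
      exact ⟨_, mul_mem ha hb, hf.mul hg⟩
  obtain ⟨b, hb, hfb⟩ := key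
  rwa [h.unique hfb]

variable [Fintype ι] {t : ExchangeSeed (RatFunc F) (Option ι)}

/-- The matrix entries at `none` may change, but they only contribute powers of a variable that
specializes to `1`; so `IsExtension` does not need to record them. -/
theorem IsExtension.mutate (h : IsExtension t s) (hs : s.IsFree k) (v : ι) :
    IsExtension (t.mutate (some v)) (s.mutate v) := by
  have hz : ∀ e : Option ι → ℤ,
      SpecializesTo (zmonomial t.x e) (zmonomial s.x fun l => e (some l)) := fun e => by
    rw [zmonomial, Fintype.prod_option, zmonomial]
    have := (h.x_none.zpow one_ne_zero (e none)).mul (SpecializesTo.prod (s := Finset.univ)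
      fun l _ => (h.x_some l).zpow (hs.ne_zero l) (e (some l)))
    rwa [one_zpow, one_mul] at this
  have hnum : SpecializesTo (t.numerator (some v)) (s.numerator v) := by
    rw [numerator, numerator]
    have := (hz fun l => max (t.B l (some v)) 0).add (hz fun l => max (-t.B l (some v)) 0)
    simpa only [h.B_some] using this
  refine ⟨fun i j => ?_, fun l => ?_, ?_⟩
  · simp only [ExchangeSeed.mutate, h.B_some, Option.some.injEq]
  · by_cases hl : l = v
    · subst hl
      simp only [ExchangeSeed.mutate, Function.update_self]
      exact hnum.mul ((h.x_some l).inv (hs.ne_zero l))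
    · simp only [ExchangeSeed.mutate, Option.some.injEq, hl, Function.update_of_ne, ne_eq,
        not_false_iff]
      exact h.x_some l
  · simpa [ExchangeSeed.mutate] using h.x_none

theorem IsExtension.path (h2 : (2 : k) ≠ 0) (h : IsExtension t s) (hs : s.IsFree k) (w : List ι) :
    IsExtension (t.path (w.map some)) (s.path w) := by
  induction w generalizing s t with
  | nil => exact h
  | cons v w ih => exact ih (h.mutate hs v) (hs.mutate h2 v)

/-- The arrow from `none` to `j` makes the exchange polynomial at `j` linear in the new variable,
with monomial coefficients, while the one at `i` does not involve that variable. -/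
theorem IsFree.regularMod_extend (hs : s.IsFree k) (h2 : (2 : k) ≠ 0) {i j : ι} (hne : i ≠ j) :
    RegularMod (laurentAdjoin k (s.extend j).x) ((s.extend j).numerator (some i))
      ((s.extend j).numerator (some j)) := by
  have ht := hs.extend j
  set t := s.extend j with htdef
  have hi : t.B none (some i) = 0 := by simp [htdef, ExchangeSeed.extend, hne]
  have hj : t.B none (some j) = 1 := by simp [htdef, ExchangeSeed.extend]
  have hoff : ∀ e : Option ι → ℤ, e none = 0 → zmonomial t.x e ∈ laurentOff k t.x none :=
    fun e => zmonomial_mem_laurentOff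
  set e₁ : Option ι → ℤ := fun l => max (t.B l (some j)) 0 with he₁
  set e₂ : Option ι → ℤ := fun l => max (-t.B l (some j)) 0 with he₂
  have h1 : e₁ none = 1 := by simp [he₁, hj]
  have h3 : e₂ none = 0 := by simp [he₂, hj]
  have hnum : t.numerator (some j) =
      zmonomial t.x e₂ + zmonomial t.x (Function.update e₁ none 0) * t.x none := by
    rw [numerator, ← he₁, ← he₂, zmonomial_eq_zpow_mul t.x none e₁, h1, zpow_one]; ring
  rw [hnum]
  refine regularMod_of_linear ht.indep ?_ (ht.numerator_ne_zero h2 _) (hoff _ h3) ?_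
    (zmonomial_ne_zero ht.ne_zero _) (hoff _ (by simp))
  · exact add_mem (hoff _ (by simp [hi])) (hoff _ (by simp [hi]))
  · rw [← zmonomial_neg]; exact hoff _ (by simp [h3])

end ExchangeSeed

/-! ### The Laurent phenomenon. -/

namespace ExchangeSeed

section Commuting

variable {k F ι : Type*} [Field k] [Field F] [Algebra k F] [DecidableEq ι] [Fintype ι]
  {s : ExchangeSeed F ι}

theorem numerator_mutate_of_eq_zero (s : ExchangeSeed F ι) {i j : ι} (hne : i ≠ j)
    (hij : s.B i j = 0) : (s.mutate i).numerator j = s.numerator j := by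
  have h0 : ∀ l, (s.mutate i).B l j = s.B l j := fun l => by
    by_cases hl : l = i
    · subst hl; simp [ExchangeSeed.mutate, hij]
    · simp [ExchangeSeed.mutate, hl, hne.symm, hij]
  rw [numerator, numerator, zmonomial_mutate _ (by simp [h0, hij]),
    zmonomial_mutate _ (by simp [h0, hij])]
  simp only [h0]

/-- The three-step mutation `i, j, i` in all cases. -/
theorem IsFree.rank_two (hs : s.IsFree k) (h2 : (2 : k) ≠ 0) {i j : ι} (hne : i ≠ j)
    (hreg : s.B i j = 0 → RegularMod (laurentAdjoin k s.x) (s.numerator i) (s.numerator j)) :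
    let R := laurentAdjoin k s.x
    let s₁ := s.mutate i
    let s₂ := s₁.mutate j
    let s₃ := s₂.mutate i
    (s₂.x j ∈ R ∧ RegularMod R (s₁.x i) (s₂.x j)) ∧
      s₃.x i ∈ R ∧ RegularMod R (s₁.x i) (s₃.x i) := by
  by_cases hb : s.B i j = 0
  · intro R s₁ s₂ s₃
    have hji : s₁.B j i = 0 := by simp [s₁, ExchangeSeed.mutate, hs.skew j i, hb]
    have hs₁ : s₁.IsFree k := hs.mutate h2 i
    have h0 := hs.ne_zero
    have e1 : s₁.x i = s.numerator i * (s.x i)⁻¹ := s.mutate_x_self i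
    have e2 : s₂.x j = s.numerator j * (s.x j)⁻¹ := by
      rw [show s₂.x j = _ from s₁.mutate_x_self j, s.numerator_mutate_of_eq_zero hne hb,
        s.mutate_x_of_ne hne.symm]
    have e3 : s₃.x i = s.x i := by
      rw [show s₃.x i = _ from s₂.mutate_x_self i,
        s₁.numerator_mutate_of_eq_zero hne.symm hji, hs.numerator_mutate_self,
        s₁.mutate_x_of_ne hne, e1, mul_inv, inv_inv,
        mul_inv_cancel_left₀ (hs.numerator_ne_zero h2 i)]
    have hu : ∀ l, RegularMod R (s₁.x i) (s.x l) := fun l =>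
      RegularMod.of_unit (h0 l) (inv_mem_laurentAdjoin l)
    have hu' : ∀ l, RegularMod R (s₁.x i) (s.x l)⁻¹ := fun l =>
      RegularMod.of_unit (inv_ne_zero (h0 l)) (by rw [inv_inv]; exact mem_laurentAdjoin l)
    rw [e3, e2]
    refine ⟨⟨mul_mem (laurentOff_le j (hs.numerator_mem j)) (inv_mem_laurentAdjoin j), ?_⟩,
      mem_laurentAdjoin i, hu i⟩
    refine RegularMod.mul ?_ (hu' j) (inv_mem_laurentAdjoin j)
    rw [e1]
    exact (hreg hb).mul_unit_left (inv_ne_zero (h0 i)) (inv_mem_laurentAdjoin i)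
      (by rw [inv_inv]; exact mem_laurentAdjoin i)
  · obtain ⟨b, h | h⟩ := (s.B i j).eq_nat_or_neg
    · exact hs.rank_two_pos h2 (by omega) h
    -- Reversing all arrows commutes with mutation and does not change the variables.
    · have := hs.neg.rank_two_pos h2 (i := i) (j := j) (b := b) (by omega)
        (by simp [ExchangeSeed.neg, h])
      simp only [← neg_mutate] at this
      exact this

/-- An element that is a Laurent polynomial in the seeds obtained by the mutations `i` and `i, j, i`
is a Laurent polynomial in the original seed. -/
theorem IsFree.mem_laurentAdjoin_of_mutate (hs : s.IsFree k) (h2 : (2 : k) ≠ 0) {i j : ι}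
    (hne : i ≠ j)
    (hreg : s.B i j = 0 → RegularMod (laurentAdjoin k s.x) (s.numerator i) (s.numerator j)) {y : F}
    (h1 : y ∈ laurentAdjoin k (s.mutate i).x)
    (h3 : y ∈ laurentAdjoin k (((s.mutate i).mutate j).mutate i).x) : y ∈ laurentAdjoin k s.x := by
  obtain ⟨⟨hX, hrX⟩, hZ, hrZ⟩ := hs.rank_two h2 hne hreg
  set R := laurentAdjoin k s.x
  set s₁ := s.mutate i with hs₁
  set s₂ := s₁.mutate j with hs₂
  set s₃ := s₂.mutate i with hs₃
  have hf₁ : s₁.IsFree k := hs.mutate h2 i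
  have hf₂ : s₂.IsFree k := hf₁.mutate h2 j
  have hf₃ : s₃.IsFree k := hf₂.mutate h2 i
  have hD : s₁.x i ∈ R := by
    rw [s.mutate_x_self i]
    exact mul_mem (laurentOff_le i (hs.numerator_mem i)) (inv_mem_laurentAdjoin i)
  have hm : ∀ l, s.x l ∈ R := mem_laurentAdjoin
  have hm' : ∀ l, (s.x l)⁻¹ ∈ R := inv_mem_laurentAdjoin
  -- The variables of `s₁` other than `s₁.x i` are units of `R`, so a power of `s₁.x i` clears all
  -- denominators.
  obtain ⟨a, ha⟩ := exists_mul_pow_mem hD (w := s₁.x) (A := R)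
    (fun l => by
      by_cases hl : l = i
      · rwa [hl]
      · rw [s.mutate_x_of_ne hl]; exact hm l)
    (fun l => by
      by_cases hl : l = i
      · rw [hl, inv_mul_cancel₀ (hf₁.ne_zero i)]; exact one_mem _
      · rw [s.mutate_x_of_ne hl]; exact mul_mem (hm' l) hD) h1
  have hXZ := mul_mem hX hZ
  have hXj : s₃.x j = s₂.x j := s₂.mutate_x_of_ne hne.symm
  have hXl : ∀ l, l ≠ i → l ≠ j → s₃.x l = s.x l := fun l hi hj => by
    rw [s₂.mutate_x_of_ne hi, s₁.mutate_x_of_ne hj, s.mutate_x_of_ne hi]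
  -- In `s₃` only the variables at `i` and `j` can obstruct, and both are regular modulo `s₁.x i`.
  obtain ⟨b, hb⟩ := exists_mul_pow_mem hXZ (w := s₃.x) (A := R)
    (fun l => by
      by_cases hi : l = i
      · rwa [hi]
      by_cases hj : l = j
      · rwa [hj, hXj]
      rw [hXl l hi hj]; exact hm l)
    (fun l => by
      by_cases hi : l = i
      · rw [hi, mul_comm, mul_inv_cancel_right₀ (hf₃.ne_zero i)]; exact hX
      by_cases hj : l = j
      · rw [hj, hXj, inv_mul_cancel_left₀ (hf₂.ne_zero j)]; exact hZ
      rw [hXl l hi hj]; exact mul_mem (hm' l) hXZ) h3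
  exact (hrX.mul hrZ hZ).mem (hf₁.ne_zero i) hXZ ha hb hD

end Commuting

/-- The Laurent phenomenon. -/
theorem IsFree.path_mem_laurentAdjoin.{u, v, w} {k : Type v} [Field k] (h2 : (2 : k) ≠ 0) (m : ℕ) :
    ∀ {ι : Type w} [Fintype ι] [DecidableEq ι] {F : Type u} [Field F] [Algebra k F]
      {s : ExchangeSeed F ι}, s.IsFree k → ∀ p : List ι, p.length = m →
      ∀ l, (s.path p).x l ∈ laurentAdjoin k s.x := by
  induction m using Nat.strong_induction_on with
  | _ m ih =>
    intro ι _ _ F _ _ s hs p hp l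
    match p, hp with
    | [], _ => exact mem_laurentAdjoin l
    | [i], _ =>
      change (s.mutate i).x l ∈ _
      by_cases hl : l = i
      · rw [hl, s.mutate_x_self i]
        exact mul_mem (laurentOff_le i (hs.numerator_mem i)) (inv_mem_laurentAdjoin i)
      · rw [s.mutate_x_of_ne hl]; exact mem_laurentAdjoin l
    | i :: j :: p, hp =>
      simp only [List.length_cons] at hp
      by_cases hij : i = j
      · subst hij
        have h1 : s.path (i :: i :: p) = ((s.mutate i).mutate i).path p := rfl
        rw [h1, hs.mutate_mutate h2]
        exact ih p.length (by omega) hs p rfl l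
      -- Seed, index type and field are all generalized, because the extended seed lives over
      -- `RatFunc F` and `Option ι`.
      have key : ∀ {ι : Type w} [Fintype ι] [DecidableEq ι] {F : Type u} [Field F] [Algebra k F]
          {s : ExchangeSeed F ι}, s.IsFree k → ∀ (i j : ι) (p : List ι), p.length + 2 ≤ m → i ≠ j →
          (s.B i j = 0 → RegularMod (laurentAdjoin k s.x) (s.numerator i) (s.numerator j)) →
          ∀ l, (s.path (i :: j :: p)).x l ∈ laurentAdjoin k s.x := by
        intro ι _ _ F _ _ s hs i j p hp hij hreg l
        have hs₁ := hs.mutate h2 i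
        have hs₂ := hs₁.mutate h2 j
        refine hs.mem_laurentAdjoin_of_mutate h2 hij hreg
          (ih (p.length + 1) (by omega) hs₁ (j :: p) (by simp) l) ?_
        -- From the seed after `i, j, i`, the path `i :: p` first undoes the last mutation; it ends
        -- at the same seed as the given path and is one step shorter.
        have h3 := ih (p.length + 1) (by omega) (hs₂.mutate h2 i) (i :: p) (by simp) l
        have h4 : (((s.mutate i).mutate j).mutate i).path (i :: p) =
            ((((s.mutate i).mutate j).mutate i).mutate i).path p := rfl
        rwa [h4, hs₂.mutate_mutate h2] at h3
      -- Without arrows between `i` and `j` the two exchange polynomials may have a common factor.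
      -- In the extended seed they are coprime, and the conclusion there specializes.
      by_cases hB : s.B i j = 0
      · have h5 := key (hs.extend j) (some i) (some j) (p.map some) (by simp; omega) (by simpa)
          (fun _ => hs.regularMod_extend h2 hij) (some l)
        exact mem_laurentAdjoin_of_extend hs j h5
          (((isExtension_extend s j).path h2 hs (i :: j :: p)).x_some l)
      · exact key hs i j p (by omega) hij (fun h => absurd h hB) l

end ExchangeSeed

/-! ### Cluster variables lie in the upper cluster algebra. -/

section ClusterSeed

variable {k F : Type*} [Field k] [Field F] [Algebra k F] {n : ℕ}

namespace ClusterSeed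

/-- The exchange matrix and the cluster of a seed. -/
def toExchangeSeed (s : ClusterSeed k F n) : ExchangeSeed F (Fin n) where
  B i j := s.quiver.arrows i j - s.quiver.arrows j i
  x := s.cluster

variable (s : ClusterSeed k F n)

theorem isFree_toExchangeSeed : s.toExchangeSeed.IsFree k :=
  ⟨fun i j => by simp [toExchangeSeed], s.algebraicIndependent⟩

theorem max_B (i j : Fin n) : max (s.toExchangeSeed.B i j) 0 = s.quiver.arrows i j := by
  have := s.quiver.no_two_cycle i j
  simp only [toExchangeSeed]
  omega

theorem max_neg_B (i j : Fin n) : max (-s.toExchangeSeed.B i j) 0 = s.quiver.arrows j i := by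
  have := s.quiver.no_two_cycle i j
  simp only [toExchangeSeed]
  omega

theorem numerator_toExchangeSeed (v : Fin n) :
    s.toExchangeSeed.numerator v = exchangeNumerator s.quiver s.cluster v := by
  simp only [ExchangeSeed.numerator, max_B, max_neg_B, zmonomial, zpow_natCast]
  rfl

theorem toExchangeSeed_mutate {v : Fin n} (hv : v ∉ s.quiver.frozen) :
    (s.mutate v hv).toExchangeSeed = s.toExchangeSeed.mutate v := by
  ext i j
  · simp only [ExchangeSeed.mutate, max_B, max_neg_B]
    simp only [toExchangeSeed, mutate, IceQuiver.mutate, IceQuiver.mutateArrows,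
      IceQuiver.cancelTwoCycles, IceQuiver.reverseAt, IceQuiver.addComposites, or_comm (a := j = v)]
    have hl := s.quiver.loopless v
    split_ifs with h
    · rcases h with rfl | rfl <;> simp only [hl] <;> omega
    · rw [← Nat.cast_mul, ← Nat.cast_mul, mul_comm (s.quiver.arrows v i)]
      generalize s.quiver.arrows i v * s.quiver.arrows v j = a
      generalize s.quiver.arrows j v * s.quiver.arrows v i = a'
      omega
  · simp only [ExchangeSeed.mutate, numerator_toExchangeSeed]
    rfl

variable {s}

theorem MutationEquivalent.exists_path {t : ClusterSeed k F n} (h : s.MutationEquivalent t)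
    (h2 : (2 : k) ≠ 0) : ∃ w, t.toExchangeSeed = s.toExchangeSeed.path w ∧
      s.toExchangeSeed = t.toExchangeSeed.path w.reverse := by
  induction h with
  | refl => exact ⟨[], rfl, rfl⟩
  | @tail t t' _ ht ih =>
    obtain ⟨v, hv, rfl⟩ := ht
    obtain ⟨w, hw, hw'⟩ := ih
    refine ⟨w ++ [v], ?_, ?_⟩
    · rw [toExchangeSeed_mutate, hw, ExchangeSeed.path, ExchangeSeed.path, List.foldl_append]
      rfl
    · rw [List.reverse_append, toExchangeSeed_mutate]
      change _ = ((t.toExchangeSeed.mutate v).mutate v).path w.reverse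
      rw [t.isFree_toExchangeSeed.mutate_mutate h2]
      exact hw'

/-- The mutations from `s` to `t` are run backwards and followed by those from `s` to `t'`; the
Laurent phenomenon is applied to this path. -/
theorem MutationEquivalent.cluster_mem {t t' : ClusterSeed k F n} (h : s.MutationEquivalent t)
    (h' : s.MutationEquivalent t') (h2 : (2 : k) ≠ 0) (l : Fin n) :
    t'.cluster l ∈ laurentRing k t.cluster := by
  obtain ⟨w, -, hw⟩ := h.exists_path h2
  obtain ⟨w', hw', -⟩ := h'.exists_path h2
  have h1 : t'.toExchangeSeed = t.toExchangeSeed.path (w.reverse ++ w') := by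
    rw [hw', hw, ExchangeSeed.path, ExchangeSeed.path, ExchangeSeed.path, List.foldl_append]
  have h3 := t.isFree_toExchangeSeed.path_mem_laurentAdjoin h2 _ (w.reverse ++ w') rfl l
  rw [← h1] at h3
  exact h3

theorem mem_upperClusterAlgebra {f : F} :
    f ∈ upperClusterAlgebra s ↔ ∀ t, s.MutationEquivalent t → f ∈ laurentRing k t.cluster := by
  simp [upperClusterAlgebra, Algebra.mem_iInf]

theorem MutationEquivalent.cluster_mem_upperClusterAlgebra {t : ClusterSeed k F n}
    (h : s.MutationEquivalent t) (h2 : (2 : k) ≠ 0) (l : Fin n) :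
    t.cluster l ∈ upperClusterAlgebra s :=
  mem_upperClusterAlgebra.2 fun _ ht => ht.cluster_mem h h2 l

end ClusterSeed

/-! ### Invariance of the log volume form and of the trace under mutation. -/

section LogVolume

variable {x : Fin n → F}

theorem LogFrame.vol_logVolumeForm (fr : LogFrame k x) (h : ∀ i, x i ≠ 0) :
    fr.vol (logVolumeForm k n x) = 1 := by
  rw [logVolumeForm, map_smul, fr.vol_wedgeD_self h, zmonomial_one, smul_eq_mul,
    inv_mul_cancel₀ (Finset.prod_ne_zero_iff.2 fun i _ => h i)]

theorem logVolumeForm_comp_perm (x : Fin n → F) (π : Equiv.Perm (Fin n)) :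
    logVolumeForm k n (x ∘ π) = logVolumeForm k n x ∨
      logVolumeForm k n (x ∘ π) = -logVolumeForm k n x := by
  have h1 : logVolumeForm k n (x ∘ π) = Equiv.Perm.sign π • logVolumeForm k n x := by
    rw [logVolumeForm, logVolumeForm, smul_comm]
    congr 1
    · simp only [Function.comp_apply]
      rw [Equiv.prod_comp π x]
    · exact (exteriorPower.ιMulti F n).map_perm (fun i => KaehlerDifferential.D k F (x i)) π
  rcases Int.units_eq_one_or (Equiv.Perm.sign π) with h | h <;> rw [h] at h1
  · left; rw [h1, one_smul]
  · right; rw [h1, Units.neg_smul, one_smul]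

/-- The logarithmic Jacobian is the identity outside column `v`, so its determinant is the entry
`θ_v(x'_v) / x'_v`. This is `-1`, since the numerator does not involve `x_v`. -/
theorem ClusterSeed.logVolumeForm_mutate (s : ClusterSeed k F n) {v : Fin n}
    (hv : v ∉ s.quiver.frozen) :
    logVolumeForm k n (s.mutate v hv).cluster = -logVolumeForm k n s.cluster := by
  obtain ⟨fr⟩ := exists_logFrame s.algebraicIndependent s.adjoin_eq_top
  have h0 : ∀ i, s.cluster i ≠ 0 := s.algebraicIndependent.ne_zero
  set x' := (s.mutate v hv).cluster with hx'
  have h0' : ∀ i, x' i ≠ 0 := (s.mutate v hv).algebraicIndependent.ne_zero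
  apply fr.vol.injective
  rw [map_neg, fr.vol_logVolumeForm h0, logVolumeForm, map_smul, fr.vol_wedgeD, smul_eq_mul]
  have hxv : x' v = s.toExchangeSeed.numerator v * (s.cluster v)⁻¹ := by
    rw [hx', s.numerator_toExchangeSeed]; simp [ClusterSeed.mutate, mutateCluster]
  have hxl : ∀ l, l ≠ v → x' l = s.cluster l := fun l hl => by
    simp [hx', ClusterSeed.mutate, mutateCluster, hl]
  have hθ : fr.θ v (x' v) = -x' v := by
    have h1 : fr.θ v (s.toExchangeSeed.numerator v) = 0 := by
      rw [ExchangeSeed.numerator, map_add]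
      change fr.θ v (zmonomial s.cluster _) + fr.θ v (zmonomial s.cluster _) = 0
      rw [fr.θ_zmonomial h0, fr.θ_zmonomial h0]
      simp [s.isFree_toExchangeSeed.diag]
    rw [hxv, Derivation.leibniz, h1, Derivation.leibniz_inv, fr.θ_apply, if_pos rfl]
    have := h0 v
    simp only [smul_eq_mul, mul_zero, add_zero]
    field_simp
  have hM : (Matrix.of fun i j => fr.θ i (x' j)) = Matrix.of fun i j => x' j *
      (1 : Matrix (Fin n) (Fin n) F).updateCol v (fun i => (x' v)⁻¹ * fr.θ i (x' v)) i j := by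
    ext i j
    rw [Matrix.of_apply, Matrix.of_apply]
    by_cases hj : j = v
    · subst hj
      rw [Matrix.updateCol_self, mul_inv_cancel_left₀ (h0' j)]
    · rw [Matrix.updateCol_ne hj, hxl j hj, fr.θ_apply, Matrix.one_apply]
      split_ifs <;> simp
  rw [hM, Matrix.det_mul_row, inv_mul_cancel_left₀ (Finset.prod_ne_zero_iff.2 fun i _ => h0' i)]
  have h4 := congrFun (LinearMap.congr_fun (Matrix.cramer_one (n := Fin n) (α := F))
    fun i => (x' v)⁻¹ * fr.θ i (x' v)) v
  rw [Matrix.cramer_apply] at h4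
  rw [h4]
  change (x' v)⁻¹ * fr.θ v (x' v) = -1
  rw [hθ, mul_neg, inv_mul_cancel₀ (h0' v)]

theorem ClusterSeed.MutationEquivalent.logVolumeForm_eq {s t : ClusterSeed k F n}
    (h : s.MutationEquivalent t) :
    logVolumeForm k n t.cluster = logVolumeForm k n s.cluster ∨
      logVolumeForm k n t.cluster = -logVolumeForm k n s.cluster := by
  induction h with
  | refl => exact Or.inl rfl
  | tail _ ht ih =>
    obtain ⟨v, hv, rfl⟩ := ht
    rw [ClusterSeed.logVolumeForm_mutate]
    rcases ih with ih | ih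
    · right; rw [ih]
    · left; rw [ih, neg_neg]

theorem IsLogVolumeForm.eq_or {s : ClusterSeed k F n} {η : TopForms k n F}
    (h : IsLogVolumeForm s η) :
    η = logVolumeForm k n s.cluster ∨ η = -logVolumeForm k n s.cluster := by
  obtain ⟨t, π, ht, h⟩ := h
  rcases ht.logVolumeForm_eq with h1 | h1 <;>
    rcases logVolumeForm_comp_perm (k := k) t.cluster π with h3 | h3 <;>
    rw [h3, h1] at h <;> simpa [or_comm] using h

/-- Log frames of mutation equivalent seeds have the same coordinate up to sign. -/
theorem ClusterSeed.MutationEquivalent.vol_eq {s t : ClusterSeed k F n}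
    (h : s.MutationEquivalent t) (fr : LogFrame k s.cluster) (fr' : LogFrame k t.cluster) :
    (∀ η, fr'.vol η = fr.vol η) ∨ ∀ η, fr'.vol η = -fr.vol η := by
  have h0 : ∀ i, s.cluster i ≠ 0 := s.algebraicIndependent.ne_zero
  have h0' : ∀ i, t.cluster i ≠ 0 := t.algebraicIndependent.ne_zero
  have h1 : ∀ η, fr'.vol η = fr.vol η * fr'.vol (logVolumeForm k n s.cluster) := fun η => by
    have : η = fr.vol η • logVolumeForm k n s.cluster := by
      apply fr.vol.injective
      rw [map_smul, fr.vol_logVolumeForm h0, smul_eq_mul, mul_one]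
    conv_lhs => rw [this]
    rw [map_smul, smul_eq_mul]
  have h2 := fr'.vol_logVolumeForm h0'
  rcases h.logVolumeForm_eq with h3 | h3 <;> rw [h3] at h2
  · left; intro η; rw [h1, h2, mul_one]
  · right; intro η
    rw [map_neg] at h2
    rw [h1, ← neg_neg (fr'.vol (logVolumeForm k n s.cluster)), h2, mul_neg, mul_one]

/-- The traces of both clusters express one and the same Cartier operator, in coordinates that agree
up to sign; additive maps commute with the sign. -/
theorem ClusterSeed.MutationEquivalent.isFrobeniusTrace {p : ℕ} [Fact p.Prime] [CharP k p]
    [CharP F p] [PerfectField k] {s t : ClusterSeed k F n} (h : s.MutationEquivalent t) {κ : F →+ F}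
    (hκ : IsFrobeniusTrace p s.cluster κ) : IsFrobeniusTrace p t.cluster κ := by
  obtain ⟨fr⟩ := exists_logFrame s.algebraicIndependent s.adjoin_eq_top
  obtain ⟨fr'⟩ := exists_logFrame t.algebraicIndependent t.adjoin_eq_top
  have h0 : ∀ i, s.cluster i ≠ 0 := s.algebraicIndependent.ne_zero
  have h0' : ∀ i, t.cluster i ≠ 0 := t.algebraicIndependent.ne_zero
  obtain ⟨κ', hκ'⟩ := exists_isFrobeniusTrace p fr' h0' t.adjoin_eq_top
  have hτ := fr.isCartierOperator h0 s.adjoin_eq_top hκ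
  have h1 := hτ.vol_apply fr h0 s.adjoin_eq_top hκ
  have h2 := hτ.vol_apply fr' h0' t.adjoin_eq_top hκ'
  have : κ = κ' := by
    ext f
    obtain ⟨η, rfl⟩ := fr'.vol.surjective f
    rw [← h2]
    rcases h.vol_eq fr fr' with h3 | h3
    · rw [h3, h3, h1]
    · rw [h3, h3, h1, map_neg]
  rwa [this]

end LogVolume

end ClusterSeed

/-! ### The Frobenius trace on a Laurent ring. -/

section LaurentRing

variable {k F : Type*} [Field k] [Field F] [Algebra k F] {n : ℕ} {x : Fin n → F}

theorem zmonomial_mem_laurentRing (b : Fin n → ℤ) : zmonomial x b ∈ laurentRing k x :=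
  zmonomial_mem_laurentAdjoin b

/-- Induction on Laurent polynomials. -/
theorem laurentRing_induction (h : ∀ i, x i ≠ 0) {S : AddSubgroup F}
    (hS : ∀ (c : k) b, c • zmonomial x b ∈ S) {f : F} (hf : f ∈ laurentRing k x) : f ∈ S := by
  let M : Submonoid F :=
    { carrier := Set.range (zmonomial x)
      mul_mem' := by
        rintro _ _ ⟨b, rfl⟩ ⟨c, rfl⟩
        exact ⟨b + c, zmonomial_add h b c⟩
      one_mem' := ⟨0, zmonomial_zero x⟩ }
  have h1 : f ∈ Submodule.span k (Set.range (zmonomial x)) := by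
    have h2 : f ∈ Subalgebra.toSubmodule (laurentRing k x) := hf
    rw [laurentRing, Algebra.adjoin_eq_span] at h2
    refine Submodule.span_mono ?_ h2
    refine (Submonoid.closure_le (S := M)).2 ?_
    rintro _ (⟨i, rfl⟩ | ⟨i, rfl⟩)
    · exact ⟨Pi.single i 1, zmonomial_single x i⟩
    · exact ⟨-Pi.single i 1, by rw [zmonomial_neg, zmonomial_single]⟩
  clear hf
  induction h1 using Submodule.closure_induction with
  | zero => exact S.zero_mem
  | add y z _ _ hy hz => exact S.add_mem hy hz
  | smul_mem c y hy =>
    obtain ⟨b, rfl⟩ := hy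
    exact hS c b

theorem LogFrame.θ_mem_laurentRing (fr : LogFrame k x) (h : ∀ i, x i ≠ 0) (j : Fin n) {f : F}
    (hf : f ∈ laurentRing k x) : fr.θ j f ∈ laurentRing k x := by
  refine laurentRing_induction h (S := (laurentRing k x).toSubmodule.toAddSubgroup.comap
    ((fr.θ j : F →ₗ[k] F) : F →+ F)) (fun c b => ?_) hf
  change fr.θ j _ ∈ laurentRing k x
  rw [(fr.θ j).map_smul, fr.θ_zmonomial h]
  refine Subalgebra.smul_mem _ (mul_mem ?_ (zmonomial_mem_laurentRing b)) c
  exact intCast_mem _ _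

theorem LogFrame.vol_wedgeD_mem_laurentRing (fr : LogFrame k x) (h : ∀ i, x i ≠ 0)
    {a : Fin n → F} (ha : ∀ i, a i ∈ laurentRing k x) :
    fr.vol (wedgeD a) ∈ laurentRing k x := by
  rw [fr.vol_wedgeD, Matrix.det_apply]
  refine sum_mem fun σ _ => ?_
  rw [Units.smul_def]
  exact zsmul_mem (prod_mem fun i _ => fr.θ_mem_laurentRing h _ (ha i)) _

variable {p : ℕ} {κ : F →+ F}

theorem IsFrobeniusTrace.map_pow_smul (hκ : IsFrobeniusTrace p x κ) (c : k) (f : F) :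
    κ (c ^ p • f) = c • κ f := by
  rw [Algebra.smul_def, map_pow, hκ.map_pow_mul, Algebra.smul_def]

/-- An exponent vector with entries in `0, …, p - 1`. -/
def finExponent (r : Fin n → Fin p) : Fin n → ℤ := fun i => (r i : ℕ)

theorem IsFrobeniusTrace.map_finExponent_sub (hκ : IsFrobeniusTrace p x κ)
    (r r' : Fin n → Fin p) :
    κ (zmonomial x (finExponent r - finExponent r')) = if r = r' then 1 else 0 := by
  split_ifs with hr
  · subst hr
    have h := hκ.map_nsmul 0
    rw [smul_zero, zmonomial_zero] at h
    rw [sub_self, zmonomial_zero, h]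
  · apply hκ.map_of_not_dvd
    intro h
    apply hr
    ext i
    have h1 := h i
    simp only [finExponent, Pi.sub_apply] at h1
    have h2 := (r i).2
    have h3 := (r' i).2
    have h4 := Int.eq_zero_of_abs_lt_dvd h1 (by rw [abs_lt]; constructor <;> omega)
    omega

variable [Fact p.Prime]

theorem IsFrobeniusTrace.mem_laurentRing [CharP k p] [PerfectField k]
    (hκ : IsFrobeniusTrace p x κ) (h : ∀ i, x i ≠ 0) {f : F} (hf : f ∈ laurentRing k x) :
    κ f ∈ laurentRing k x := by
  refine laurentRing_induction h (S := (laurentRing k x).toSubmodule.toAddSubgroup.comap κ)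
    (fun c b => ?_) hf
  change κ _ ∈ laurentRing k x
  obtain ⟨d, rfl⟩ := exists_pow_prime_eq p c
  rw [hκ.map_pow_smul]
  refine Subalgebra.smul_mem _ ?_ d
  by_cases hb : ∀ i, (p : ℤ) ∣ b i
  · choose c hc using hb
    have : b = p • c := by ext i; simp [hc]
    rw [this, hκ.map_nsmul]
    exact zmonomial_mem_laurentRing c
  · rw [hκ.map_of_not_dvd b hb]; exact zero_mem _

theorem exists_eq_nsmul_add_finExponent (b : Fin n → ℤ) :
    ∃ (q : Fin n → ℤ) (r : Fin n → Fin p), b = p • q + finExponent r := by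
  have hp : 0 < p := (Fact.out : p.Prime).pos
  have h0 : ∀ i, 0 ≤ b i % p := fun i => Int.emod_nonneg _ (by omega)
  have h1 : ∀ i, b i % p < p := fun i => Int.emod_lt_of_pos _ (by omega)
  refine ⟨fun i => b i / p, fun i => ⟨(b i % p).toNat, by have := h0 i; have := h1 i; omega⟩, ?_⟩
  ext i
  simp only [finExponent, Pi.add_apply, Pi.smul_apply]
  rw [nsmul_eq_mul, Int.toNat_of_nonneg (h0 i), Int.mul_ediv_add_emod]

/-- The expansion of `c` in the basis of monomials over the `p`-th powers. -/
theorem IsFrobeniusTrace.sum_pow_mul [CharP k p] [CharP F p] [PerfectField k]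
    (hκ : IsFrobeniusTrace p x κ) (h : ∀ i, x i ≠ 0)
    (hg : IntermediateField.adjoin k (Set.range x) = ⊤) (c : F) :
    ∑ r : Fin n → Fin p, κ (c * zmonomial x (-finExponent r)) ^ p * zmonomial x (finExponent r) =
      c := by
  classical
  let E : F →+ F := ∑ r : Fin n → Fin p, (AddMonoidHom.mulRight (zmonomial x (finExponent r))).comp
    ((frobenius F p : F →+ F).comp (κ.comp (AddMonoidHom.mulRight
      (zmonomial x (-finExponent r)))))
  have hE : ∀ c, E c = ∑ r : Fin n → Fin p,
      κ (c * zmonomial x (-finExponent r)) ^ p * zmonomial x (finExponent r) := fun c => by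
    simp [E, frobenius_def]
  rw [← hE]
  have hS : AddMonoidHom.eqLocus E (AddMonoidHom.id F) = ⊤ := by
    have hmul : ∀ a f, E (a ^ p * f) = a ^ p * E f := fun a f => by
      rw [hE, hE, Finset.mul_sum]
      refine Finset.sum_congr rfl fun r _ => ?_
      rw [mul_assoc, hκ.map_pow_mul, mul_pow, mul_assoc]
    refine addSubgroup_eq_top_of_zmonomial_mem (k := k) p h hg (fun a f hf => ?_) fun b => ?_
    · change E f = f at hf
      change E _ = a ^ p * f
      rw [hmul, hf]
    · change E _ = zmonomial x b
      obtain ⟨q, r, rfl⟩ := exists_eq_nsmul_add_finExponent (p := p) b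
      rw [zmonomial_add h, zmonomial_nsmul, hmul]
      congr 1
      rw [hE, Finset.sum_eq_single r]
      · rw [← zmonomial_add h, ← sub_eq_add_neg, hκ.map_finExponent_sub, if_pos rfl, one_pow,
          one_mul]
      · intro r' _ hr
        rw [← zmonomial_add h, ← sub_eq_add_neg, hκ.map_finExponent_sub, if_neg hr.symm,
          zero_pow (Fact.out : p.Prime).ne_zero, zero_mul]
      · simp
  have : c ∈ AddMonoidHom.eqLocus E (AddMonoidHom.id F) := by rw [hS]; trivial
  exact this

theorem zmonomial_mem_of_nonneg {U : Subalgebra k F} (hU : ∀ i, x i ∈ U) {b : Fin n → ℤ}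
    (hb : ∀ i, 0 ≤ b i) : zmonomial x b ∈ U :=
  prod_mem fun i _ => by
    rw [← Int.toNat_of_nonneg (hb i), zpow_natCast]
    exact pow_mem (hU i) _

/-- If `κ (c * y)` is a Laurent polynomial for all `y` in an algebra that contains the variables,
then `c` is a Laurent polynomial. -/
theorem IsFrobeniusTrace.mem_laurentRing_of_forall [CharP k p] [CharP F p] [PerfectField k]
    (hκ : IsFrobeniusTrace p x κ) (h : ∀ i, x i ≠ 0)
    (hg : IntermediateField.adjoin k (Set.range x) = ⊤) {U : Subalgebra k F} (hU : ∀ i, x i ∈ U)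
    {c : F} (hc : ∀ y ∈ U, κ (c * y) ∈ laurentRing k x) : c ∈ laurentRing k x := by
  rw [← hκ.sum_pow_mul h hg c]
  refine sum_mem fun r _ => mul_mem (pow_mem ?_ p) (zmonomial_mem_laurentRing _)
  -- The exponent `-r` is shifted by `p` to become nonnegative, so that the monomial lies in `U`.
  -- The shift passes through `κ` as the factor `(x_1 ⋯ x_n)⁻¹`, a unit of the Laurent ring.
  have h1 : zmonomial x (p • 1 - finExponent r) ∈ U := by
    refine zmonomial_mem_of_nonneg hU fun i => ?_
    have := (r i).2
    simp only [finExponent, Pi.sub_apply, Pi.smul_apply, Pi.one_apply]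
    rw [nsmul_eq_mul, mul_one]
    omega
  have h2 : c * zmonomial x (-finExponent r) =
      zmonomial x (-1) ^ p * (c * zmonomial x (p • 1 - finExponent r)) := by
    rw [sub_eq_add_neg, zmonomial_add h, mul_left_comm, ← zmonomial_nsmul,
      ← mul_assoc (zmonomial x _) (zmonomial x _), ← zmonomial_add h, smul_neg, neg_add_cancel,
      zmonomial_zero, one_mul]
  rw [h2, hκ.map_pow_mul]
  exact mul_mem (zmonomial_mem_laurentRing _) (hc _ h1)

end LaurentRing

/-! ### Functionals on the top forms of a subalgebra of a Laurent ring. -/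

section TopForms

variable {k F : Type*} [Field k] [Field F] [Algebra k F] {n : ℕ}

theorem span_range_wedgeD (R : Type*) [CommRing R] [Algebra k R] :
    Submodule.span R (Set.range (wedgeD : (Fin n → R) → TopForms k n R)) = ⊤ := by
  rw [← exteriorPower.ιMulti_span_of_span R n Ω[R⁄k]
    (KaehlerDifferential.span_range_derivation k R)]
  congr 1
  ext m
  constructor
  · rintro ⟨a, rfl⟩
    exact ⟨_, Set.range_subset_iff.2 fun i => ⟨a i, rfl⟩, rfl⟩
  · rintro ⟨v, hv, rfl⟩
    choose a ha using fun i => hv (Set.mem_range_self i)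
    exact ⟨a, by rw [wedgeD]; congr 1; ext1 i; exact ha i⟩

/-- A multilinear map vanishes if it vanishes on a set of vectors that detects linear maps. -/
theorem MultilinearMap.eq_zero_of_forall_mem {R M N ι : Type*} [CommRing R] [AddCommGroup M]
    [Module R M] [AddCommGroup N] [Module R N] [Fintype ι] {S : Set M}
    (hS : ∀ l : M →ₗ[R] N, (∀ y ∈ S, l y = 0) → l = 0) (g : MultilinearMap R (fun _ : ι => M) N)
    (hg : ∀ v, (∀ i, v i ∈ S) → g v = 0) : g = 0 := by
  classical
  have key : ∀ s : Finset ι, ∀ v, (∀ i ∉ s, v i ∈ S) → g v = 0 := fun s => by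
    induction s using Finset.induction_on with
    | empty => exact fun v hv => hg v fun i => hv i (Finset.notMem_empty i)
    | insert j s hj ih =>
      intro v hv
      have h1 : g.toLinearMap v j = 0 := hS _ fun y hy => by
        refine ih _ fun i hi => ?_
        by_cases hij : i = j
        · subst hij; rwa [Function.update_self]
        · rw [Function.update_of_ne hij]
          exact hv i (by simp [hij, hi])
      have h2 := LinearMap.congr_fun h1 (v j)
      rwa [MultilinearMap.toLinearMap_apply, Function.update_eq_self] at h2
  ext v
  exact key Finset.univ v fun i hi => absurd (Finset.mem_univ i) hi

variable {x : Fin n → F} {U : Subalgebra k F}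

/-- A subalgebra of a Laurent ring becomes polynomial after clearing denominators. -/
theorem exists_pow_mul_mem_adjoin (h : ∀ i, x i ≠ 0) {f : F} (hf : f ∈ laurentRing k x) :
    ∃ N : ℕ, (∏ i, x i) ^ N * f ∈ Algebra.adjoin k (Set.range x) := by
  have hx : ∀ i, x i ∈ Algebra.adjoin k (Set.range x) := fun i =>
    Algebra.subset_adjoin ⟨i, rfl⟩
  have hX : ∏ i, x i ∈ Algebra.adjoin k (Set.range x) := prod_mem fun i _ => hx i
  let S : AddSubgroup F :=
    { carrier := {f | ∃ N : ℕ, (∏ i, x i) ^ N * f ∈ Algebra.adjoin k (Set.range x)}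
      add_mem' := by
        rintro f g ⟨M, hM⟩ ⟨N, hN⟩
        refine ⟨M + N, ?_⟩
        have := add_mem (mul_mem (pow_mem hX N) hM) (mul_mem (pow_mem hX M) hN)
        convert this using 1
        ring
      zero_mem' := ⟨0, by rw [mul_zero]; exact zero_mem _⟩
      neg_mem' := by
        rintro f ⟨M, hM⟩
        exact ⟨M, by rw [mul_neg]; exact neg_mem hM⟩ }
  refine laurentRing_induction h (S := S) (fun c b => ?_) hf
  refine ⟨∑ i, (b i).natAbs, ?_⟩
  rw [mul_smul_comm, ← zmonomial_one, ← zmonomial_nsmul, ← zmonomial_add h]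
  refine Subalgebra.smul_mem _ (zmonomial_mem_of_nonneg hx fun i => ?_) c
  have := Finset.single_le_sum (f := fun i => (b i).natAbs) (fun i _ => Nat.zero_le _)
    (Finset.mem_univ i)
  simp only [Pi.add_apply, Pi.smul_apply, Pi.one_apply]
  rw [nsmul_eq_mul, mul_one]
  omega

/-- Derivations of a subalgebra of a Laurent ring are determined by their values on the
variables. -/
theorem derivation_eq_zero_of_laurentRing (h : ∀ i, x i ≠ 0) (hx : ∀ i, x i ∈ U)
    (hU : ∀ f ∈ U, f ∈ laurentRing k x) (δ : Derivation k U F)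
    (hδ : ∀ i, δ ⟨x i, hx i⟩ = 0) : δ = 0 := by
  have h1 : ∀ f ∈ Algebra.adjoin k (Set.range fun i => (⟨x i, hx i⟩ : U)), δ f = 0 := fun f hf =>
    Derivation.eqOn_adjoin (D2 := 0) (by rintro _ ⟨i, rfl⟩; exact hδ i) hf
  have h2 : ∀ f : U, (f : F) ∈ Algebra.adjoin k (Set.range x) → δ f = 0 := fun f hf => by
    apply h1
    have e : Set.range x = U.val '' Set.range fun i => (⟨x i, hx i⟩ : U) := by
      rw [← Set.range_comp]; rfl
    rw [e, ← AlgHom.map_adjoin] at hf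
    obtain ⟨g, hg, hgf⟩ := hf
    rwa [← Subtype.ext hgf]
  ext f
  -- A power of `x_1 ⋯ x_n` moves `f` into the polynomial ring, where `δ` vanishes, and can be
  -- cancelled in `F`.
  obtain ⟨N, hN⟩ := exists_pow_mul_mem_adjoin h (hU f f.2)
  let X : U := ∏ i, ⟨x i, hx i⟩
  have hX : (X : F) = ∏ i, x i := by simp [X]
  have hXm : (X : F) ∈ Algebra.adjoin k (Set.range x) := by
    rw [hX]; exact prod_mem fun i _ => Algebra.subset_adjoin ⟨i, rfl⟩
  have h3 := h2 (X ^ N * f) (by rw [MulMemClass.coe_mul, SubmonoidClass.coe_pow, hX]; exact hN)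
  rw [Derivation.leibniz, h2 (X ^ N) (by rw [SubmonoidClass.coe_pow]; exact pow_mem hXm N),
    smul_zero, add_zero] at h3
  have h4 : (X : F) ^ N * δ f = 0 := h3
  refine (mul_eq_zero.1 h4).resolve_left (pow_ne_zero _ ?_)
  rw [hX]
  exact Finset.prod_ne_zero_iff.2 fun i _ => h i

/-- A linear functional on the top forms of a subalgebra of a Laurent ring vanishes if it vanishes
on the volume form of the variables. -/
theorem TopForms.linearMap_eq_zero (h : ∀ i, x i ≠ 0) (hx : ∀ i, x i ∈ U)
    (hU : ∀ f ∈ U, f ∈ laurentRing k x) (ν : TopForms k n U →ₗ[U] F)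
    (hν : ν (wedgeD fun i => ⟨x i, hx i⟩) = 0) : ν = 0 := by
  let d := fun i => KaehlerDifferential.D k U ⟨x i, hx i⟩
  let g := ν.compAlternatingMap (exteriorPower.ιMulti U n)
  have h0 : g d = 0 := hν
  -- The `dx_i` need not generate `Ω[U⁄k]`, but an `F`-valued linear map that vanishes on them is
  -- zero. So `g` is determined by its values on tuples of the `dx_i`, and these are `± g d` or `0`.
  have hg : g.toMultilinearMap = 0 := by
    refine MultilinearMap.eq_zero_of_forall_mem (S := Set.range d) (fun l hl => ?_) _ fun v hv => ?_
    · apply Derivation.liftKaehlerDifferential_unique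
      rw [derivation_eq_zero_of_laurentRing h hx hU (l.compDer (KaehlerDifferential.D k U))
        fun i => hl _ ⟨i, rfl⟩]
      ext; simp
    · choose e he using hv
      obtain rfl : d ∘ e = v := funext he
      change g (d ∘ e) = 0
      by_cases hi : Function.Injective e
      · have := g.map_perm d (Equiv.ofBijective e (Finite.injective_iff_bijective.1 hi))
        rw [h0, smul_zero] at this
        exact this
      · rw [Function.not_injective_iff] at hi
        obtain ⟨i, j, hij, hne⟩ := hi
        exact g.map_eq_zero_of_eq _ (by simp [hij]) hne
  apply exteriorPower.linearMap_ext
  ext v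
  exact congrArg (fun q => q v) hg

end TopForms

/-! ### Freeness of the two dual modules and the duality isomorphism. -/

section FrobeniusFrame

variable {k F : Type*} [Field k] [Field F] [Algebra k F] {n : ℕ}

/-- A subalgebra `U` of a Laurent ring that is stable under a Frobenius trace `κ` and big enough for
its canonical module and its Frobenius-dual to be free. -/
structure FrobeniusFrame (p : ℕ) (U : Subalgebra k F) (x : Fin n → F) (fr : LogFrame k x)
    (κ : F →+ F) : Prop where
  ne_zero : ∀ i, x i ≠ 0
  adjoin_eq_top : IntermediateField.adjoin k (Set.range x) = ⊤
  isFrobeniusTrace : IsFrobeniusTrace p x κ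
  mem : ∀ i, x i ∈ U
  mem_laurentRing : ∀ f ∈ U, f ∈ laurentRing k x
  vol_mem : ∀ a : Fin n → F, (∀ i, a i ∈ U) → fr.vol (wedgeD a) ∈ U
  mem_of_vol : ∀ c, (∀ a : Fin n → F, (∀ i, a i ∈ U) → c * fr.vol (wedgeD a) ∈ U) → c ∈ U
  trace_mem : ∀ y ∈ U, κ y ∈ U
  mem_of_trace : ∀ c, (∀ y ∈ U, κ (c * y) ∈ U) → c ∈ U

namespace FrobeniusFrame

variable {p : ℕ} {U : Subalgebra k F} {x : Fin n → F} {fr : LogFrame k x} {κ : F →+ F}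

/-- The variables as elements of `U`. -/
def var (H : FrobeniusFrame p U x fr κ) (i : Fin n) : U := ⟨x i, H.mem i⟩

theorem vol_toGeneric_var (H : FrobeniusFrame p U x fr κ) :
    fr.vol (toGeneric k n U (wedgeD H.var)) = zmonomial x 1 := by
  rw [toGeneric_wedgeD]
  exact fr.vol_wedgeD_self H.ne_zero

theorem vol_toGeneric_mem (H : FrobeniusFrame p U x fr κ) (m : TopForms k n U) :
    fr.vol (toGeneric k n U m) ∈ U := by
  have hm : m ∈ Submodule.span U (Set.range (wedgeD : (Fin n → U) → TopForms k n U)) := by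
    rw [span_range_wedgeD]; trivial
  induction hm using Submodule.span_induction with
  | mem m hm =>
    obtain ⟨a, rfl⟩ := hm
    rw [toGeneric_wedgeD]
    exact H.vol_mem _ fun i => (a i).2
  | zero => rw [map_zero, map_zero]; exact zero_mem _
  | add m m' _ _ h h' => rw [map_add, map_add]; exact add_mem h h'
  | smul u m _ h =>
    rw [map_smul]
    change fr.vol ((u : F) • _) ∈ U
    rw [map_smul]
    exact mul_mem u.2 h

/-- The dual of the log volume form of `x`. -/
noncomputable def dualForm (H : FrobeniusFrame p U x fr κ) : DualTopForms k n U where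
  toFun m := ⟨fr.vol (toGeneric k n U m), H.vol_toGeneric_mem m⟩
  map_add' m m' := Subtype.ext (by simp)
  map_smul' u m := Subtype.ext (by
    change fr.vol (toGeneric k n U (u • m)) = u * fr.vol (toGeneric k n U m)
    rw [map_smul]
    change fr.vol ((u : F) • _) = _
    rw [map_smul]; rfl)

theorem coe_dualForm (H : FrobeniusFrame p U x fr κ) (m : TopForms k n U) :
    (H.dualForm m : F) = fr.vol (toGeneric k n U m) := rfl

theorem dualForm_var (H : FrobeniusFrame p U x fr κ) :
    (H.dualForm (wedgeD H.var) : F) = zmonomial x 1 := H.vol_toGeneric_var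

theorem dualForm_var_ne_zero (H : FrobeniusFrame p U x fr κ) :
    H.dualForm (wedgeD H.var) ≠ 0 := fun h0 =>
  zmonomial_ne_zero H.ne_zero 1 (by rw [← H.dualForm_var, h0]; rfl)

/-- Over `F` a functional is determined by its value on `dx_1 ∧ … ∧ dx_n`, which fixes `c`; the
condition `mem_of_vol` puts `c` in `U`. -/
theorem exists_eq_smul_dualForm (H : FrobeniusFrame p U x fr κ) (ν : DualTopForms k n U) :
    ∃ c : U, ν = c • H.dualForm := by
  let c : F := ν (wedgeD H.var) * (zmonomial x 1)⁻¹
  let l : U →ₗ[U] F := Algebra.linearMap U F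
  have h1 : l ∘ₗ ν - c • (l ∘ₗ H.dualForm) = 0 := by
    refine TopForms.linearMap_eq_zero H.ne_zero H.mem H.mem_laurentRing _ ?_
    change (ν (wedgeD H.var) : F) - c * H.dualForm (wedgeD H.var) = 0
    rw [dualForm_var, inv_mul_cancel_right₀ (zmonomial_ne_zero H.ne_zero 1), sub_self]
  have h2 : ∀ m, (ν m : F) = c * H.dualForm m := fun m => by
    have := LinearMap.congr_fun h1 m
    exact sub_eq_zero.1 this
  have hc : c ∈ U := H.mem_of_vol c fun a ha => by
    have := (ν (wedgeD fun i => ⟨a i, ha i⟩)).2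
    rwa [h2, coe_dualForm, toGeneric_wedgeD] at this
  exact ⟨⟨c, hc⟩, LinearMap.ext fun m => Subtype.ext (h2 m)⟩

/-- The dual of the top forms is free of rank one. -/
noncomputable def dualEquiv (H : FrobeniusFrame p U x fr κ) : U ≃ₗ[U] DualTopForms k n U :=
  LinearEquiv.ofBijective (LinearMap.toSpanSingleton U _ H.dualForm)
    ⟨by
      refine (injective_iff_map_eq_zero _).2 fun u hu => ?_
      have h1 := LinearMap.congr_fun hu (wedgeD H.var)
      exact (mul_eq_zero.1 h1).resolve_right H.dualForm_var_ne_zero,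
    fun ν => (H.exists_eq_smul_dualForm ν).imp fun _ h => h.symm⟩

theorem dualEquiv_symm_dualForm (H : FrobeniusFrame p U x fr κ) :
    H.dualEquiv.symm H.dualForm = 1 := by
  rw [LinearEquiv.symm_apply_eq]
  exact (one_smul U _).symm

/-- A generic form `η` is the functional that multiplies the dual of the log volume form by the
coordinate of `η`. -/
theorem isGenericForm_iff (H : FrobeniusFrame p U x fr κ) {θ : CanonicalModule k n U}
    {η : TopForms k n F} : IsGenericForm θ η ↔ (θ H.dualForm : F) = fr.vol η := by
  constructor
  · intro h
    obtain ⟨νF, h1, h2⟩ := h H.dualForm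
    -- The top forms of `F` are one-dimensional and spanned by the image of `dx_1 ∧ … ∧ dx_n`, so
    -- the `F`-linear extension of `dualForm` can only be `vol`.
    have h3 : νF = (fr.vol : TopForms k n F →ₗ[F] F) := by
      refine LinearMap.ext fun m => ?_
      have h4 : m = (fr.vol m * (zmonomial x 1)⁻¹) • toGeneric k n U (wedgeD H.var) := by
        apply fr.vol.injective
        rw [map_smul, H.vol_toGeneric_var, smul_eq_mul,
          inv_mul_cancel_right₀ (zmonomial_ne_zero H.ne_zero 1)]
      conv_lhs => rw [h4]
      rw [map_smul, h1, H.dualForm_var, smul_eq_mul,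
        inv_mul_cancel_right₀ (zmonomial_ne_zero H.ne_zero 1)]
      rfl
    rw [← h2, h3]; rfl
  · intro h ν
    obtain ⟨c, rfl⟩ := H.exists_eq_smul_dualForm ν
    refine ⟨(c : F) • (fr.vol : TopForms k n F →ₗ[F] F), fun m => rfl, ?_⟩
    rw [map_smul]
    change (c : F) * fr.vol η = c * θ H.dualForm
    rw [h]

theorem existsUnique_isGenericForm (H : FrobeniusFrame p U x fr κ) {η : TopForms k n F}
    (hη : fr.vol η ∈ U) : ∃! μ : CanonicalModule k n U, IsGenericForm μ η := by
  let ε : U := ⟨fr.vol η, hη⟩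
  refine ⟨ε • (H.dualEquiv.symm : DualTopForms k n U →ₗ[U] U), H.isGenericForm_iff.2 ?_,
    fun μ hμ => LinearMap.ext fun ν => ?_⟩
  · change ((ε * H.dualEquiv.symm H.dualForm : U) : F) = fr.vol η
    rw [H.dualEquiv_symm_dualForm, mul_one]
  · obtain ⟨c, rfl⟩ := H.exists_eq_smul_dualForm ν
    rw [map_smul, map_smul]
    congr 1
    change _ = ε * H.dualEquiv.symm H.dualForm
    rw [H.dualEquiv_symm_dualForm, mul_one]
    exact Subtype.ext (H.isGenericForm_iff.1 hμ)

/-- The tensor power of the dual of the log volume form. -/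
noncomputable def dualPower (H : FrobeniusFrame p U x fr κ) : CanonicalPower k n p U :=
  PiTensorProduct.tprod U fun _ => H.dualForm

theorem evalPower_smul_dualPower (H : FrobeniusFrame p U x fr κ) (u : U) (m : TopForms k n U) :
    evalPower p m (u • H.dualPower) = u * H.dualForm m ^ (p - 1) := by
  rw [map_smul, evalPower, dualPower, PiTensorProduct.lift.tprod]
  simp

theorem exists_eq_smul_dualPower (H : FrobeniusFrame p U x fr κ) (σ : CanonicalPower k n p U) :
    ∃ u : U, u • H.dualPower = σ := by
  have h1 : σ ∈ Submodule.span U (Set.range (PiTensorProduct.tprod U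
      (s := fun _ : Fin (p - 1) => DualTopForms k n U))) := by
    rw [PiTensorProduct.span_tprod_eq_top]; trivial
  have h2 : Submodule.span U (Set.range (PiTensorProduct.tprod U
      (s := fun _ : Fin (p - 1) => DualTopForms k n U))) ≤ Submodule.span U {H.dualPower} := by
    rw [Submodule.span_le]
    rintro _ ⟨ν, rfl⟩
    choose c hc using fun i => H.exists_eq_smul_dualForm (ν i)
    obtain rfl : ν = fun i => c i • H.dualForm := funext hc
    refine Submodule.mem_span_singleton.2 ⟨∏ i, c i, ?_⟩
    rw [MultilinearMap.map_smul_univ]; rfl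
  exact Submodule.mem_span_singleton.1 (h2 h1)

/-- The canonical power is free of rank one. -/
noncomputable def powerEquiv (H : FrobeniusFrame p U x fr κ) : U ≃ₗ[U] CanonicalPower k n p U :=
  LinearEquiv.ofBijective (LinearMap.toSpanSingleton U _ H.dualPower)
    ⟨by
      refine (injective_iff_map_eq_zero _).2 fun u hu => ?_
      have h1 := H.evalPower_smul_dualPower u (wedgeD H.var)
      rw [LinearMap.toSpanSingleton_apply] at hu
      rw [hu, map_zero] at h1
      exact (mul_eq_zero.1 h1.symm).resolve_right (pow_ne_zero _ H.dualForm_var_ne_zero),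
    H.exists_eq_smul_dualPower⟩

theorem powerEquiv_apply (H : FrobeniusFrame p U x fr κ) (u : U) :
    H.powerEquiv u = u • H.dualPower := rfl

variable [Fact p.Prime] [CharP k p]

/-- The trace twisted by `u`. -/
def traceHom (H : FrobeniusFrame p U x fr κ) (u : U) : PthRoot p U →ₗ[U] U where
  toFun y := ⟨κ (u * ((PthRoot.root p).symm y : U)), H.trace_mem _ (mul_mem u.2 (Subtype.mem _))⟩
  map_add' y z := Subtype.ext (by simp [mul_add])
  map_smul' v y := by
    obtain ⟨y, rfl⟩ := (PthRoot.root p).surjective y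
    refine Subtype.ext ?_
    rw [PthRoot.smul_root]
    simp only [RingEquiv.symm_apply_apply]
    change κ (u * (v ^ p * y)) = v * κ (u * y)
    rw [mul_left_comm, H.isFrobeniusTrace.map_pow_mul]

theorem traceHom_root (H : FrobeniusFrame p U x fr κ) (u y : U) :
    (H.traceHom u (PthRoot.root p y) : F) = κ (u * y) := rfl

/-- If `κ((u - v) y) = 0` on `U`, then it vanishes on all of `F`, because monomials with nonnegative
exponents span `F` over `F^p`. At `y = (u - v)⁻¹` this contradicts `κ(1) = 1`. -/
theorem traceHom_injective [PerfectField k] (H : FrobeniusFrame p U x fr κ) :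
    Function.Injective H.traceHom := by
  intro u v huv
  by_contra hne
  have h0 : (u - v : F) ≠ 0 := sub_ne_zero.2 fun h => hne (Subtype.ext h)
  have h1 : ∀ y ∈ U, κ ((u - v) * y) = 0 := fun y hy => by
    have := congrArg Subtype.val (LinearMap.congr_fun huv (PthRoot.root p ⟨y, hy⟩))
    rw [traceHom_root, traceHom_root] at this
    rw [sub_mul, map_sub, this, sub_self]
  have hS : (κ.comp (AddMonoidHom.mulLeft (u - v : F))).ker = ⊤ := by
    refine addSubgroup_eq_top_of_zmonomial_mem (k := k) p H.ne_zero H.adjoin_eq_top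
      (fun a f hf => ?_) fun b => ?_
    · change κ _ = 0 at hf
      change κ ((u - v) * (a ^ p * f)) = 0
      rw [mul_left_comm, H.isFrobeniusTrace.map_pow_mul]
      change a * κ ((u - v) * f) = 0
      rw [show κ ((u - v) * f) = 0 from hf, mul_zero]
    · obtain ⟨q, r, rfl⟩ := exists_eq_nsmul_add_finExponent (p := p) b
      change κ ((u - v) * _) = 0
      rw [zmonomial_add H.ne_zero, zmonomial_nsmul, mul_left_comm,
        H.isFrobeniusTrace.map_pow_mul, h1, mul_zero]
      exact zmonomial_mem_of_nonneg H.mem fun i => Int.natCast_nonneg _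
  have h2 : (u - v : F)⁻¹ ∈ (κ.comp (AddMonoidHom.mulLeft (u - v : F))).ker := by
    rw [hS]; trivial
  change κ ((u - v) * (u - v : F)⁻¹) = 0 at h2
  have h3 := H.isFrobeniusTrace.map_nsmul 0
  rw [smul_zero, zmonomial_zero] at h3
  rw [mul_inv_cancel₀ h0, h3] at h2
  exact one_ne_zero h2

theorem traceHom_surjective [PerfectField k] (H : FrobeniusFrame p U x fr κ) :
    Function.Surjective H.traceHom := by
  intro f
  have hκ := H.isFrobeniusTrace
  let X (r : Fin n → Fin p) : U :=
    ⟨zmonomial x (finExponent r), zmonomial_mem_of_nonneg H.mem fun i => Int.natCast_nonneg _⟩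
  let g (u : U) : F := f (PthRoot.root p u)
  have hg_add : ∀ u v, g (u + v) = g u + g v := fun u v => by simp [g]
  have hg_mul : ∀ d u : U, g (d ^ p * u) = d * g u := fun d u => by
    simp only [g, ← PthRoot.smul_root, map_smul]; rfl
  have hg_neg : ∀ u, g (-u) = -g u := fun u => by simp [g]
  have hg_zero : g 0 = 0 := by simp [g]
  -- The monomials `x^r` and `x^(-r)` with `0 ≤ r_i < p` are dual bases over `F^p` for the pairing
  -- `κ(a b)`, so `c` is chosen to give `κ(c x^r) = g(x^r)`.
  let c : F := ∑ r, g (X r) ^ p * zmonomial x (-finExponent r)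
  have hc : ∀ r, κ (c * zmonomial x (finExponent r)) = g (X r) := fun r => by
    rw [Finset.sum_mul, map_sum, Finset.sum_eq_single r]
    · rw [mul_assoc, hκ.map_pow_mul, mul_comm (zmonomial x _), ← zmonomial_add H.ne_zero,
        ← sub_eq_add_neg, hκ.map_finExponent_sub, if_pos rfl, mul_one]
    · intro r' _ hr
      rw [mul_assoc, hκ.map_pow_mul, mul_comm (zmonomial x _), ← zmonomial_add H.ne_zero,
        ← sub_eq_add_neg, hκ.map_finExponent_sub, if_neg hr.symm, mul_zero]
    · simp
  -- `T` consists of the `z` for which the extension of `g` to fractions `z = u / d^p`, namely `g(u)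
  -- / d`, agrees with `κ(c z)`. Fractions are needed because a monomial of an element of `U` may
  -- lie outside `U`.
  let T : AddSubgroup F :=
    { carrier := {z | ∃ d u : U, (d : F) ≠ 0 ∧ (u : F) = (d : F) ^ p * z ∧ g u = d * κ (c * z)}
      add_mem' := by
        rintro z z' ⟨d, u, hd, hu, hf⟩ ⟨d', u', hd', hu', hf'⟩
        refine ⟨d * d', d' ^ p * u + d ^ p * u', mul_ne_zero hd hd', ?_, ?_⟩
        · push_cast
          rw [hu, hu']; ring
        · rw [hg_add, hg_mul, hg_mul, hf, hf', mul_add, map_add]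
          push_cast; ring
      zero_mem' := ⟨1, 0, one_ne_zero, by simp, by rw [hg_zero]; simp⟩
      neg_mem' := by
        rintro z ⟨d, u, hd, hu, hf⟩
        exact ⟨d, -u, hd, by simp [hu], by rw [hg_neg, hf]; simp⟩ }
  have hT : ∀ y ∈ laurentRing k x, y ∈ T := fun y hy => by
    refine laurentRing_induction H.ne_zero (fun e b => ?_) hy
    obtain ⟨e, rfl⟩ := exists_pow_prime_eq p e
    obtain ⟨q, r, rfl⟩ := exists_eq_nsmul_add_finExponent (p := p) b
    let q' : Fin n → ℤ := fun i => (q i).natAbs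
    have hq : ∀ i, 0 ≤ (q' + q) i := fun i => by simp only [q', Pi.add_apply]; omega
    let d : U := ⟨zmonomial x q', zmonomial_mem_of_nonneg H.mem fun i => Int.natCast_nonneg _⟩
    let w : U := e • ⟨zmonomial x (q' + q), zmonomial_mem_of_nonneg H.mem hq⟩
    have hw : (w : F) = d * (algebraMap k F e * zmonomial x q) := by
      change e • zmonomial x (q' + q) = zmonomial x q' * _
      rw [zmonomial_add H.ne_zero, Algebra.smul_def]; ring
    have hz : e ^ p • zmonomial x (p • q + finExponent r) =
        (algebraMap k F e * zmonomial x q) ^ p * zmonomial x (finExponent r) := by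
      rw [zmonomial_add H.ne_zero, zmonomial_nsmul, Algebra.smul_def, map_pow]; ring
    refine ⟨d, w ^ p * X r, zmonomial_ne_zero H.ne_zero _, ?_, ?_⟩
    · rw [MulMemClass.coe_mul, SubmonoidClass.coe_pow, hw, hz, mul_pow, mul_assoc]
    · rw [hg_mul, hw, hz, mul_left_comm c, hκ.map_pow_mul, hc, mul_assoc (d : F)]
  have hf : ∀ y : U, g y = κ (c * y) := fun y => by
    obtain ⟨d, u, hd, hu, h⟩ := hT y (H.mem_laurentRing y y.2)
    obtain rfl : u = d ^ p * y := Subtype.ext hu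
    rw [hg_mul] at h
    exact mul_left_cancel₀ hd h
  have hcU : c ∈ U := H.mem_of_trace c fun y hy => by
    rw [← hf ⟨y, hy⟩]; exact Subtype.mem _
  refine ⟨⟨c, hcU⟩, LinearMap.ext fun y => ?_⟩
  obtain ⟨y, rfl⟩ := (PthRoot.root p).surjective y
  exact Subtype.ext (hf y).symm

/-- The duality isomorphism. -/
noncomputable def dualityEquiv [PerfectField k] (H : FrobeniusFrame p U x fr κ) :
    CanonicalPower k n p U ≃+ (PthRoot p U →ₗ[U] U) :=
  H.powerEquiv.symm.toAddEquiv.trans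
    (AddEquiv.ofBijective
      ({ toFun := H.traceHom
         map_zero' := LinearMap.ext fun y => Subtype.ext (by
          change κ (0 * _) = 0
          rw [zero_mul, map_zero])
         map_add' := fun u v => LinearMap.ext fun y => Subtype.ext (by
          change κ ((u + v) * _) = κ (u * _) + κ (v * _)
          rw [add_mul, map_add]) } : U →+ (PthRoot p U →ₗ[U] U))
      ⟨H.traceHom_injective, H.traceHom_surjective⟩)

theorem dualityEquiv_smul_dualPower [PerfectField k] (H : FrobeniusFrame p U x fr κ) (u : U) :
    H.dualityEquiv (u • H.dualPower) = H.traceHom u := by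
  change H.traceHom (H.powerEquiv.symm _) = _
  rw [← H.powerEquiv_apply, LinearEquiv.symm_apply_apply]

variable {τ : TopForms k n F →+ TopForms k n F}

/-- For `σ = v • dualPower` the right-hand side has coordinate `κ(u v vol(m)^(p-1) vol(m))`, and the
`p`-th power comes out of `κ` as `vol(m)`. -/
theorem isDualityIso [CharP F p] [PerfectField k] (H : FrobeniusFrame p U x fr κ)
    (hτ : IsCartierOperator p τ) : IsDualityIso p τ H.dualityEquiv where
  trace σ u m := by
    obtain ⟨v, rfl⟩ := H.exists_eq_smul_dualPower σ
    apply fr.vol.injective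
    rw [dualityEquiv_smul_dualPower, traceHom_root,
      hτ.vol_apply fr H.ne_zero H.adjoin_eq_top H.isFrobeniusTrace, map_smul, map_smul,
      evalPower_smul_dualPower, ← H.coe_dualForm, smul_eq_mul, smul_eq_mul, mul_comm (κ _),
      ← H.isFrobeniusTrace.map_pow_mul]
    congr 1
    push_cast
    rw [← pow_sub_one_mul (Fact.out : p.Prime).ne_zero (H.dualForm m : F)]
    ring
  map_smul σ u y := by
    obtain ⟨v, rfl⟩ := H.exists_eq_smul_dualPower σ
    obtain ⟨y, rfl⟩ := (PthRoot.root p).surjective y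
    refine Subtype.ext ?_
    rw [smul_smul, dualityEquiv_smul_dualPower, dualityEquiv_smul_dualPower, ← map_mul,
      traceHom_root, traceHom_root]
    push_cast
    congr 1
    ring

/-- The trace formula at a single form with nonzero image in the top forms of `F` already determines
the map. -/
theorem eq_of_isDualityIso [CharP F p] [PerfectField k] (H : FrobeniusFrame p U x fr κ)
    {Φ Ψ : CanonicalPower k n p U ≃+ (PthRoot p U →ₗ[U] U)}
    (hΦ : IsDualityIso p τ Φ) (hΨ : IsDualityIso p τ Ψ) : Φ = Ψ := by
  ext σ y
  obtain ⟨y, rfl⟩ := (PthRoot.root p).surjective y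
  have h1 := hΦ.trace σ y (wedgeD H.var)
  rw [← hΨ.trace σ y (wedgeD H.var)] at h1
  have h2 : toGeneric k n U (wedgeD H.var) ≠ 0 := fun h0 =>
    zmonomial_ne_zero H.ne_zero 1 (by rw [← H.vol_toGeneric_var, h0, map_zero])
  exact smul_left_injective F h2 h1

end FrobeniusFrame

end FrobeniusFrame

/-! ### The upper cluster algebra as a Frobenius frame, and the theorem. -/

section Main

variable {k F : Type*} [Field k] [Field F] [Algebra k F] {n : ℕ}

/-- The inverse of `μ` is `ε • dualForm`, and `ε² = 1` gives `ε^(p-1) = 1` because `p - 1` is even.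
So the choice of log volume form does not matter. -/
theorem FrobeniusFrame.dualForm_inverse {p : ℕ} {U : Subalgebra k F} {x : Fin n → F}
    {fr : LogFrame k x} {κ : F →+ F} (H : FrobeniusFrame p U x fr κ) (hp : Odd p)
    {μ : CanonicalModule k n U} {ε : U} (hε : ε * ε = 1) (hμ : μ H.dualForm = ε)
    (σ : CanonicalPower k n p U) : IsInversePower p μ σ ↔ σ = H.dualPower := by
  have h1 : ∀ c : U, μ (c • H.dualForm) = c * ε := fun c => by rw [map_smul, hμ, smul_eq_mul]
  have h2 : PiTensorProduct.tprod U (fun _ : Fin (p - 1) => ε • H.dualForm) = H.dualPower := by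
    have h4 : ε ^ (p - 1) = 1 := by
      obtain ⟨m, rfl⟩ := hp
      rw [Nat.add_sub_cancel, pow_mul, pow_two, hε, one_pow]
    rw [MultilinearMap.map_smul_univ, Finset.prod_const, Finset.card_univ, Fintype.card_fin, h4,
      one_smul]
    rfl
  have h3 : ∀ ν, μ ν = 1 → ν = ε • H.dualForm := fun ν hν => by
    obtain ⟨c, rfl⟩ := H.exists_eq_smul_dualForm ν
    rw [h1] at hν
    have : c = ε := by
      calc c = c * ε * ε := by rw [mul_assoc, hε, mul_one]
        _ = ε := by rw [hν, one_mul]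
    rw [this]
  constructor
  · rintro ⟨ν, hν, -, rfl⟩
    rw [h3 ν hν, h2]
  · rintro rfl
    exact ⟨ε • H.dualForm, by rw [h1, hε], h3, h2.symm⟩

variable {p : ℕ} [Fact p.Prime] [CharP k p]

/-- A Frobenius trace restricts to the standard splitting of the Laurent ring. -/
theorem IsFrobeniusTrace.exists_isStandardSplitting [PerfectField k] {x : Fin n → F} {κ : F →+ F}
    (hκ : IsFrobeniusTrace p x κ) (h : ∀ i, x i ≠ 0) :
    ∃ ψ : PthRoot p (laurentRing k x) →ₗ[laurentRing k x] laurentRing k x,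
      IsStandardSplitting p x ψ ∧ ∀ l, (ψ (PthRoot.root p l) : F) = κ l := by
  let ψ : PthRoot p (laurentRing k x) →ₗ[laurentRing k x] laurentRing k x :=
    { toFun := fun y => ⟨κ ((PthRoot.root p).symm y : laurentRing k x),
        hκ.mem_laurentRing h (Subtype.mem _)⟩
      map_add' := fun y z => Subtype.ext (by simp)
      map_smul' := fun v y => Subtype.ext (by
        obtain ⟨y, rfl⟩ := (PthRoot.root p).surjective y
        exact hκ.map_pow_mul v y) }
  refine ⟨ψ, ⟨fun c b => Subtype.ext ?_, fun c a ha => Subtype.ext ?_⟩, fun l => rfl⟩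
  · change κ (c ^ p • zmonomial x fun i => p * b i) = c • zmonomial x b
    have : (fun i => p * b i) = p • b := by ext i; simp
    rw [this, hκ.map_pow_smul, hκ.map_nsmul]
  · change κ (c ^ p • zmonomial x a) = 0
    rw [hκ.map_pow_smul, hκ.map_of_not_dvd a ha, smul_zero]

/-- Each condition is checked in the Laurent ring of every cluster `t`, since `vol` changes only by
a sign and `κ` not at all. For `mem_of_vol` the test form is that of the variables of `t`, whose
coordinate is, up to sign, the unit monomial `t_1 ⋯ t_n`. -/
theorem ClusterSeed.frobeniusFrame [CharP F p] [PerfectField k] (h2 : (2 : k) ≠ 0)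
    (s : ClusterSeed k F n) (fr : LogFrame k s.cluster) {κ : F →+ F}
    (hκ : IsFrobeniusTrace p s.cluster κ) :
    FrobeniusFrame p (upperClusterAlgebra s) s.cluster fr κ where
  ne_zero := s.algebraicIndependent.ne_zero
  adjoin_eq_top := s.adjoin_eq_top
  isFrobeniusTrace := hκ
  mem := MutationEquivalent.cluster_mem_upperClusterAlgebra (s := s) .refl h2
  mem_laurentRing f hf := mem_upperClusterAlgebra.1 hf s .refl
  vol_mem a ha := mem_upperClusterAlgebra.2 fun t ht => by
    obtain ⟨fr'⟩ := exists_logFrame t.algebraicIndependent t.adjoin_eq_top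
    have h3 := fr'.vol_wedgeD_mem_laurentRing t.algebraicIndependent.ne_zero
      fun i => mem_upperClusterAlgebra.1 (ha i) t ht
    rcases ht.vol_eq fr fr' with h | h <;> rw [h] at h3
    · exact h3
    · exact neg_mem_iff.1 h3
  mem_of_vol c hc := mem_upperClusterAlgebra.2 fun t ht => by
    obtain ⟨fr'⟩ := exists_logFrame t.algebraicIndependent t.adjoin_eq_top
    have h0 := t.algebraicIndependent.ne_zero
    have h3 := mem_upperClusterAlgebra.1
      (hc _ (ht.cluster_mem_upperClusterAlgebra h2)) t ht
    have h4 : c * fr'.vol (wedgeD t.cluster) ∈ laurentRing k t.cluster := by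
      rcases ht.vol_eq fr fr' with h | h <;> rw [h]
      · exact h3
      · rw [mul_neg]; exact neg_mem h3
    rw [fr'.vol_wedgeD_self h0] at h4
    have h5 := mul_mem h4 (zmonomial_mem_laurentRing (k := k) (x := t.cluster) (-1))
    rwa [mul_assoc, ← zmonomial_add h0, add_neg_cancel, zmonomial_zero, mul_one] at h5
  trace_mem y hy := mem_upperClusterAlgebra.2 fun t ht =>
    (ht.isFrobeniusTrace hκ).mem_laurentRing t.algebraicIndependent.ne_zero
      (mem_upperClusterAlgebra.1 hy t ht)
  mem_of_trace c hc := mem_upperClusterAlgebra.2 fun t ht =>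
    (ht.isFrobeniusTrace hκ).mem_laurentRing_of_forall t.algebraicIndependent.ne_zero
      t.adjoin_eq_top (ht.cluster_mem_upperClusterAlgebra h2)
      fun y hy => mem_upperClusterAlgebra.1 (hc y hy) t ht

end Main

/-- The duality isomorphism sends the `(1-p)`-th power of a log volume form to the cluster
splitting. -/
theorem mainTheorem12 {k F : Type*} [Field k] [PerfectField k] [Field F] [Algebra k F]
    (p : ℕ) [Fact p.Prime] [CharP k p] (hp : Odd p) {n : ℕ} (s : ClusterSeed k F n) :
    -- the trace map exists and is unique
    (∃! τ : TopForms k n F →+ TopForms k n F, IsCartierOperator p τ) ∧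
    ∀ τ : TopForms k n F →+ TopForms k n F, IsCartierOperator p τ →
      -- the duality isomorphism exists and is unique
      (∃! Φ : CanonicalPower k n p (upperClusterAlgebra s) ≃+
          (PthRoot p (upperClusterAlgebra s) →ₗ[upperClusterAlgebra s] upperClusterAlgebra s),
        IsDualityIso p τ Φ) ∧
      ∀ Φ : CanonicalPower k n p (upperClusterAlgebra s) ≃+
          (PthRoot p (upperClusterAlgebra s) →ₗ[upperClusterAlgebra s] upperClusterAlgebra s),
        IsDualityIso p τ Φ →
        ∀ η : TopForms k n F, IsLogVolumeForm s η →
          -- `η` lies in the canonical module, as the element `μ`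
          (∃! μ : CanonicalModule k n (upperClusterAlgebra s), IsGenericForm μ η) ∧
          ∀ μ : CanonicalModule k n (upperClusterAlgebra s), IsGenericForm μ η →
            -- `μ ^ (1 - p)` makes sense, and its image is the cluster splitting
            (∃ σ, IsInversePower p μ σ) ∧
            ∀ σ, IsInversePower p μ σ → IsClusterSplitting p s (Φ σ) := by
  have : CharP F p := charP_of_injective_algebraMap (algebraMap k F).injective p
  have h2 : (2 : k) ≠ 0 := Ring.two_ne_zero (by
    rw [ringChar.eq k p]
    rintro rfl
    exact absurd hp (by decide))
  obtain ⟨fr⟩ := exists_logFrame s.algebraicIndependent s.adjoin_eq_top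
  have h0 : ∀ i, s.cluster i ≠ 0 := s.algebraicIndependent.ne_zero
  obtain ⟨κ, hκ⟩ := exists_isFrobeniusTrace p fr h0 s.adjoin_eq_top
  have H := s.frobeniusFrame h2 fr hκ
  refine ⟨⟨_, fr.isCartierOperator h0 s.adjoin_eq_top hκ, fun τ hτ => ?_⟩, fun τ hτ =>
    ⟨⟨_, H.isDualityIso hτ, fun Φ hΦ => H.eq_of_isDualityIso hΦ (H.isDualityIso hτ)⟩,
      fun Φ hΦ η hη => ?_⟩⟩
  · ext1 ω
    apply fr.vol.injective
    rw [hτ.vol_apply fr h0 s.adjoin_eq_top hκ]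
    simp
  obtain rfl := H.eq_of_isDualityIso hΦ (H.isDualityIso hτ)
  -- All log volume forms are `±` that of the initial cluster, so the coordinate of `η` is a sign
  -- `ε`.
  obtain ⟨ε, hε, hεη⟩ : ∃ ε : upperClusterAlgebra s, ε * ε = 1 ∧ (ε : F) = fr.vol η := by
    have h1 := fr.vol_logVolumeForm h0
    rcases hη.eq_or with rfl | rfl
    · exact ⟨1, one_mul 1, h1.symm⟩
    · exact ⟨-1, by ring, by rw [map_neg, h1]; simp⟩
  refine ⟨H.existsUnique_isGenericForm (hεη ▸ ε.2), fun μ hμ => ?_⟩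
  have hμε : μ H.dualForm = ε := Subtype.ext (by rw [hεη, H.isGenericForm_iff.1 hμ])
  have hσ := H.dualForm_inverse hp hε hμε
  refine ⟨⟨_, (hσ _).2 rfl⟩, fun σ h => ?_⟩
  obtain rfl := (hσ σ).1 h
  -- The image of `dualPower` is the trace twisted by `1`, that is `κ` on `U`, and `κ` is the
  -- standard splitting in every cluster.
  intro t ht
  obtain ⟨ψ, hψ, hψκ⟩ :=
    (ht.isFrobeniusTrace hκ).exists_isStandardSplitting (k := k) t.algebraicIndependent.ne_zero
  refine ⟨ψ, hψ, fun u l hul => ?_⟩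
  rw [hψκ, ← hul]
  have := H.dualityEquiv_smul_dualPower 1
  rw [one_smul] at this
  rw [this, H.traceHom_root, OneMemClass.coe_one, one_mul]
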